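/- **Lemma (Convergence of functions transported by the flow).** Let $\Omega\subset\mathbb R^d$ and $T>0$. A *mesh* of $\Omega$ is a finite family of pairwise disjoint open bounded polytopal (polygonal, polyhedral) cells, not necessarily convex, such that $\Omega$ is the interior of the union of the closed cells. Let $0<\phi_*\le\phi^*$ and $\Gamma_{\rm div}\ge 0$. A pair $(\phi,\mathbf V)$ with $\phi:\Omega\to\mathbb R$, $\mathbf V:\Omega\to\mathbb R^d$ is *admissible* if there is a mesh of $\Omega$ on which $\phi$ is piecewise smooth (smooth up to the boundary of each cell) and $\mathbf V$ is piecewise polynomial, and if $\phi_*\le\phi\le\phi^*$ on $\Omega$, $\mathbf V\in H_{\rm div}(\Omega)$, $|{\rm div}\,\mathbf V|\le\Gamma_{\rm div}$ a.e. on $\Omega$ and $\mathbf V\cdot\mathbf n=0$ on $\partial\Omega$. The *flow* $F_t(x)$, $t\in[-T,T]$, of an admissible pair is defined for a.e. $x\in\Omega$: $t\mapsto F_t(x)\in\Omega$ is the Lipschitz curve with $F_0(x)=x$ which, except at countably many times $t$, lies in the interior of a mesh cell and satisfies $\frac{d}{dt}F_t(x)=\mathbf V(F_t(x))/\phi(F_t(x))$.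 For time steps $0=t^{(0)}<t^{(1)}<\dots<t^{(N)}=T$ and velocities $\mathbf V=(\mathbf V^{n})_{n=1,\dots,N}$ such that every $(\phi,\mathbf V^{n})$ is admissible, let $F^{(n)}$ be the flow for $\mathbf V^{n}$, identify $\mathbf V$ with the function on $\Omega\times(0,T)$ equal to $\mathbf V^{n+1}$ for $t\in(t^{(n)},t^{(n+1)}]$, and define, for $\psi\in L^2(\Omega\times(0,T))$, a.e. $x\in\Omega$ and $t\in(t^{(n)},t^{(n+1)})$, $n=0,\dots,N-1$, $$\mathcal T_{\mathbf V}\psi(x,t)=\psi\big(F^{(n+1)}_{t^{(n+1)}-t^{(n)}}(x),t\big),\qquad \widehat{\mathcal T}_{\mathbf V}\psi(x,t)=\psi\big(F^{(n+1)}_{t^{(n+1)}-t}(x),t\big).$$ For each $m\in\mathbb N$ let $0=t_m^{(0)}<\dots<t_m^{(N_m)}=T$ be time steps and $\mathbf V_m=(\mathbf V_m^n)_{n=1,\dots,N_m}$ be such that all $(\phi,\mathbf V_m^n)$ are admissible, with $\phi,\phi_*,\phi^*,\Gamma_{\rm div}$ not depending on $m$ and $n$ (the meshes may depend on them). Assume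 that $\max_n (t_m^{(n+1)}-t_m^{(n)})\to0$ as $m\to\infty$ and that $(\mathbf V_m)_m$ is bounded in $L^2(\Omega\times(0,T))^d$. Then $\mathcal T_{\mathbf V_m}$ and $\widehat{\mathcal T}_{\mathbf V_m}$ are well-defined bounded linear operators on $L^2(\Omega\times(0,T))$ and: 1. There is $C$ not depending on $m$ such that, for all $\psi\in L^2(\Omega\times(0,T))$, $\|\mathcal T_{\mathbf V_m}\psi\|_{L^2}+\|\widehat{\mathcal T}_{\mathbf V_m}\psi\|_{L^2}\le C\|\psi\|_{L^2}$. 2. For each $m$ there are $R_m,\widehat R_m\in L^\infty(\Omega\times(0,T))$ such that the adjoints of $\mathcal T_{\mathbf V_m}$ and $\widehat{\mathcal T}_{\mathbf V_m}$ are given, for $\psi\in L^2(\Omega\times(0,T))$, by $$\mathcal T_{\mathbf V_m}^*\psi=\phi\,\mathcal T_{-\mathbf V_m}\Big(\frac{\psi}{\phi}\Big)+R_m\,\mathcal T_{-\mathbf V_m}\psi,\qquad \widehat{\mathcal T}_{\mathbf V_m}^*\psi=\phi\,\widehat{\mathcal T}_{-\mathbf V_m}\Big(\frac{\psi}{\phi}\Big)+\widehat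 R_m\,\widehat{\mathcal T}_{-\mathbf V_m}\psi,$$ and, for $n=0,\dots,N_m-1$, $|R_m|$ and $|\widehat R_m|$ are bounded a.e. on $\Omega\times[t_m^{(n)},t_m^{(n+1)}]$ by $(t_m^{(n+1)}-t_m^{(n)})\,\phi_*^{-1}\,\Gamma_{\rm div}\,C_1(T)$, where $C_1(T)=\frac{\phi^*}{\phi_*}\exp\big(\frac{\Gamma_{\rm div}}{\phi_*}T\big)$. 3. If $f_m\to f$ strongly (resp. weakly) in $L^2(\Omega\times(0,T))$, then $\mathcal T_{\mathbf V_m}f_m\to f$ and $\widehat{\mathcal T}_{\mathbf V_m}f_m\to f$ strongly (resp. weakly) in $L^2(\Omega\times(0,T))$. -/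

import Mathlib

open MeasureTheory Set Filter Topology
open scoped ContDiff NNReal ENNReal

noncomputable section

/-- Points of `ℝ^d` with the Euclidean norm. -/
abbrev Pt (d : ℕ) : Type := EuclideanSpace ℝ (Fin d)

/-- Open polygonal (`d = 2`), polyhedral (`d = 3`), polytopal (general `d`) sets, not necessarily
convex: bounded regular open sets whose boundary lies on finitely many hyperplanes. -/
structure IsPolytopal {d : ℕ} (K : Set (Pt d)) : Prop where
  regular : interior (closure K) = K
  bounded : Bornology.IsBounded K
  flat : ∃ H : Finset (Pt d × ℝ), (∀ h ∈ H, h.1 ≠ 0) ∧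
    ∀ x ∈ frontier K, ∃ h ∈ H, inner ℝ h.1 x = h.2

/-- A mesh of `Ω`: a finite partition of `Ω`, up to the cell boundaries, into open polytopal cells.
Hanging nodes and non-convex cells are allowed. -/
structure PolytopalMesh {d : ℕ} (Ω : Set (Pt d)) where
  cells : Set (Set (Pt d))
  finite : cells.Finite
  polytopal : ∀ K ∈ cells, IsPolytopal K
  disjoint : ∀ K ∈ cells, ∀ L ∈ cells, K ≠ L → Disjoint K L
  cover : interior (⋃ K ∈ cells, closure K) = Ω

/-- `φ` is piecewise smooth on the mesh: on each cell it is smooth up to the boundary. -/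
def PiecewiseSmooth {d : ℕ} {Ω : Set (Pt d)} (M : PolytopalMesh Ω) (φ : Pt d → ℝ) : Prop :=
  ∀ K ∈ M.cells, ∃ φK : Pt d → ℝ, ContDiff ℝ ∞ φK ∧ ∀ x ∈ K, φ x = φK x

/-- `V` is piecewise polynomial on the mesh. -/
def PiecewisePolynomial {d : ℕ} {Ω : Set (Pt d)} (M : PolytopalMesh Ω) (V : Pt d → Pt d) : Prop :=
  ∀ K ∈ M.cells, ∃ P : Fin d → MvPolynomial (Fin d) ℝ,
    ∀ x ∈ K, ∀ i, V x i = MvPolynomial.eval (fun j => x j) (P i)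

/-- `V ∈ H_div(Ω)` with weak divergence `g`; `fderiv ℝ w x (V x)` is `V · ∇w` at `x`. -/
structure IsHdiv {d : ℕ} (Ω : Set (Pt d)) (V : Pt d → Pt d) (g : Pt d → ℝ) : Prop where
  memLp : MemLp V 2 (volume.restrict Ω)
  memLp_div : MemLp g 2 (volume.restrict Ω)
  weak_div : ∀ w : Pt d → ℝ, ContDiff ℝ ∞ w → HasCompactSupport w → tsupport w ⊆ Ω →
    ∫ x in Ω, fderiv ℝ w x (V x) = - ∫ x in Ω, g x * w x

/-- `V · n = 0` on `∂Ω` for a field `V` with weak divergence `g`: the boundary term in the Stokes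
formula `∫_Ω (V · ∇w + w div V) = ∫_{∂Ω} w V · n` vanishes for all `w` smooth up to `∂Ω`. -/
def ZeroNormalTrace {d : ℕ} (Ω : Set (Pt d)) (V : Pt d → Pt d) (g : Pt d → ℝ) : Prop :=
  ∀ w : Pt d → ℝ, ContDiff ℝ ∞ w →
    (∫ x in Ω, fderiv ℝ w x (V x)) + (∫ x in Ω, g x * w x) = 0

/-- The standing assumption on the porosity `φ` and on a velocity `V`, with respect to a common
mesh: `φ` is piecewise smooth with `φmin ≤ φ ≤ φmax`, and `V ∈ H_div(Ω)` is piecewise polynomial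
with `|div V| ≤ Γ` and `V · n = 0` on `∂Ω`. -/
structure IsAdmissible {d : ℕ} {Ω : Set (Pt d)} (M : PolytopalMesh Ω) (φ : Pt d → ℝ)
    (φmin φmax : ℝ) (V : Pt d → Pt d) (Γ : ℝ) : Prop where
  phi_smooth : PiecewiseSmooth M φ
  phi_bounds : ∀ x ∈ Ω, φmin ≤ φ x ∧ φ x ≤ φmax
  poly : PiecewisePolynomial M V
  hdiv : ∃ g : Pt d → ℝ, IsHdiv Ω V g ∧ (∀ᵐ x ∂(volume.restrict Ω), |g x| ≤ Γ) ∧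
    ZeroNormalTrace Ω V g

/-- `γ` is a characteristic of `V / φ` on `[-T, T]` that starts at `x`: a Lipschitz curve in `Ω`
with `γ 0 = x` which, except at countably many times, is in the interior of a cell and satisfies
`γ' = V(γ) / φ(γ)`. (On cell boundaries `V` and `φ` have no values that mean anything.) -/
structure IsFlowLine {d : ℕ} {Ω : Set (Pt d)} (M : PolytopalMesh Ω) (φ : Pt d → ℝ)
    (V : Pt d → Pt d) (T : ℝ) (x : Pt d) (γ : ℝ → Pt d) : Prop where
  start : γ 0 = x
  lipschitz : ∃ L : ℝ≥0, LipschitzOnWith L γ (Icc (-T) T)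
  mem : ∀ t ∈ Icc (-T) T, γ t ∈ Ω
  ode : ∃ S : Set ℝ, S.Countable ∧ ∀ t ∈ Ioo (-T) T \ S,
    (∃ K ∈ M.cells, γ t ∈ K) ∧ HasDerivAt γ ((φ (γ t))⁻¹ • V (γ t)) t

open Classical in
/-- The flow `F_t(x)` of `V / φ`, for `t ∈ [-T, T]`. Where there is no characteristic that starts
at `x`, the value is `x`. -/
def flow {d : ℕ} {Ω : Set (Pt d)} (M : PolytopalMesh Ω) (φ : Pt d → ℝ)
    (V : Pt d → Pt d) (T : ℝ) (t : ℝ) (x : Pt d) : Pt d :=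
  if h : ∃ γ : ℝ → Pt d, IsFlowLine M φ V T x γ then h.choose t else x

/-- Lebesgue measure on `Ω × (0, T)`. -/
abbrev spaceTime {d : ℕ} (Ω : Set (Pt d)) (T : ℝ) : Measure (Pt d × ℝ) :=
  (volume.restrict Ω).prod (volume.restrict (Ioo 0 T))

/-- The Hilbert space `L²(Ω × (0, T))`. -/
abbrev L2 {d : ℕ} (Ω : Set (Pt d)) (T : ℝ) : Type := Lp ℝ 2 (spaceTime Ω T)

/-- `0 = t 0 < t 1 < ⋯ < t N = T`. -/
structure IsTimeGrid (T : ℝ) (N : ℕ) (t : ℕ → ℝ) : Prop where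
  zero : t 0 = 0
  last : t N = T
  lt : ∀ n < N, t n < t (n + 1)

/-- The largest time step. -/
def maxStep (N : ℕ) (t : ℕ → ℝ) : ℝ := ⨆ n : Fin N, (t (n + 1) - t n)

/-- The space-time velocity equal to `V n` for times in `(t n, t (n + 1)]`, `n < N`. -/
def globalVelocity {d : ℕ} (N : ℕ) (t : ℕ → ℝ) (V : ℕ → Pt d → Pt d) (p : Pt d × ℝ) : Pt d :=
  ∑ n ∈ Finset.range N, (Ioc (t n) (t (n + 1))).indicator (fun _ => V n p.1) p.2

/-- `(𝒯 ψ)(x, s) = ψ(F^n_{t (n + 1) - t n}(x), s)` for `s ∈ (t n, t (n + 1))`, `n < N`, where `F^n`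
is the flow of `V n / φ`. -/
def transport {d : ℕ} {Ω : Set (Pt d)} (T : ℝ) (φ : Pt d → ℝ) (N : ℕ) (t : ℕ → ℝ)
    (M : ℕ → PolytopalMesh Ω) (V : ℕ → Pt d → Pt d) (ψ : Pt d × ℝ → ℝ) (p : Pt d × ℝ) : ℝ :=
  ∑ n ∈ Finset.range N, (Ioo (t n) (t (n + 1))).indicator
    (fun s => ψ (flow (M n) φ (V n) T (t (n + 1) - t n) p.1, s)) p.2

/-- `(𝒯̂ ψ)(x, s) = ψ(F^n_{t (n + 1) - s}(x), s)` for `s ∈ (t n, t (n + 1))`, `n < N`, where `F^n`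
is the flow of `V n / φ`. -/
def transportHat {d : ℕ} {Ω : Set (Pt d)} (T : ℝ) (φ : Pt d → ℝ) (N : ℕ) (t : ℕ → ℝ)
    (M : ℕ → PolytopalMesh Ω) (V : ℕ → Pt d → Pt d) (ψ : Pt d × ℝ → ℝ) (p : Pt d × ℝ) : ℝ :=
  ∑ n ∈ Finset.range N, (Ioo (t n) (t (n + 1))).indicator
    (fun s => ψ (flow (M n) φ (V n) T (t (n + 1) - s) p.1, s)) p.2

/-- The operator `A` on `L²(Ω × (0, T))` is the one given by the map `τ` on functions, whatever the
representative of the argument. -/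
def IsInducedBy {d : ℕ} {Ω : Set (Pt d)} {T : ℝ} (A : L2 Ω T →L[ℝ] L2 Ω T)
    (τ : (Pt d × ℝ → ℝ) → (Pt d × ℝ → ℝ)) : Prop :=
  ∀ (ψ : Pt d × ℝ → ℝ) (hψ : MemLp ψ 2 (spaceTime Ω T)),
    A (hψ.toLp ψ) =ᵐ[spaceTime Ω T] τ ψ

/-- Weak convergence of a sequence in `L²(Ω × (0, T))`. -/
def WeaklyTendsto {d : ℕ} {Ω : Set (Pt d)} {T : ℝ} (f : ℕ → L2 Ω T) (f₀ : L2 Ω T) : Prop :=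
  ∀ g : L2 Ω T, Tendsto (fun m => inner ℝ (f m) g) atTop (𝓝 (inner ℝ f₀ g))

/-- The constant `C₁(s) = (φmax / φmin) exp (Γ |s| / φmin)`. -/
def jacobianBound (φmin φmax Γ s : ℝ) : ℝ := φmax / φmin * Real.exp (Γ / φmin * |s|)

end

set_option linter.unusedSectionVars false
/-! ### The global flow of a bounded Lipschitz field -/

/-- `X` is the global flow of the autonomous vector field `b`. -/
structure IsGlobalFlow {E : Type*} [NormedAddCommGroup E] [NormedSpace ℝ E] (b : E → E)
    (X : ℝ → E → E) : Prop where
  zero : ∀ x, X 0 x = x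
  deriv : ∀ x t, HasDerivAt (fun s => X s x) (b (X t x)) t

section GlobalFlow

variable {E : Type*} [NormedAddCommGroup E] [NormedSpace ℝ E] {b : E → E} {X : ℝ → E → E}
  {K L : ℝ≥0}

theorem exists_isGlobalFlow [CompleteSpace E] (hb : LipschitzWith K b) (hL : ∀ x, ‖b x‖ ≤ L) :
    ∃ X : ℝ → E → E, IsGlobalFlow b X := by
  have key : ∀ (n : ℕ) (x : E), ∃ α : ℝ → E, α 0 = x ∧
      ∀ t ∈ Ioo (-(n + 1) : ℝ) (n + 1), HasDerivAt α (b (α t)) t := by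
    intro n x
    have h0 : (0 : ℝ) ∈ Icc (-(n + 1) : ℝ) (n + 1) := ⟨by linarith [n.cast_nonneg (α := ℝ)],
      by positivity⟩
    have hP : IsPicardLindelof (fun _ => b) (⟨0, h0⟩ : Icc (-(n + 1) : ℝ) (n + 1)) x
        (L * (n + 1)) 0 L K :=
      { lipschitzOnWith := fun _ _ => hb.lipschitzOnWith
        continuousOn := fun _ _ => continuousOn_const
        norm_le := fun _ _ y _ => hL y
        mul_max_le := by simp }
    obtain ⟨α, h1, h2⟩ := hP.exists_eq_forall_mem_Icc_hasDerivWithinAt₀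
    exact ⟨α, h1, fun t ht => (h2 t (Ioo_subset_Icc_self ht)).hasDerivAt (Icc_mem_nhds ht.1 ht.2)⟩
  choose α h1 h2 using key
  have huniq : ∀ (m n : ℕ) (x : E), m ≤ n → EqOn (α m x) (α n x) (Ioo (-(m + 1) : ℝ) (m + 1)) := by
    intro m n x hmn
    have hc : (m : ℝ) ≤ n := by exact_mod_cast hmn
    refine ODE_solution_unique_of_mem_Ioo (v := fun _ => b) (s := fun _ => univ) (t₀ := 0)
      (fun t _ => hb.lipschitzOnWith) ⟨by linarith [m.cast_nonneg (α := ℝ)], by positivity⟩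
      (fun t ht => ⟨h2 m x t ht, trivial⟩)
      (fun t ht => ⟨h2 n x t ⟨by linarith [ht.1], by linarith [ht.2]⟩, trivial⟩) ?_
    rw [h1, h1]
  refine ⟨fun t x => α ⌈|t|⌉₊ x t, fun x => by simp [h1], fun x t => ?_⟩
  have ht : t ∈ Ioo (-((⌈|t|⌉₊ : ℝ) + 1)) (⌈|t|⌉₊ + 1) := by
    have := Nat.le_ceil |t|
    have := abs_le.1 this
    constructor <;> linarith [this.1, this.2]
  refine (h2 _ x t ht).congr_of_eventuallyEq ?_
  filter_upwards [Ioo_mem_nhds ht.1 ht.2] with s hs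
  rcases le_total ⌈|s|⌉₊ ⌈|t|⌉₊ with h | h
  · refine huniq _ _ x h ?_
    have := abs_le.1 (Nat.le_ceil |s|)
    constructor <;> linarith [this.1, this.2]
  · exact (huniq _ _ x h hs).symm

namespace IsGlobalFlow

theorem add (hX : IsGlobalFlow b X) (hb : LipschitzWith K b) (s t : ℝ) (x : E) :
    X (s + t) x = X s (X t x) := by
  have := ODE_solution_unique_univ (v := fun _ => b) (s := fun _ => univ) (K := K) (t₀ := 0)
    (f := fun s => X (s + t) x) (g := fun s => X s (X t x)) (fun _ => hb.lipschitzOnWith)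
    (fun r => ⟨(hX.deriv x (r + t)).comp_add_const r t, trivial⟩)
    (fun r => ⟨hX.deriv _ r, trivial⟩) (by simp [hX.zero])
  exact congrFun this s

theorem neg (hX : IsGlobalFlow b X) : IsGlobalFlow (fun x => -b x) (fun t => X (-t)) where
  zero x := by simp [hX.zero]
  deriv x t := by
    have := (hX.deriv x (-t)).scomp t (hasDerivAt_neg t)
    simpa [Function.comp_def] using this

theorem dist_le_of_nonneg (hX : IsGlobalFlow b X) (hb : LipschitzWith K b) {t : ℝ} (ht : 0 ≤ t)
    (x y : E) : dist (X t x) (X t y) ≤ dist x y * Real.exp (K * t) := by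
  have := dist_le_of_trajectories_ODE (v := fun _ => b) (K := K) (a := 0) (b := t)
    (f := fun s => X s x) (g := fun s => X s y) (δ := dist x y) (fun _ => hb)
    (HasDerivAt.continuousOn fun s _ => hX.deriv x s)
    (fun s _ => (hX.deriv x s).hasDerivWithinAt)
    (HasDerivAt.continuousOn fun s _ => hX.deriv y s)
    (fun s _ => (hX.deriv y s).hasDerivWithinAt) (by simp [hX.zero]) t ⟨ht, le_rfl⟩
  simpa using this

theorem dist_le (hX : IsGlobalFlow b X) (hb : LipschitzWith K b) (t : ℝ)
    (x y : E) : dist (X t x) (X t y) ≤ dist x y * Real.exp (K * |t|) := by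
  rcases le_total 0 t with h | h
  · rw [abs_of_nonneg h]; exact hX.dist_le_of_nonneg hb h x y
  · rw [abs_of_nonpos h]
    have := hX.neg.dist_le_of_nonneg hb.neg (neg_nonneg.2 h) x y
    simpa using this

theorem lipschitzWith_space (hX : IsGlobalFlow b X) (hb : LipschitzWith K b) (t : ℝ) :
    LipschitzWith (Real.exp (K * |t|)).toNNReal (X t) :=
  LipschitzWith.of_dist_le_mul fun x y => by
    rw [Real.coe_toNNReal _ (Real.exp_nonneg _), mul_comm]
    exact hX.dist_le hb t x y

theorem lipschitzWith_time (hX : IsGlobalFlow b X) (hL : ∀ x, ‖b x‖ ≤ L) (x : E) :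
    LipschitzWith L (fun t => X t x) :=
  lipschitzWith_of_nnnorm_deriv_le (fun t => (hX.deriv x t).differentiableAt) fun t => by
    rw [(hX.deriv x t).deriv]; exact hL _

theorem continuous_uncurry (hX : IsGlobalFlow b X) (hb : LipschitzWith K b)
    (hL : ∀ x, ‖b x‖ ≤ L) : Continuous (Function.uncurry X) := by
  exact continuous_prod_of_continuous_lipschitzWith _ L
    (fun t => (hX.lipschitzWith_space hb t).continuous) fun x => hX.lipschitzWith_time hL x

theorem isCompact_preimage (hX : IsGlobalFlow b X) (hb : LipschitzWith K b) {s : Set E}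
    (hs : IsCompact s) (t : ℝ) : IsCompact (X t ⁻¹' s) := by
  have : X t ⁻¹' s = X (-t) '' s := by
    ext x
    constructor
    · intro hx
      exact ⟨X t x, hx, by rw [← hX.add hb, neg_add_cancel, hX.zero]⟩
    · rintro ⟨y, hy, rfl⟩
      rw [mem_preimage, ← hX.add hb, add_neg_cancel, hX.zero]
      exact hy
  rw [this]
  exact hs.image (hX.lipschitzWith_space hb _).continuous

end IsGlobalFlow

end GlobalFlow

section QuasiInvariance

variable {E : Type*} [NormedAddCommGroup E] [InnerProductSpace ℝ E] [FiniteDimensional ℝ E]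
  [MeasurableSpace E] [BorelSpace E]

/-- Integration by parts of a Lipschitz function against a `C¹` field with compact support. -/
theorem integral_fderiv_apply_eq_neg_integral_mul_trace {u : E → ℝ} {C : ℝ≥0}
    (hu : LipschitzWith C u) {V : E → E} (hV : ContDiff ℝ 1 V) (hVc : HasCompactSupport V) :
    ∫ x, fderiv ℝ u x (V x) = -∫ x, u x * LinearMap.trace ℝ E (fderiv ℝ V x) := by
  classical
  set e := stdOrthonormalBasis ℝ E
  have hcomp : ∀ i, ContDiff ℝ 1 (fun x => inner ℝ (e i) (V x)) := fun i =>
    contDiff_const.inner ℝ hV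
  have hcompc : ∀ i, HasCompactSupport (fun x => inner ℝ (e i) (V x)) := fun i =>
    hVc.comp_left (g := fun v => inner ℝ (e i) v) (by simp)
  have hlip : ∀ i, ∃ D, LipschitzWith D (fun x => inner ℝ (e i) (V x)) := fun i =>
    (hcomp i).lipschitzWith_of_hasCompactSupport (hcompc i) (by norm_num)
  choose D hD using hlip
  have h1 : ∀ᵐ x : E, fderiv ℝ u x (V x) =
      ∑ i, lineDeriv ℝ u x (e i) * inner ℝ (e i) (V x) := by
    filter_upwards [hu.ae_differentiableAt] with x hx
    conv_lhs => rw [← e.sum_repr' (V x)]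
    rw [map_sum]
    refine Finset.sum_congr rfl fun i _ => ?_
    rw [map_smul, hx.lineDeriv_eq_fderiv, smul_eq_mul, mul_comm]
  have h2 : ∀ i x, lineDeriv ℝ (fun x => inner ℝ (e i) (V x)) x (-(e i)) =
      -inner ℝ (e i) (fderiv ℝ V x (e i)) := by
    intro i x
    have hd : DifferentiableAt ℝ V x := hV.differentiable (by norm_num) x
    rw [(((hcomp i).differentiable (by norm_num)) x).lineDeriv_eq_fderiv, map_neg]
    congr 1
    have := ((hasFDerivAt_const (e i) x).inner ℝ hd.hasFDerivAt).fderiv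
    rw [this]
    simp
  have hint : ∀ i, Integrable (fun x => lineDeriv ℝ u x (e i) * inner ℝ (e i) (V x)) := by
    intro i
    have hc : Integrable (fun x => inner ℝ (e i) (V x)) :=
      (hcomp i).continuous.integrable_of_hasCompactSupport (hcompc i)
    refine hc.bdd_mul (c := C * ‖e i‖) (measurable_lineDeriv hu.continuous).aestronglyMeasurable
      (ae_of_all _ fun x => ?_)
    exact norm_lineDeriv_le_of_lipschitz ℝ hu
  rw [integral_congr_ae h1, integral_finsetSum _ fun i _ => hint i]
  simp_rw [fun i => LipschitzWith.integral_lineDeriv_mul_eq (μ := volume) hu (hD i) (hcompc i) (e i), h2]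
  rw [← integral_finsetSum, ← integral_neg]
  · refine integral_congr_ae (ae_of_all _ fun x => ?_)
    simp only [LinearMap.trace_eq_sum_inner _ e, ContinuousLinearMap.coe_coe, Finset.mul_sum]
    rw [← Finset.sum_neg_distrib]
    exact Finset.sum_congr rfl fun i _ => by ring
  · intro i _
    have hcd : Continuous (fun x => -inner ℝ (e i) (fderiv ℝ V x (e i)) * u x) := by
      have := hV.continuous_fderiv (by norm_num)
      have := hu.continuous
      fun_prop
    refine hcd.integrable_of_hasCompactSupport ?_
    refine HasCompactSupport.mul_right ?_
    exact (hVc.fderiv ℝ).comp_left (g := fun A : E →L[ℝ] E => -inner ℝ (e i) (A (e i))) (by simp)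

theorem measure_le_of_forall_lipschitz {ν μ : Measure E} [IsFiniteMeasureOnCompacts ν]
    [IsFiniteMeasureOnCompacts μ] [SigmaFinite ν] {C : ℝ} (hC : 0 ≤ C)
    (h : ∀ f : E → ℝ, (∃ D, LipschitzWith D f) → HasCompactSupport f → (∀ x, 0 ≤ f x) →
      ∫ x, f x ∂ν ≤ C * ∫ x, f x ∂μ) : ν ≤ ENNReal.ofReal C • μ := by
  have hK : ∀ K : Set E, IsCompact K → ν K ≤ ENNReal.ofReal C * μ K := by
    intro K hK
    have hr : ∀ r : ℝ, 0 < r → ν K ≤ ENNReal.ofReal C * μ (Metric.cthickening r K) := by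
      intro r hr
      set f : E → ℝ := fun x => (thickenedIndicator hr K x : ℝ)
      have hf0 : ∀ x, 0 ≤ f x := fun x => NNReal.coe_nonneg _
      have hf1 : ∀ x, f x ≤ 1 := fun x => by exact_mod_cast thickenedIndicator_le_one hr K x
      have hsupp : ∀ x, x ∉ Metric.cthickening r K → f x = 0 := by
        intro x hx
        have := thickenedIndicator_zero hr K (x := x)
          (fun hx' => hx (Metric.thickening_subset_cthickening _ _ hx'))
        simp only [f, this, NNReal.coe_zero]
      have hcomp : HasCompactSupport f := by
        refine HasCompactSupport.intro hK.cthickening (fun x hx => hsupp x hx)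
      have hlip : LipschitzWith (r.toNNReal)⁻¹ f := lipschitzWith_thickenedIndicator hr K
      have hiν : Integrable f ν := hlip.continuous.integrable_of_hasCompactSupport hcomp
      have hiμ : Integrable f μ := hlip.continuous.integrable_of_hasCompactSupport hcomp
      have hfi := h f ⟨_, hlip⟩ hcomp hf0
      have e1 : ν K ≤ ENNReal.ofReal (∫ x, f x ∂ν) := by
        rw [ofReal_integral_eq_lintegral_ofReal hiν (ae_of_all _ hf0)]
        calc ν K = ∫⁻ x, K.indicator 1 x ∂ν := by
              rw [lintegral_indicator_one hK.measurableSet]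
          _ ≤ _ := lintegral_mono fun x => by
              by_cases hx : x ∈ K
              · have := thickenedIndicator_one hr K hx
                simp only [hx, indicator_of_mem, Pi.one_apply, f, this, NNReal.coe_one,
                  ENNReal.ofReal_one, le_refl]
              · simp [hx]
      have e2 : ENNReal.ofReal (∫ x, f x ∂μ) ≤ μ (Metric.cthickening r K) := by
        rw [ofReal_integral_eq_lintegral_ofReal hiμ (ae_of_all _ hf0)]
        calc _ ≤ ∫⁻ x, (Metric.cthickening r K).indicator 1 x ∂μ := lintegral_mono fun x => by
              by_cases hx : x ∈ Metric.cthickening r K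
              · simpa [hx] using hf1 x
              · simp [hx, hsupp x hx]
          _ = _ := by rw [lintegral_indicator_one hK.cthickening.measurableSet]
      calc ν K ≤ ENNReal.ofReal (C * ∫ x, f x ∂μ) := e1.trans (ENNReal.ofReal_le_ofReal hfi)
        _ = ENNReal.ofReal C * ENNReal.ofReal (∫ x, f x ∂μ) := ENNReal.ofReal_mul hC
        _ ≤ _ := by gcongr
    have ht : Tendsto (fun r => ENNReal.ofReal C * μ (Metric.cthickening r K)) (𝓝[>] 0)
        (𝓝 (ENNReal.ofReal C * μ K)) :=
      (ENNReal.Tendsto.const_mul (tendsto_measure_cthickening_of_isCompact hK)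
        (Or.inr ENNReal.ofReal_ne_top)).mono_left nhdsWithin_le_nhds
    exact ge_of_tendsto ht (eventually_mem_nhdsWithin.mono fun r hr' => hr r hr')
  rw [Measure.le_iff]
  intro A hA
  rw [hA.measure_eq_iSup_isCompact]
  refine iSup_le fun K => iSup_le fun hKA => iSup_le fun hKc => (hK K hKc).trans ?_
  rw [Measure.smul_apply, smul_eq_mul]
  gcongr

variable {φ : E → ℝ} {V : E → E} {X : ℝ → E → E} {K L : ℝ≥0} {c Γ : ℝ}

theorem IsGlobalFlow.integral_comp_mul_le (hφ : Continuous φ) (hc : 0 < c) (hφc : ∀ x, c ≤ φ x)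
    (hV : ContDiff ℝ 1 V) (hVc : HasCompactSupport V)
    (hdiv : ∀ x, |LinearMap.trace ℝ E (fderiv ℝ V x)| ≤ Γ)
    (hX : IsGlobalFlow (fun x => (φ x)⁻¹ • V x) X)
    (hb : LipschitzWith K (fun x => (φ x)⁻¹ • V x)) (hL : ∀ x, ‖(φ x)⁻¹ • V x‖ ≤ L)
    {h : E → ℝ} {D : ℝ≥0} (hh : LipschitzWith D h) (hhc : HasCompactSupport h)
    (hh0 : ∀ x, 0 ≤ h x) {t : ℝ} (ht : 0 ≤ t) :
    ∫ x, h (X t x) * φ x ≤ Real.exp (Γ / c * t) * ∫ x, h x * φ x := by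
  have hΓ : 0 ≤ Γ := (abs_nonneg _).trans (hdiv 0)
  have hφ0 : ∀ x, 0 < φ x := fun x => hc.trans_le (hφc x)
  have hu : ∀ t, ∃ D', LipschitzWith D' (fun x => h (X t x)) := fun t =>
    ⟨_, hh.comp (hX.lipschitzWith_space hb t)⟩
  have huc : ∀ t, HasCompactSupport (fun x => h (X t x)) := fun t =>
    HasCompactSupport.intro (hX.isCompact_preimage hb hhc.isCompact t) fun x hx =>
      image_eq_zero_of_notMem_tsupport hx
  have hXc := hX.continuous_uncurry hb hL
  have hXt : ∀ t, Continuous (X t) := fun t => (hX.lipschitzWith_space hb t).continuous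
  set I : ℝ → ℝ := fun t => ∫ x, h (X t x) * φ x
  have hI0 : ∀ t, 0 ≤ I t := fun t => integral_nonneg fun x => mul_nonneg (hh0 _) (hφ0 x).le
  have hder : ∀ t, HasDerivAt I
      (-∫ x, h (X t x) * LinearMap.trace ℝ E (fderiv ℝ V x)) t := by
    intro t
    obtain ⟨D', hD'⟩ := hu t
    set u : E → ℝ := fun x => h (X t x)
    have hS : IsCompact (Metric.cthickening L (tsupport u)) := (huc t).isCompact.cthickening
    set S := Metric.cthickening L (tsupport u)
    have hmem : ∀ s ∈ Ioo (-1 : ℝ) 1, ∀ x, x ∉ S → u (X s x) = 0 := by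
      intro s hs x hx
      refine image_eq_zero_of_notMem_tsupport fun hmem => hx ?_
      refine Metric.mem_cthickening_of_dist_le x (X s x) _ _ hmem ?_
      have := (hX.lipschitzWith_time hL x).dist_le_mul 0 s
      rw [hX.zero] at this
      refine this.trans ?_
      have h1 : dist 0 s ≤ 1 := by
        rw [dist_comm, Real.dist_0_eq_abs]; exact abs_le.2 ⟨hs.1.le, hs.2.le⟩
      calc (L : ℝ) * dist 0 s ≤ L * 1 := by gcongr
        _ = L := mul_one _
    have hmain := hasDerivAt_integral_of_dominated_loc_of_lip (μ := (volume : Measure E))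
      (F := fun s x => u (X s x) * φ x) (F' := fun x => fderiv ℝ u x (V x)) (x₀ := (0 : ℝ))
      (s := Ioo (-1) 1) (bound := S.indicator fun x => D' * L * φ x)
      (Ioo_mem_nhds (by norm_num) (by norm_num))
      (Eventually.of_forall fun s => by
        have := hD'.continuous; have := hXt s
        exact (by fun_prop : Continuous fun x => u (X s x) * φ x).aestronglyMeasurable)
      (by
        simp only [hX.zero]
        exact (hD'.continuous.mul hφ).integrable_of_hasCompactSupport (huc t).mul_right)
      (by
        refine Measurable.aestronglyMeasurable ?_
        have h1 : Measurable (fun x => fderiv ℝ u x) := measurable_fderiv ℝ u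
        have h2 : Measurable V := hV.continuous.measurable
        exact (isBoundedBilinearMap_apply.continuous.measurable.comp (h1.prodMk h2) : Measurable ((fun p : (E →L[ℝ] ℝ) × E => p.1 p.2) ∘ fun x => (fderiv ℝ u x, V x))))
      (ae_of_all _ fun x => by
        by_cases hx : x ∈ S
        · have hb0 : 0 ≤ (D' : ℝ) * L * φ x := by have := hφ0 x; positivity
          refine LipschitzOnWith.of_dist_le_mul fun s _ s' _ => ?_
          simp only [hx, indicator_of_mem, Real.coe_nnabs, abs_of_nonneg hb0]
          rw [Real.dist_eq, ← sub_mul, abs_mul, abs_of_pos (hφ0 x)]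
          have h1 := hD'.dist_le_mul (X s x) (X s' x)
          have h2 := (hX.lipschitzWith_time hL x).dist_le_mul s s'
          rw [Real.dist_eq] at h1
          calc |u (X s x) - u (X s' x)| * φ x ≤ D' * (L * dist s s') * φ x := by
                have := hφ0 x
                gcongr
                exact h1.trans (by gcongr)
            _ = _ := by ring
        · refine LipschitzOnWith.of_dist_le_mul fun s hs s' hs' => ?_
          simp only [hmem s hs x hx, hmem s' hs' x hx, zero_mul, dist_self]
          positivity)
      (by
        refine IntegrableOn.integrable_indicator ?_ hS.measurableSet
        exact (by fun_prop : Continuous fun x => (D' : ℝ) * L * φ x).continuousOn.integrableOn_compact hS)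
      (by
        filter_upwards [hD'.ae_differentiableAt] with x hx
        have h1 : HasDerivAt (fun s => X s x) ((φ x)⁻¹ • V x) 0 := by
          have := hX.deriv x 0
          rwa [hX.zero] at this
        have hx' : HasFDerivAt u (fderiv ℝ u x) (X 0 x) := by rw [hX.zero]; exact hx.hasFDerivAt
        have h2 := (hx'.comp_hasDerivAt (0 : ℝ) h1).mul_const (φ x)
        refine h2.congr_deriv ?_
        rw [map_smul, smul_eq_mul, mul_comm, ← mul_assoc, mul_inv_cancel₀ (hφ0 x).ne', one_mul])
    have h3 := hmain.2
    rw [integral_fderiv_apply_eq_neg_integral_mul_trace hD' hV hVc] at h3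
    have h4 : HasDerivAt (fun s => ∫ x, u (X s x) * φ x)
        (-∫ x, u x * LinearMap.trace ℝ E (fderiv ℝ V x)) (t - t) := by rwa [sub_self]
    have h5 := h4.comp_sub_const t t
    refine h5.congr_of_eventuallyEq (Eventually.of_forall fun s => ?_)
    simp only [I, u]
    refine integral_congr_ae (ae_of_all _ fun x => ?_)
    simp only [← hX.add hb, add_sub_cancel]
  have hbound : ∀ t, ‖-∫ x, h (X t x) * LinearMap.trace ℝ E (fderiv ℝ V x)‖ ≤
      Γ / c * ‖I t‖ + 0 := by
    intro t
    obtain ⟨D', hD'⟩ := hu t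
    have hint : Integrable (fun x => h (X t x) * φ x) :=
      (hD'.continuous.mul hφ).integrable_of_hasCompactSupport (huc t).mul_right
    rw [norm_neg, Real.norm_of_nonneg (hI0 t), add_zero]
    simp only [I]
    rw [← integral_const_mul]
    refine norm_integral_le_of_norm_le (hint.const_mul _) (ae_of_all _ fun x => ?_)
    rw [norm_mul, Real.norm_of_nonneg (hh0 _), Real.norm_eq_abs]
    calc h (X t x) * |LinearMap.trace ℝ E (fderiv ℝ V x)| ≤ h (X t x) * Γ :=
          mul_le_mul_of_nonneg_left (hdiv x) (hh0 _)
      _ = Γ / c * (h (X t x) * c) := by field_simp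
      _ ≤ _ := by
          have := hh0 (X t x)
          have := hφc x
          gcongr
  have := norm_le_gronwallBound_of_norm_deriv_right_le (f := I) (δ := I 0) (a := 0) (b := t)
    (HasDerivAt.continuousOn fun s _ => hder s) (fun s _ => (hder s).hasDerivWithinAt)
    (by rw [Real.norm_of_nonneg (hI0 0)]) (fun s _ => hbound s) t ⟨ht, le_rfl⟩
  rw [gronwallBound_ε0, Real.norm_of_nonneg (hI0 t), sub_zero, mul_comm] at this
  simpa [I, hX.zero] using this

theorem IsGlobalFlow.map_withDensity_le (hφ : Continuous φ) (hc : 0 < c) (hφc : ∀ x, c ≤ φ x)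
    (hV : ContDiff ℝ 1 V) (hVc : HasCompactSupport V)
    (hdiv : ∀ x, |LinearMap.trace ℝ E (fderiv ℝ V x)| ≤ Γ)
    (hX : IsGlobalFlow (fun x => (φ x)⁻¹ • V x) X)
    (hb : LipschitzWith K (fun x => (φ x)⁻¹ • V x)) (hL : ∀ x, ‖(φ x)⁻¹ • V x‖ ≤ L)
    {t : ℝ} (ht : 0 ≤ t) :
    (volume.withDensity fun x => ENNReal.ofReal (φ x)).map (X t) ≤
      ENNReal.ofReal (Real.exp (Γ / c * t)) • volume.withDensity fun x => ENNReal.ofReal (φ x) := by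
  set μ : Measure E := volume.withDensity fun x => ENNReal.ofReal (φ x)
  have hXt : Continuous (X t) := (hX.lipschitzWith_space hb t).continuous
  have hlf : IsLocallyFiniteMeasure μ :=
    IsLocallyFiniteMeasure.withDensity_ofReal hφ
  have hfin : IsFiniteMeasureOnCompacts (μ.map (X t)) := ⟨fun S hS => by
    rw [Measure.map_apply hXt.measurable hS.measurableSet]
    exact (hX.isCompact_preimage hb hS t).measure_lt_top⟩
  have hint : ∀ f : E → ℝ, Continuous f → ∫ x, f x ∂μ = ∫ x, f x * φ x := by
    intro f hf
    have hm : Measurable fun x => (φ x).toNNReal := (by fun_prop : Continuous _).measurable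
    have := integral_withDensity_eq_integral_smul (μ := (volume : Measure E)) hm f
    refine Eq.trans this (integral_congr_ae (ae_of_all _ fun x => ?_))
    simp only [NNReal.smul_def, Real.coe_toNNReal _ (hc.le.trans (hφc x)), smul_eq_mul, mul_comm]
  refine measure_le_of_forall_lipschitz (Real.exp_nonneg _) fun f hf hfc hf0 => ?_
  obtain ⟨D, hD⟩ := hf
  rw [integral_map hXt.aemeasurable hD.continuous.aestronglyMeasurable, hint _ hD.continuous,
    hint (fun x => f (X t x)) (hD.continuous.comp hXt)]
  exact hX.integral_comp_mul_le hφ hc hφc hV hVc hdiv hb hL hD hfc hf0 ht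

end QuasiInvariance


/-! ### Mollification of bounded fields -/

section Mollify

variable {E : Type*} [NormedAddCommGroup E] [InnerProductSpace ℝ E] [FiniteDimensional ℝ E]
  [MeasurableSpace E] [BorelSpace E]
variable {F : Type*} [NormedAddCommGroup F] [InnerProductSpace ℝ F]


/-- A bump function supported in the ball of radius `1 / (k + 1)`. -/
noncomputable def mollifier (E : Type*) [NormedAddCommGroup E] [InnerProductSpace ℝ E] (k : ℕ) :
    ContDiffBump (0 : E) where
  rIn := 1 / (2 * (k + 1))
  rOut := 1 / (k + 1)
  rIn_pos := by positivity
  rIn_lt_rOut := by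
    apply one_div_lt_one_div_of_lt <;> linarith [k.cast_nonneg (α := ℝ)]

/-- Convolution with the normalized bump function of radius `1 / (k + 1)`. -/
noncomputable def mollify (k : ℕ) (g : E → F) : E → F :=
  convolution ((mollifier E k).normed volume) g (ContinuousLinearMap.lsmul ℝ ℝ) volume

theorem mollify_apply (k : ℕ) (g : E → F) (x : E) :
    mollify k g x = ∫ t, (mollifier E k).normed volume t • g (x - t) := rfl

theorem tendsto_rOut_mollifier : Tendsto (fun k => (mollifier E k).rOut) atTop (𝓝 0) :=
  tendsto_one_div_add_atTop_nhds_zero_nat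

theorem locallyIntegrable_of_norm_le {g : E → F} {C : ℝ} (hg : AEStronglyMeasurable g volume)
    (hC : ∀ x, ‖g x‖ ≤ C) : LocallyIntegrable g volume := by
  rw [locallyIntegrable_iff]
  exact fun K hK => Measure.integrableOn_of_bounded (M := C) hK.measure_lt_top.ne hg
    (ae_of_all _ hC)

variable {g : E → F} {k : ℕ} {C : ℝ}

theorem contDiff_mollify {n : ℕ∞} (hg : LocallyIntegrable g volume) :
    ContDiff ℝ n (mollify k g) :=
  (mollifier E k).hasCompactSupport_normed.contDiff_convolution_left _
    (mollifier E k).contDiff_normed hg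

theorem hasCompactSupport_mollify (hg : HasCompactSupport g) : HasCompactSupport (mollify k g) :=
  (mollifier E k).hasCompactSupport_normed.convolution _ hg

theorem tendsto_mollify [CompleteSpace F] {ι : Type*} {l : Filter ι} {κ : ι → ℕ} {y : ι → E} {x : E}
    (hg : AEStronglyMeasurable g volume) (hx : ContinuousAt g x) (hκ : Tendsto κ l atTop)
    (hy : Tendsto y l (𝓝 x)) : Tendsto (fun i => mollify (κ i) g (y i)) l (𝓝 (g x)) :=
  ContDiffBump.convolution_tendsto_right (φ := fun i => mollifier E (κ i)) (g := fun _ => g)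
    (tendsto_rOut_mollifier.comp hκ) (Eventually.of_forall fun _ => hg)
    (hx.tendsto.comp tendsto_snd) hy

theorem integrable_mollify_integrand (hg : LocallyIntegrable g volume) (x : E) :
    Integrable (fun t => (mollifier E k).normed volume t • g (x - t)) :=
  (mollifier E k).hasCompactSupport_normed.convolutionExists_left
    (ContinuousLinearMap.lsmul ℝ ℝ) (mollifier E k).continuous_normed hg x

theorem normed_mollifier_eq_zero {t : E} (ht : (1 : ℝ) / (k + 1) ≤ ‖t‖) :
    (mollifier E k).normed volume t = 0 := by
  by_contra h
  have : t ∈ Metric.ball (0 : E) (mollifier E k).rOut := by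
    rw [← (mollifier E k).support_normed_eq (μ := volume)]; exact h
  rw [mem_ball_zero_iff] at this
  exact absurd this (not_lt.2 ht)

theorem norm_mollify_le_of_ae {x : E}
    (h : ∀ᵐ z, z ∈ Metric.ball x (1 / (k + 1)) → ‖g z‖ ≤ C) : ‖mollify k g x‖ ≤ C := by
  rw [mollify_apply]
  have h1 : ∫ t, (mollifier E k).normed volume t * C = C := by
    rw [integral_mul_const, (mollifier E k).integral_normed, one_mul]
  rw [← h1]
  refine norm_integral_le_of_norm_le ((mollifier E k).integrable_normed.mul_const _) ?_
  have h2 := (quasiMeasurePreserving_sub_left_of_right_invariant (volume : Measure E) x).ae h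
  filter_upwards [h2] with t ht
  rw [norm_smul, Real.norm_of_nonneg ((mollifier E k).nonneg_normed _)]
  rcases lt_or_ge ‖t‖ (1 / (k + 1)) with h3 | h3
  · exact mul_le_mul_of_nonneg_left (ht (by simpa [dist_eq_norm] using h3))
      ((mollifier E k).nonneg_normed _)
  · simp [normed_mollifier_eq_zero h3]

theorem norm_mollify_le (hC : ∀ x, ‖g x‖ ≤ C) (x : E) : ‖mollify k g x‖ ≤ C :=
  norm_mollify_le_of_ae (ae_of_all _ fun z _ => hC z)

theorem le_inner_mollify [CompleteSpace F] (hg : LocallyIntegrable g volume) {x : E} {n : F} {c : ℝ}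
    (h : ∀ᵐ z, z ∈ Metric.ball x (1 / (k + 1)) → c ≤ inner ℝ n (g z)) :
    c ≤ inner ℝ n (mollify k g x) := by
  have hi := integrable_mollify_integrand (k := k) hg x
  rw [mollify_apply, ← integral_inner hi]
  have h1 : ∫ t, (mollifier E k).normed volume t * c = c := by
    rw [integral_mul_const, (mollifier E k).integral_normed, one_mul]
  rw [← h1]
  refine integral_mono_ae ((mollifier E k).integrable_normed.mul_const _) (hi.const_inner n) ?_
  have h2 := (quasiMeasurePreserving_sub_left_of_right_invariant (volume : Measure E) x).ae h
  filter_upwards [h2] with t ht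
  rw [inner_smul_right]
  rcases lt_or_ge ‖t‖ (1 / (k + 1)) with h3 | h3
  · exact mul_le_mul_of_nonneg_left (ht (by simpa [dist_eq_norm] using h3))
      ((mollifier E k).nonneg_normed _)
  · simp [normed_mollifier_eq_zero h3]

theorem le_mollify {g : E → ℝ} (hg : LocallyIntegrable g volume) {x : E} {c : ℝ}
    (h : ∀ z, c ≤ g z) : c ≤ mollify k g x := by
  have := le_inner_mollify (k := k) (x := x) (n := (1 : ℝ)) (c := c) hg (ae_of_all _ fun z _ => by simpa using h z)
  simpa using this

theorem mollify_add_sub (hg : LocallyIntegrable g volume) (x h : E) :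
    mollify k g (x + h) - mollify k g x = mollify k (fun z => g (z + h) - g z) x := by
  simp only [mollify_apply]
  rw [← integral_sub (integrable_mollify_integrand hg _) (integrable_mollify_integrand hg _)]
  refine integral_congr_ae (ae_of_all _ fun t => ?_)
  simp only [smul_sub, sub_add_eq_add_sub]

/-- The distributional divergence of `V` is bounded by `Γ`. -/
def HasBoundedWeakDiv (V : E → E) (Γ : ℝ) : Prop :=
  ∀ w : E → ℝ, ContDiff ℝ ∞ w → HasCompactSupport w →
    |∫ x, fderiv ℝ w x (V x)| ≤ Γ * ∫ x, |w x|

theorem abs_trace_fderiv_mollify_le {V : E → E} {Γ : ℝ} (hV : LocallyIntegrable V volume)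
    (hdiv : HasBoundedWeakDiv V Γ) (x : E) :
    |LinearMap.trace ℝ E (fderiv ℝ (mollify k V) x)| ≤ Γ := by
  set ρ := (mollifier E k).normed (volume : Measure E)
  have hρ : ContDiff ℝ ∞ ρ := (mollifier E k).contDiff_normed
  have hρc : HasCompactSupport ρ := (mollifier E k).hasCompactSupport_normed
  have h1 := hρc.hasFDerivAt_convolution_left (ContinuousLinearMap.lsmul ℝ ℝ)
    (hρ.of_le (by exact_mod_cast le_top)) hV x
  have h2 : fderiv ℝ (mollify k V) x = ∫ t, (fderiv ℝ ρ t).smulRight (V (x - t)) := h1.fderiv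
  have hint : Integrable fun t => (fderiv ℝ ρ t).smulRight (V (x - t)) :=
    (hρc.fderiv ℝ).convolutionExists_left
      ((ContinuousLinearMap.lsmul ℝ ℝ : ℝ →L[ℝ] E →L[ℝ] E).precompL E)
      (hρ.continuous_fderiv (by simp)) hV x
  set tr : (E →L[ℝ] E) →L[ℝ] ℝ :=
    LinearMap.toContinuousLinearMap (LinearMap.trace ℝ E ∘ₗ ContinuousLinearMap.coeLM ℝ)
  have h3 : LinearMap.trace ℝ E (fderiv ℝ (mollify k V) x) = ∫ t, fderiv ℝ ρ t (V (x - t)) := by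
    change tr (fderiv ℝ (mollify k V) x) = _
    rw [h2, ← tr.integral_comp_comm hint]
    refine integral_congr_ae (ae_of_all _ fun t => ?_)
    exact LinearMap.trace_smulRight (fderiv ℝ ρ t : E →ₗ[ℝ] ℝ) (V (x - t))
  set w : E → ℝ := fun z => ρ (x - z)
  have hw : ContDiff ℝ ∞ w := hρ.comp (contDiff_const.sub contDiff_id)
  have hwc : HasCompactSupport w := hρc.comp_homeomorph (Homeomorph.subLeft x)
  have h4 : ∫ t, fderiv ℝ ρ t (V (x - t)) = -∫ z, fderiv ℝ w z (V z) := by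
    rw [← integral_sub_left_eq_self _ volume x, ← integral_neg]
    refine integral_congr_ae (ae_of_all _ fun z => ?_)
    have h5 : HasFDerivAt w (-(fderiv ℝ ρ (x - z))) z := by
      have := ((hρ.differentiable (by simp)) (x - z)).hasFDerivAt.comp z
        ((hasFDerivAt_id z).const_sub x)
      simpa [w, Function.comp_def] using! this
    simp [h5.fderiv]
  have h6 : ∫ z, |w z| = 1 := by
    rw [← (mollifier E k).integral_normed (μ := (volume : Measure E)),
      ← integral_sub_left_eq_self _ volume x]
    exact integral_congr_ae (ae_of_all _ fun z => by
      simp only [w, sub_sub_cancel]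
      exact abs_of_nonneg ((mollifier E k).nonneg_normed _))
  rw [h3, h4, abs_neg]
  simpa [h6] using hdiv w hw hwc

theorem volume_hyperplane {n : E} (hn : n ≠ 0) (c : ℝ) :
    volume {x : E | inner ℝ n x = c} = 0 := by
  by_cases h : ∃ y : E, inner ℝ n y = c
  · obtain ⟨y, hy⟩ := h
    have := Measure.addHaar_affineSubspace (volume : Measure E)
      (AffineSubspace.mk' y (LinearMap.ker (innerSL ℝ n : E →ₗ[ℝ] ℝ))) ?_
    · convert this using 2
      ext x
      simp [AffineSubspace.mem_mk', inner_sub_right, hy, sub_eq_zero]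
    · intro htop
      have : y + n ∈ (AffineSubspace.mk' y (LinearMap.ker (innerSL ℝ n : E →ₗ[ℝ] ℝ))) := by
        rw [htop]; trivial
      simp [AffineSubspace.mem_mk', hn] at this
  · push Not at h
    simp [h]

theorem ae_inner_ne {n : E} (hn : n ≠ 0) (c : ℝ) : ∀ᵐ x : E, inner ℝ n x ≠ c := by
  rw [ae_iff]; simpa using volume_hyperplane hn c

/-- A field with bounded divergence which is Lipschitz on both sides of a hyperplane has a
continuous normal component. -/
theorem inner_eq_of_hasBoundedWeakDiv {V W₁ W₂ : E → E} {Γ r : ℝ} {C : ℝ≥0} {n y : E}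
    (hVi : LocallyIntegrable V volume) (hdiv : HasBoundedWeakDiv V Γ) (hn : ‖n‖ = 1) (hr : 0 < r)
    (hW₁ : LipschitzOnWith C W₁ (Metric.ball y r)) (hW₂ : LipschitzOnWith C W₂ (Metric.ball y r))
    (h₁ : ∀ x ∈ Metric.ball y r, 0 < inner ℝ n (x - y) → V x = W₁ x)
    (h₂ : ∀ x ∈ Metric.ball y r, inner ℝ n (x - y) < 0 → V x = W₂ x) :
    inner ℝ n (W₁ y) = inner ℝ n (W₂ y) := by
  classical
  have hn0 : n ≠ 0 := by rintro rfl; simp at hn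
  obtain ⟨u, e, hu, he⟩ := Orthonormal.exists_orthonormalBasis_extension (𝕜 := ℝ) (v := {n})
    (by simp [hn])
  set M : ℝ := Γ + u.card * C
  -- derivative of the mollified normal component
  have key : ∀ᶠ k : ℕ in atTop, ∀ x ∈ Metric.ball y (r / 2),
      |inner ℝ n (fderiv ℝ (mollify k V) x n)| ≤ M := by
    have hk : ∀ᶠ k : ℕ in atTop, (1 : ℝ) / (k + 1) < r / 4 :=
      (tendsto_order.1 tendsto_one_div_add_atTop_nhds_zero_nat).2 _ (by positivity)
    filter_upwards [hk] with k hk x hx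
    have hd : DifferentiableAt ℝ (mollify k V) x :=
      (contDiff_mollify (n := 1) hVi).differentiable (by norm_num) x
    have htan : ∀ τ : E, ‖τ‖ = 1 → inner ℝ n τ = 0 → ‖fderiv ℝ (mollify k V) x τ‖ ≤ C := by
      intro τ hτ hnτ
      have h3 : HasDerivAt (fun s : ℝ => mollify k V (x + s • τ)) (fderiv ℝ (mollify k V) x τ) 0 := by
        have h4 : HasDerivAt (fun s : ℝ => x + s • τ) τ 0 := by
          simpa using ((hasDerivAt_id (0 : ℝ)).smul_const τ).const_add x
        have h5 : HasFDerivAt (mollify k V) (fderiv ℝ (mollify k V) x) (x + (0 : ℝ) • τ) := by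
          simpa using hd.hasFDerivAt
        exact h5.comp_hasDerivAt (0 : ℝ) h4
      refine HasDerivAt.le_of_lip' h3 C.2 ?_
      filter_upwards [Metric.ball_mem_nhds (0 : ℝ) (by positivity : 0 < r / 4)] with s hs
      simp only [sub_zero, zero_smul, add_zero]
      rw [mollify_add_sub hVi]
      refine norm_mollify_le_of_ae ?_
      filter_upwards [ae_inner_ne hn0 (inner ℝ n y)] with z hz hzx
      have hs' : ‖s‖ < r / 4 := by simpa using hs
      have hz1 : z ∈ Metric.ball y r := by
        rw [Metric.mem_ball] at *
        linarith [dist_triangle z x y]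
      have hz2 : z + s • τ ∈ Metric.ball y r := by
        rw [Metric.mem_ball] at *
        have : dist (z + s • τ) z < r / 4 := by simpa [dist_eq_norm, norm_smul, hτ] using hs'
        linarith [dist_triangle z x y, dist_triangle (z + s • τ) z y]
      have hin : inner ℝ n (z + s • τ - y) = inner ℝ n (z - y) := by
        rw [add_sub_right_comm, inner_add_right, inner_smul_right, hnτ, mul_zero, add_zero]
      have hfin : ∀ W : E → E, LipschitzOnWith C W (Metric.ball y r) →
          ‖W (z + s • τ) - W z‖ ≤ C * ‖s‖ := fun W hW => by
        have := hW.dist_le_mul _ hz2 _ hz1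
        simpa [dist_eq_norm, norm_smul, hτ] using this
      rcases lt_trichotomy (inner ℝ n (z - y)) 0 with h | h | h
      · rw [h₂ z hz1 h, h₂ _ hz2 (hin ▸ h)]; exact hfin _ hW₂
      · rw [inner_sub_right, sub_eq_zero] at h; exact absurd h hz
      · rw [h₁ z hz1 h, h₁ _ hz2 (hin ▸ h)]; exact hfin _ hW₁
    have htr := abs_trace_fderiv_mollify_le (k := k) hVi hdiv x
    rw [LinearMap.trace_eq_sum_inner _ e, he] at htr
    have hnu : n ∈ u := hu (mem_singleton n)
    rw [← Finset.add_sum_erase _ _ (Finset.mem_univ (⟨n, hnu⟩ : u))] at htr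
    simp only [ContinuousLinearMap.coe_coe] at htr
    have hrest : |∑ i ∈ Finset.univ.erase (⟨n, hnu⟩ : u),
        inner ℝ (i : E) (fderiv ℝ (mollify k V) x i)| ≤ u.card * C := by
      refine (Finset.abs_sum_le_sum_abs _ _).trans ?_
      calc _ ≤ ∑ i ∈ Finset.univ.erase (⟨n, hnu⟩ : u), (C : ℝ) := by
            refine Finset.sum_le_sum fun i hi => ?_
            have hi1 : ‖(i : E)‖ = 1 := by
              have := e.orthonormal.1 i
              rwa [he] at this
            have hi2 : inner ℝ n (i : E) = 0 := by
              have := e.orthonormal.2 (i := ⟨n, hnu⟩) (j := i) (Finset.ne_of_mem_erase hi).symm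
              rwa [he] at this
            calc _ ≤ ‖(i : E)‖ * ‖fderiv ℝ (mollify k V) x i‖ := abs_real_inner_le_norm _ _
              _ ≤ C := by rw [hi1, one_mul]; exact htan _ hi1 hi2
        _ ≤ _ := by
            rw [Finset.sum_const, nsmul_eq_mul]
            gcongr
            refine (Finset.card_le_univ _).trans ?_
            simp
    rw [abs_le] at *
    constructor <;> simp only [M] <;> linarith [htr.1, htr.2, hrest.1, hrest.2]
  -- the jump at distance `s`
  have jump : ∀ s ∈ Ioo 0 (r / 2),
      |inner ℝ n (W₁ (y + s • n)) - inner ℝ n (W₂ (y - s • n))| ≤ M * (2 * s) := by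
    intro s hs
    have hc : ∀ (W : E → E) (x : E), x ∈ Metric.ball y r → ContinuousAt W x → V =ᶠ[𝓝 x] W →
        Tendsto (fun k => inner ℝ n (mollify k V x)) atTop (𝓝 (inner ℝ n (W x))) := by
      intro W x _ hWx hVW
      have hVx : ContinuousAt V x := hWx.congr hVW.symm
      have := tendsto_mollify (y := fun _ => x) hVi.aestronglyMeasurable hVx tendsto_id
        tendsto_const_nhds
      rw [hVW.eq_of_nhds] at this
      exact tendsto_const_nhds.inner this
    have hb1 : y + s • n ∈ Metric.ball y r := by
      simp [norm_smul, hn, abs_of_pos hs.1]; linarith [hs.2]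
    have hb2 : y - s • n ∈ Metric.ball y r := by
      rw [Metric.mem_ball, dist_eq_norm]
      simp [norm_smul, hn, abs_of_pos hs.1]; linarith [hs.2]
    have hnn : inner ℝ n n = (1 : ℝ) := by rw [real_inner_self_eq_norm_sq, hn]; norm_num
    have hcont : Continuous fun x : E => inner ℝ n (x - y) := by fun_prop
    have t1 := hc W₁ _ hb1 (hW₁.continuousOn.continuousAt (Metric.isOpen_ball.mem_nhds hb1)) (by
      have : ∀ᶠ x in 𝓝 (y + s • n), 0 < inner ℝ n (x - y) :=
        hcont.continuousAt.eventually (lt_mem_nhds (by simp [inner_smul_right, hn, hs.1]))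
      filter_upwards [this, Metric.isOpen_ball.mem_nhds hb1] with x hx hx' using h₁ x hx' hx)
    have t2 := hc W₂ _ hb2 (hW₂.continuousOn.continuousAt (Metric.isOpen_ball.mem_nhds hb2)) (by
      have : ∀ᶠ x in 𝓝 (y - s • n), inner ℝ n (x - y) < 0 :=
        hcont.continuousAt.eventually (gt_mem_nhds (by
          simp [inner_smul_right, hn, hs.1]))
      filter_upwards [this, Metric.isOpen_ball.mem_nhds hb2] with x hx hx' using h₂ x hx' hx)
    refine le_of_tendsto (t1.sub t2).abs ?_
    filter_upwards [key] with k hk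
    set f : ℝ → ℝ := fun a => inner ℝ n (mollify k V (y + a • n))
    have hf : ∀ a, HasDerivAt f (inner ℝ n (fderiv ℝ (mollify k V) (y + a • n) n)) a := by
      intro a
      have h4 : HasDerivAt (fun s : ℝ => y + s • n) n a := by
        simpa using ((hasDerivAt_id a).smul_const n).const_add y
      have h5 := ((contDiff_mollify (n := 1) (k := k) hVi).differentiable (by norm_num)
        (y + a • n)).hasFDerivAt.comp_hasDerivAt a h4
      simpa using (hasDerivAt_const a n).inner ℝ h5
    have := (convex_Icc (-s) s).norm_image_sub_le_of_norm_hasDerivWithin_le (f := f) (C := M)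
      (fun a _ => (hf a).hasDerivWithinAt) (fun a ha => by
        refine hk _ ?_
        have := abs_le.2 ha
        simp [norm_smul, hn]; linarith [hs.2])
      (left_mem_Icc.2 (by linarith [hs.1])) (right_mem_Icc.2 (by linarith [hs.1]))
    have h2s : ‖s - -s‖ = 2 * s := by
      rw [Real.norm_of_nonneg] <;> linarith [hs.1]
    rw [h2s] at this
    simpa [f, sub_eq_add_neg] using this
  have hy : y ∈ Metric.ball y r := Metric.mem_ball_self hr
  have c1 : ContinuousAt W₁ y := hW₁.continuousOn.continuousAt (Metric.isOpen_ball.mem_nhds hy)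
  have c2 : ContinuousAt W₂ y := hW₂.continuousOn.continuousAt (Metric.isOpen_ball.mem_nhds hy)
  have l1 : Tendsto (fun s : ℝ => y + s • n) (𝓝[>] 0) (𝓝 y) := by
    have : Continuous fun s : ℝ => y + s • n := by fun_prop
    simpa using (this.tendsto 0).mono_left nhdsWithin_le_nhds
  have l2 : Tendsto (fun s : ℝ => y - s • n) (𝓝[>] 0) (𝓝 y) := by
    have : Continuous fun s : ℝ => y - s • n := by fun_prop
    simpa using (this.tendsto 0).mono_left nhdsWithin_le_nhds
  have l3 : Tendsto (fun s : ℝ => M * (2 * s)) (𝓝[>] 0) (𝓝 0) := by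
    have : Continuous fun s : ℝ => M * (2 * s) := by fun_prop
    simpa using (this.tendsto 0).mono_left nhdsWithin_le_nhds
  have lim := (((tendsto_const_nhds (x := n)).inner (𝕜 := ℝ) (c1.tendsto.comp l1)).sub
    ((tendsto_const_nhds (x := n)).inner (𝕜 := ℝ) (c2.tendsto.comp l2))).abs
  have := le_of_tendsto_of_tendsto lim l3 (by
    filter_upwards [Ioo_mem_nhdsGT (by positivity : 0 < r / 2)] with s hs using jump s hs)
  exact sub_eq_zero.1 (abs_nonpos_iff.1 this)

end Mollify


/-! ### Characteristics of a field which is piecewise Lipschitz -/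

section Characteristics

variable {E : Type*} [NormedAddCommGroup E] [InnerProductSpace ℝ E]

/-- `b` is Lipschitz near every point of the open set `U`. -/
def IsLocLipschitz (U : Set E) (b : E → E) : Prop :=
  ∀ y ∈ U, ∃ r > 0, Metric.ball y r ⊆ U ∧ ∃ C : ℝ≥0, LipschitzOnWith C b (Metric.ball y r)

/-- Near `y`, the field `b` is Lipschitz on both sides of the hyperplane through `y` with normal
`n` and crosses it with a normal velocity at least `lam`. -/
structure IsCrossing (U : Set E) (b : E → E) (y n : E) (lam r : ℝ) : Prop where
  ne : n ≠ 0
  lam_pos : 0 < lam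
  r_pos : 0 < r
  mem : ∀ x ∈ Metric.ball y r, inner ℝ n (x - y) ≠ 0 → x ∈ U
  le : ∀ x ∈ Metric.ball y r, x ∈ U → lam ≤ inner ℝ n (b x)
  lip : ∃ C : ℝ≥0, LipschitzOnWith C b (Metric.ball y r ∩ {x | 0 < inner ℝ n (x - y)}) ∧
    LipschitzOnWith C b (Metric.ball y r ∩ {x | inner ℝ n (x - y) < 0})

/-- Near `y`, the field `b` is tangential to the hyperplane through `y` with normal `n`. -/
structure IsTangential (U : Set E) (b : E → E) (y n : E) (C r : ℝ) : Prop where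
  r_pos : 0 < r
  notMem : ∀ x ∈ Metric.ball y r, inner ℝ n (x - y) = 0 → x ∉ U
  pos_side : ∀ x ∈ Metric.ball y r, ∀ x' ∈ Metric.ball y r, 0 < inner ℝ n (x - y) →
    0 < inner ℝ n (x' - y) → x ∈ U → x' ∈ U
  neg_side : ∀ x ∈ Metric.ball y r, ∀ x' ∈ Metric.ball y r, inner ℝ n (x - y) < 0 →
    inner ℝ n (x' - y) < 0 → x ∈ U → x' ∈ U
  le : ∀ x ∈ Metric.ball y r, x ∈ U → |inner ℝ n (b x)| ≤ C * |inner ℝ n (x - y)|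

/-- The points through which characteristics pass. -/
def goodSet (U : Set E) (b : E → E) : Set E :=
  U ∪ {y | ∃ n lam r, IsCrossing U b y n lam r}

/-- A curve on `[0, τ]` which is a characteristic of `b` as long as it is in `U`, and which goes
through crossing points at a speed at least `θ` times the minimal normal speed. -/
structure IsCharacteristic (U : Set E) (b : E → E) (θ τ : ℝ) (γ : ℝ → E) : Prop where
  cont : ContinuousOn γ (Icc 0 τ)
  ode : ∀ s t, 0 ≤ s → s ≤ t → t ≤ τ → (∀ a ∈ Icc s t, γ a ∈ U) →
    γ t - γ s = ∫ a in s..t, b (γ a)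
  cross : ∀ y n lam r, IsCrossing U b y n lam r → ∀ s t, 0 ≤ s → s ≤ t → t ≤ τ →
    (∀ a ∈ Icc s t, γ a ∈ Metric.ball y (r / 2)) → θ * lam * (t - s) ≤ inner ℝ n (γ t - γ s)

/-- A Lipschitz curve on `[0, τ]` which, except at countably many times, is in `U` and satisfies
`γ' = b(γ)`. -/
structure IsForwardLine (U : Set E) (b : E → E) (τ : ℝ) (γ : ℝ → E) : Prop where
  lipschitz : ∃ L : ℝ≥0, LipschitzOnWith L γ (Icc 0 τ)
  ode : ∃ S : Set ℝ, S.Countable ∧ ∀ t ∈ Ioo 0 τ \ S, γ t ∈ U ∧ HasDerivAt γ (b (γ t)) t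

variable {U : Set E} {b : E → E} {θ τ : ℝ} {γ γ₁ γ₂ : ℝ → E}

theorem IsLocLipschitz.isOpen (hb : IsLocLipschitz U b) : IsOpen U :=
  Metric.isOpen_iff.2 fun y hy => let ⟨r, hr, h, _⟩ := hb y hy; ⟨r, hr, h⟩

theorem IsLocLipschitz.continuousAt (hb : IsLocLipschitz U b) {y : E} (hy : y ∈ U) :
    ContinuousAt b y := by
  obtain ⟨r, hr, _, C, hC⟩ := hb y hy
  exact hC.continuousOn.continuousAt (Metric.ball_mem_nhds y hr)

theorem IsCrossing.mono {y n z : E} {lam r : ℝ} (h : IsCrossing U b y n lam r)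
    (hz : z ∈ Metric.ball y r) (hzn : inner ℝ n (z - y) = 0) :
    IsCrossing U b z n lam (r - dist z y) := by
  have hb : Metric.ball z (r - dist z y) ⊆ Metric.ball y r :=
    Metric.ball_subset_ball' (by linarith)
  have hi : ∀ x, inner ℝ n (x - z) = inner ℝ n (x - y) := fun x => by
    rw [← sub_sub_sub_cancel_right x z y, inner_sub_right n, hzn, sub_zero]
  obtain ⟨C, h1, h2⟩ := h.lip
  refine ⟨h.ne, h.lam_pos, sub_pos.2 hz, fun x hx hx' => h.mem x (hb hx) (by rwa [← hi]),
    fun x hx => h.le x (hb hx), C, h1.mono ?_, h2.mono ?_⟩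
  · exact fun x hx => ⟨hb hx.1, by simpa only [mem_ofPred_eq, hi] using hx.2⟩
  · exact fun x hx => ⟨hb hx.1, by simpa only [mem_ofPred_eq, hi] using hx.2⟩

theorem isOpen_goodSet (hU : IsOpen U) : IsOpen (goodSet U b) := by
  rw [isOpen_iff_mem_nhds]
  rintro y (hy | ⟨n, lam, r, hy⟩)
  · exact mem_of_superset (hU.mem_nhds hy) subset_union_left
  · filter_upwards [Metric.ball_mem_nhds y hy.r_pos] with z hz
    by_cases h : inner ℝ n (z - y) = 0
    · exact Or.inr ⟨n, lam, _, hy.mono hz h⟩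
    · exact Or.inl (hy.mem z hz h)

theorem goodSet_subset_closure : goodSet U b ⊆ closure U := by
  rintro y (hy | ⟨n, lam, r, hy⟩)
  · exact subset_closure hy
  · have hc : Tendsto (fun s : ℝ => y + s • n) (𝓝[>] 0) (𝓝 y) := by
      have : Continuous fun s : ℝ => y + s • n := by fun_prop
      simpa using (this.tendsto 0).mono_left nhdsWithin_le_nhds
    refine mem_closure_of_tendsto hc ?_
    filter_upwards [hc (Metric.ball_mem_nhds y hy.r_pos), self_mem_nhdsWithin] with s hs hs0
    refine hy.mem _ hs ?_
    have : (s : ℝ) ≠ 0 := ne_of_gt hs0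
    simp [inner_smul_right, hy.ne, this]

theorem IsCharacteristic.mono {τ' : ℝ} (h : IsCharacteristic U b θ τ γ) (hτ : τ' ≤ τ) :
    IsCharacteristic U b θ τ' γ :=
  ⟨h.cont.mono (Icc_subset_Icc_right hτ), fun s t h0 hst ht => h.ode s t h0 hst (ht.trans hτ),
    fun y n lam r hy s t h0 hst ht => h.cross y n lam r hy s t h0 hst (ht.trans hτ)⟩

theorem IsCharacteristic.hasDerivWithinAt [CompleteSpace E] (hb : IsLocLipschitz U b)
    (h : IsCharacteristic U b θ τ γ) {p q : ℝ} (hp : 0 ≤ p) (hq : q ≤ τ)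
    (hU : ∀ a ∈ Icc p q, γ a ∈ U) {t : ℝ} (ht : t ∈ Icc p q) :
    HasDerivWithinAt γ (b (γ t)) (Icc p q) t := by
  have hpq : p ≤ q := ht.1.trans ht.2
  have hbc : ContinuousOn b U := fun y hy => (hb.continuousAt hy).continuousWithinAt
  have h1 := ODE.hasDerivWithinAt_picard_Icc (f := fun _ => b) (left_mem_Icc.2 hpq)
    (hbc.comp continuousOn_snd fun x hx => hx.2) (h.cont.mono (Icc_subset_Icc hp hq)) hU (γ p) ht
  refine h1.congr_of_mem (fun a ha => ?_) ht
  rw [ODE.picard_apply, ← h.ode p a hp ha.1 (ha.2.trans hq)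
    fun c hc => hU c ⟨hc.1, hc.2.trans ha.2⟩]
  abel

/-- A time shortly after `t₀` up to which the curve is in a neighbourhood of `γ t₀`. -/
theorem ContinuousOn.exists_forall_Icc_mem {γ : ℝ → E} (hγ : ContinuousOn γ (Icc 0 τ)) {t₀ : ℝ}
    (ht₀ : t₀ ∈ Ico 0 τ) {s : Set E} (hs : s ∈ 𝓝 (γ t₀)) :
    ∃ t₁ ∈ Ioc t₀ τ, ∀ a ∈ Icc t₀ t₁, γ a ∈ s := by
  have h1 : ContinuousWithinAt γ (Ici t₀) t₀ := by
    refine ((hγ t₀ (Ico_subset_Icc_self ht₀)).mono (Icc_subset_Icc_left ht₀.1)).mono_of_mem_nhdsWithin ?_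
    exact Icc_mem_nhdsGE ht₀.2
  obtain ⟨u, hu, hus⟩ := (mem_nhdsGE_iff_exists_Icc_subset).1 (h1 hs)
  refine ⟨min u τ, ⟨lt_min hu ht₀.2, min_le_right _ _⟩, fun a ha => ?_⟩
  exact hus ⟨ha.1, ha.2.trans (min_le_left _ _)⟩

theorem IsCharacteristic.exists_forall_mem_of_crossing (hθ : 0 < θ)
    (h : IsCharacteristic U b θ τ γ) {t₀ lam r : ℝ} {n : E} (ht₀ : t₀ ∈ Ico 0 τ)
    (hc : IsCrossing U b (γ t₀) n lam r) : ∃ t₁ ∈ Ioc t₀ τ, ∀ a ∈ Ioc t₀ t₁,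
      γ a ∈ Metric.ball (γ t₀) r ∩ {x | 0 < inner ℝ n (x - γ t₀)} := by
  obtain ⟨t₁, ht₁, h1⟩ := h.cont.exists_forall_Icc_mem ht₀
    (Metric.ball_mem_nhds (γ t₀) (half_pos hc.r_pos))
  refine ⟨t₁, ht₁, fun a ha => ⟨Metric.ball_subset_ball (by linarith [hc.r_pos])
    (h1 a (Ioc_subset_Icc_self ha)), ?_⟩⟩
  have := h.cross _ n lam r hc t₀ a ht₀.1 ha.1.le (ha.2.trans ht₁.2)
    fun c hc' => h1 c ⟨hc'.1, hc'.2.trans ha.2⟩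
  refine lt_of_lt_of_le ?_ this
  have := hc.lam_pos
  have := sub_pos.2 ha.1
  positivity

theorem IsCharacteristic.eqOn_of_forall_mem [CompleteSpace E] (hb : IsLocLipschitz U b)
    (h₁ : IsCharacteristic U b θ τ γ₁) (h₂ : IsCharacteristic U b θ τ γ₂) {t₀ t₁ : ℝ}
    (ht₀ : 0 ≤ t₀) (ht₁ : t₁ ≤ τ) (heq : γ₁ t₀ = γ₂ t₀) {S : Set E} (hSU : S ⊆ U) {C : ℝ≥0}
    (hS : LipschitzOnWith C b S) (hS₁ : ∀ a ∈ Ioc t₀ t₁, γ₁ a ∈ S)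
    (hS₂ : ∀ a ∈ Ioc t₀ t₁, γ₂ a ∈ S) {t : ℝ} (ht : t ∈ Ioc t₀ t₁) : γ₁ t = γ₂ t := by
  have key : ∀ s ∈ Ioo t₀ t, dist (γ₁ t) (γ₂ t) ≤
      dist (γ₁ s) (γ₂ s) * Real.exp (C * (t - s)) := by
    intro s hs
    have hsub : Icc s t ⊆ Ioc t₀ t₁ := fun a ha => ⟨hs.1.trans_le ha.1, ha.2.trans ht.2⟩
    have hsub' : Icc s t ⊆ Icc 0 τ := Icc_subset_Icc (ht₀.trans hs.1.le) (ht.2.trans ht₁)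
    have hd : ∀ γ, IsCharacteristic U b θ τ γ → (∀ a ∈ Ioc t₀ t₁, γ a ∈ S) →
        ∀ a ∈ Ico s t, HasDerivWithinAt γ (b (γ a)) (Ici a) a := by
      intro γ hγ hγS a ha
      refine (hγ.hasDerivWithinAt hb (p := a) (q := t) (ht₀.trans (hs.1.le.trans ha.1))
        (ht.2.trans ht₁) (fun c hc => hSU (hγS c (hsub ⟨ha.1.trans hc.1, hc.2⟩)))
        (left_mem_Icc.2 ha.2.le)).mono_of_mem_nhdsWithin ?_
      exact Icc_mem_nhdsGE ha.2
    exact dist_le_of_trajectories_ODE_of_mem (v := fun _ => b) (s := fun _ => S) (K := C)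
      (fun _ _ => hS) (h₁.cont.mono hsub') (hd γ₁ h₁ hS₁)
      (fun a ha => hS₁ a (hsub (Ico_subset_Icc_self ha))) (h₂.cont.mono hsub') (hd γ₂ h₂ hS₂)
      (fun a ha => hS₂ a (hsub (Ico_subset_Icc_self ha))) le_rfl t (right_mem_Icc.2 hs.2.le)
  have hlim : ∀ γ, IsCharacteristic U b θ τ γ → Tendsto γ (𝓝[>] t₀) (𝓝 (γ t₀)) := by
    intro γ hγ
    have h1 := hγ.cont t₀ ⟨ht₀, (ht.1.le.trans ht.2).trans ht₁⟩
    refine (h1.mono_left ?_)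
    have : Ioc t₀ t ⊆ Icc 0 τ := fun a ha => ⟨ht₀.trans ha.1.le, ha.2.trans (ht.2.trans ht₁)⟩
    rw [← nhdsWithin_Ioc_eq_nhdsGT ht.1]
    exact nhdsWithin_mono _ this
  have l1 : Tendsto (fun s => dist (γ₁ s) (γ₂ s) * Real.exp (C * (t - s))) (𝓝[>] t₀)
      (𝓝 (dist (γ₁ t₀) (γ₂ t₀) * Real.exp (C * (t - t₀)))) := by
    refine ((hlim γ₁ h₁).dist (hlim γ₂ h₂)).mul ?_
    have : Continuous fun s => Real.exp (C * (t - s)) := by fun_prop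
    exact (this.tendsto t₀).mono_left nhdsWithin_le_nhds
  rw [heq, dist_self, zero_mul] at l1
  refine dist_le_zero.1 (ge_of_tendsto l1 ?_)
  filter_upwards [Ioo_mem_nhdsGT ht.1] with s hs using key s hs

/-- Uniqueness of characteristics that stay in the good set. -/
theorem IsCharacteristic.eqOn [CompleteSpace E] (hθ : 0 < θ) (hb : IsLocLipschitz U b)
    (h₁ : IsCharacteristic U b θ τ γ₁) (h₂ : IsCharacteristic U b θ τ γ₂) (heq : γ₁ 0 = γ₂ 0)
    (hgood : ∀ t ∈ Icc 0 τ, γ₁ t ∈ goodSet U b) : EqOn γ₁ γ₂ (Icc 0 τ) := by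
  rcases lt_or_ge τ 0 with hτ | hτ
  · intro t ht; exact absurd (ht.1.trans ht.2) (not_le.2 hτ)
  have hcl : IsClosed ({t | γ₁ t = γ₂ t} ∩ Icc 0 τ) := by
    have := (h₁.cont.prodMk h₂.cont).preimage_isClosed_of_isClosed isClosed_Icc
      (isClosed_diagonal (X := E))
    convert this using 1
    ext t; simp [and_comm]
  refine hcl.Icc_subset_of_forall_mem_nhdsWithin heq ?_
  rintro t₀ ⟨ht₀ : γ₁ t₀ = γ₂ t₀, ht₀'⟩
  suffices ∃ t₁ > t₀, ∀ t ∈ Ioc t₀ t₁, γ₁ t = γ₂ t by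
    obtain ⟨t₁, ht₁, h⟩ := this
    filter_upwards [Ioc_mem_nhdsGT ht₁] with t ht using h t ht
  rcases hgood t₀ (Ico_subset_Icc_self ht₀') with hU | ⟨n, lam, r, hc⟩
  · obtain ⟨r, hr, hrU, C, hC⟩ := hb _ hU
    obtain ⟨t₁, ht₁, hm₁⟩ := h₁.cont.exists_forall_Icc_mem ht₀' (Metric.ball_mem_nhds _ hr)
    have hr₂ : Metric.ball (γ₁ t₀) r ∈ 𝓝 (γ₂ t₀) := by
      rw [← ht₀]; exact Metric.ball_mem_nhds _ hr
    obtain ⟨t₂, ht₂, hm₂⟩ := h₂.cont.exists_forall_Icc_mem ht₀' hr₂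
    refine ⟨min t₁ t₂, lt_min ht₁.1 ht₂.1, fun t ht => ?_⟩
    exact h₁.eqOn_of_forall_mem hb h₂ ht₀'.1 ((min_le_left _ _).trans ht₁.2) ht₀ hrU hC
      (fun a ha => hm₁ a ⟨ha.1.le, ha.2.trans (min_le_left _ _)⟩)
      (fun a ha => hm₂ a ⟨ha.1.le, ha.2.trans (min_le_right _ _)⟩) ht
  · obtain ⟨C, hC, -⟩ := hc.lip
    obtain ⟨t₁, ht₁, hm₁⟩ := h₁.exists_forall_mem_of_crossing hθ ht₀' hc
    have hc' := hc
    rw [ht₀] at hc'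
    obtain ⟨t₂, ht₂, hm₂⟩ := h₂.exists_forall_mem_of_crossing hθ ht₀' hc'
    rw [← ht₀] at hm₂
    refine ⟨min t₁ t₂, lt_min ht₁.1 ht₂.1, fun t ht => ?_⟩
    exact h₁.eqOn_of_forall_mem hb h₂ ht₀'.1 ((min_le_left _ _).trans ht₁.2) ht₀
      (fun x hx => hc.mem x hx.1 (ne_of_gt hx.2)) hC
      (fun a ha => hm₁ a ⟨ha.1, ha.2.trans (min_le_left _ _)⟩)
      (fun a ha => hm₂ a ⟨ha.1, ha.2.trans (min_le_right _ _)⟩) ht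

/-- A characteristic cannot arrive at a tangential point from `U`. -/
theorem IsCharacteristic.not_isTangential [CompleteSpace E] (hb : IsLocLipschitz U b)
    (h : IsCharacteristic U b θ τ γ) {t₀ t₁ C r : ℝ} {n : E} (ht₀ : 0 ≤ t₀) (h01 : t₀ ≤ t₁)
    (ht₁ : t₁ ≤ τ) (hU : γ t₀ ∈ U) (htan : IsTangential U b (γ t₁) n C r)
    (hball : ∀ a ∈ Icc t₀ t₁, γ a ∈ Metric.ball (γ t₁) r) : False := by
  set y := γ t₁
  set f : ℝ → ℝ := fun t => inner ℝ n (γ t - y)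
  have hcont : ContinuousOn f (Icc t₀ t₁) := by
    have := h.cont.mono (Icc_subset_Icc ht₀ ht₁)
    fun_prop
  have hf0 : f t₀ ≠ 0 := fun h0 => htan.notMem _ (hball t₀ (left_mem_Icc.2 h01)) h0 hU
  set Z := Icc t₀ t₁ ∩ f ⁻¹' {0}
  have hZc : IsClosed Z := hcont.preimage_isClosed_of_isClosed isClosed_Icc isClosed_singleton
  have hZne : Z.Nonempty := ⟨t₁, right_mem_Icc.2 h01, by simp [f, y]⟩
  have hZb : BddBelow Z := ⟨t₀, fun t ht => ht.1.1⟩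
  set t₂ := sInf Z
  have ht₂ : t₂ ∈ Z := hZc.csInf_mem hZne hZb
  have hlt : ∀ t ∈ Ico t₀ t₂, f t ≠ 0 := fun t ht h0 =>
    absurd (csInf_le hZb ⟨⟨ht.1, ht.2.le.trans ht₂.1.2⟩, h0⟩) (not_le.2 ht.2)
  have h02 : t₀ < t₂ := lt_of_le_of_ne ht₂.1.1 fun he => hf0 (he ▸ ht₂.2)
  have hsub : Icc t₀ t₂ ⊆ Icc t₀ t₁ := Icc_subset_Icc_right ht₂.1.2
  -- the curve stays in `U` before `t₂`
  have hUt : ∀ t ∈ Ico t₀ t₂, γ t ∈ U := by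
    intro t ht
    have hb0 := hball t₀ (left_mem_Icc.2 h01)
    have hbt := hball t (hsub (Ico_subset_Icc_self ht))
    have hno : ¬ (0 : ℝ) ∈ f '' Icc t₀ t := by
      rintro ⟨a, ha, h0⟩
      exact hlt a ⟨ha.1, ha.2.trans_lt ht.2⟩ h0
    have hct : ContinuousOn f (Icc t₀ t) :=
      hcont.mono (Icc_subset_Icc_right (ht.2.le.trans ht₂.1.2))
    rcases lt_or_gt_of_ne hf0 with hs | hs
    · refine htan.neg_side _ hb0 _ hbt hs ?_ hU
      by_contra hcon
      exact hno (intermediate_value_Icc ht.1 hct ⟨hs.le, not_lt.1 hcon⟩)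
    · refine htan.pos_side _ hb0 _ hbt hs ?_ hU
      by_contra hcon
      exact hno (intermediate_value_Icc' ht.1 hct ⟨not_lt.1 hcon, hs.le⟩)
  -- `f² exp (2 C t)` is monotone
  set F : ℝ → ℝ := fun t => f t ^ 2 * Real.exp (2 * C * t)
  have hder : ∀ t ∈ Ioo t₀ t₂, HasDerivAt f (inner ℝ n (b (γ t))) t := by
    intro t ht
    obtain ⟨q, hq1, hq2⟩ := exists_between ht.2
    have h1 : HasDerivAt γ (b (γ t)) t :=
      (h.hasDerivWithinAt hb (p := t₀) (q := q) ht₀ (hq2.le.trans (ht₂.1.2.trans ht₁))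
        (fun a ha => hUt a ⟨ha.1, ha.2.trans_lt hq2⟩) ⟨ht.1.le, hq1.le⟩).hasDerivAt
        (Icc_mem_nhds ht.1 hq1)
    simpa using (hasDerivAt_const t n).inner ℝ (h1.sub_const y)
  have hFmono : MonotoneOn F (Icc t₀ t₂) := by
    have hFd : ∀ t ∈ Ioo t₀ t₂, HasDerivAt F (2 * f t * inner ℝ n (b (γ t)) *
        Real.exp (2 * C * t) + f t ^ 2 * (Real.exp (2 * C * t) * (2 * C))) t := by
      intro t ht
      have h1 := (hder t ht).pow 2
      have h2 : HasDerivAt (fun t => Real.exp (2 * C * t)) (Real.exp (2 * C * t) * (2 * C)) t := by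
        simpa using ((hasDerivAt_id t).const_mul (2 * C)).exp
      refine (h1.mul h2).congr_deriv ?_
      simp
    refine monotoneOn_of_deriv_nonneg (convex_Icc _ _) ?_ ?_ ?_
    · have := hcont.mono hsub
      fun_prop
    · rw [interior_Icc]
      exact fun t ht => (hFd t ht).differentiableAt.differentiableWithinAt
    · rw [interior_Icc]
      intro t ht
      rw [(hFd t ht).deriv]
      have hle := htan.le (γ t) (hball t (hsub (Ioo_subset_Icc_self ht)))
        (hUt t (Ioo_subset_Ico_self ht))
      have h3 : -(C * f t ^ 2) ≤ f t * inner ℝ n (b (γ t)) := by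
        have h4 : |f t * inner ℝ n (b (γ t))| ≤ C * f t ^ 2 := by
          rw [abs_mul, ← sq_abs (f t)]
          calc |f t| * |inner ℝ n (b (γ t))| ≤ |f t| * (C * |f t|) := by gcongr
            _ = _ := by ring
        exact (abs_le.1 h4).1
      have h5 := Real.exp_pos (2 * C * t)
      nlinarith
  have h6 := hFmono (left_mem_Icc.2 h02.le) (right_mem_Icc.2 h02.le) h02.le
  have h7 : f t₂ = 0 := ht₂.2
  have h8 : F t₀ ≤ 0 := by simpa [F, h7] using h6
  have h9 : 0 < F t₀ := by positivity
  linarith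

/-- A characteristic that starts in `U` and avoids the bad set `B` stays in the good set. -/
theorem IsCharacteristic.mem_goodSet [CompleteSpace E] (hθ : 0 < θ) (hb : IsLocLipschitz U b)
    (h : IsCharacteristic U b θ τ γ) {B : Set E}
    (hB : ∀ y ∈ closure U, y ∉ B → y ∈ goodSet U b ∨ ∃ n C r, IsTangential U b y n C r)
    (h0 : γ 0 ∈ U) (hγB : ∀ t ∈ Icc 0 τ, γ t ∉ B) : ∀ t ∈ Icc 0 τ, γ t ∈ goodSet U b := by
  by_contra hcon
  push Not at hcon
  obtain ⟨t', ht', hbad'⟩ := hcon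
  set Z := Icc 0 τ ∩ γ ⁻¹' (goodSet U b)ᶜ
  have hZc : IsClosed Z := h.cont.preimage_isClosed_of_isClosed isClosed_Icc
    (isOpen_goodSet hb.isOpen).isClosed_compl
  have hZb : BddBelow Z := ⟨0, fun t ht => ht.1.1⟩
  set t₁ := sInf Z
  have ht₁ : t₁ ∈ Z := hZc.csInf_mem ⟨t', ht', hbad'⟩ hZb
  have hlt : ∀ t ∈ Ico 0 t₁, γ t ∈ goodSet U b := fun t ht => by
    by_contra h0
    exact absurd (csInf_le hZb ⟨⟨ht.1, ht.2.le.trans ht₁.1.2⟩, h0⟩) (not_le.2 ht.2)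
  have hpos : 0 < t₁ := lt_of_le_of_ne ht₁.1.1 fun he => ht₁.2 (he ▸ Or.inl h0)
  have hcl : γ t₁ ∈ closure U := by
    have h1 : Tendsto γ (𝓝[Ico 0 t₁] t₁) (𝓝 (γ t₁)) :=
      (h.cont t₁ ht₁.1).mono_left (nhdsWithin_mono _
        fun a ha => ⟨ha.1, ha.2.le.trans ht₁.1.2⟩)
    have : (𝓝[Ico 0 t₁] t₁).NeBot := by
      rw [nhdsWithin_Ico_eq_nhdsLT hpos]; infer_instance
    rw [← closure_closure]
    exact mem_closure_of_tendsto h1 (eventually_mem_nhdsWithin.mono fun a ha =>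
      goodSet_subset_closure (hlt a ha))
  rcases hB _ hcl (hγB _ ht₁.1) with hg | ⟨n, C, r, htan⟩
  · exact ht₁.2 hg
  -- just before `t₁` the curve is in the ball
  have hev : ∀ᶠ a in 𝓝[≤] t₁, γ a ∈ Metric.ball (γ t₁) r := by
    have h1 : ContinuousWithinAt γ (Iic t₁) t₁ :=
      ((h.cont t₁ ht₁.1).mono (Icc_subset_Icc_right ht₁.1.2)).mono_of_mem_nhdsWithin
        (Icc_mem_nhdsLE hpos)
    exact h1 (Metric.ball_mem_nhds _ htan.r_pos)
  obtain ⟨u, hu, hus⟩ := (mem_nhdsLE_iff_exists_Icc_subset).1 hev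
  have hu : u < t₁ := hu
  set v := max u 0
  have hv : v < t₁ := max_lt hu hpos
  have hv0 : 0 ≤ v := le_max_right _ _
  obtain ⟨t₀, ht₀, ht₀U⟩ : ∃ t₀ ∈ Ico v t₁, γ t₀ ∈ U := by
    rcases hlt v ⟨hv0, hv⟩ with hU | ⟨n', lam, r', hc⟩
    · exact ⟨v, ⟨le_rfl, hv⟩, hU⟩
    · obtain ⟨t₂, ht₂, hm⟩ := h.exists_forall_mem_of_crossing hθ
        ⟨hv0, hv.trans_le ht₁.1.2⟩ hc
      obtain ⟨t₃, ht₃, ht₃'⟩ := exists_between (lt_min ht₂.1 hv)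
      have := hm t₃ ⟨ht₃, ht₃'.le.trans (min_le_left _ _)⟩
      exact ⟨t₃, ⟨ht₃.le, ht₃'.trans_le (min_le_right _ _)⟩,
        hc.mem _ this.1 (ne_of_gt this.2)⟩
  refine h.not_isTangential hb (hv0.trans ht₀.1) ht₀.2.le ht₁.1.2 ht₀U htan fun a ha => ?_
  exact hus ⟨(le_max_left _ _).trans (ht₀.1.trans ha.1), ha.2⟩

theorem IsCharacteristic.isForwardLine [CompleteSpace E] (hθ : 0 < θ) (hb : IsLocLipschitz U b)
    (h : IsCharacteristic U b θ τ γ) (hL : ∃ L : ℝ≥0, LipschitzOnWith L γ (Icc 0 τ))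
    (hgood : ∀ t ∈ Icc 0 τ, γ t ∈ goodSet U b) : IsForwardLine U b τ γ := by
  set S := Ico 0 τ ∩ γ ⁻¹' Uᶜ
  refine ⟨hL, S, ?_, fun t ht => ?_⟩
  · refine (countable_setOfPred_isolated_right_within (s := S)).mono fun t ht => ?_
    refine mem_ofPred.2 ⟨ht, ?_⟩
    rcases hgood t (Ico_subset_Icc_self ht.1) with hU | ⟨n, lam, r, hc⟩
    · exact absurd hU ht.2
    obtain ⟨t₁, ht₁, hm⟩ := h.exists_forall_mem_of_crossing hθ ht.1 hc
    rw [← empty_mem_iff_bot, mem_nhdsWithin]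
    refine ⟨Iio t₁, isOpen_Iio, ht₁.1, ?_⟩
    rintro a ⟨ha, haS, hat⟩
    have := hm a ⟨hat, le_of_lt ha⟩
    exact haS.2 (hc.mem _ this.1 (ne_of_gt this.2))
  · have hU : γ t ∈ U := by
      by_contra hcon
      exact ht.2 ⟨Ioo_subset_Ico_self ht.1, hcon⟩
    refine ⟨hU, ?_⟩
    have hct : ContinuousAt γ t := h.cont.continuousAt (Icc_mem_nhds ht.1.1 ht.1.2)
    have hev : ∀ᶠ a in 𝓝 t, γ a ∈ U ∧ a ∈ Ioo 0 τ :=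
      (hct.eventually_mem (hb.isOpen.mem_nhds hU)).and (isOpen_Ioo.mem_nhds ht.1)
    obtain ⟨ε, hε, hball⟩ := Metric.nhds_basis_closedBall.eventually_iff.1 hev
    rw [Real.closedBall_eq_Icc] at hball
    have ha := hball (x := t - ε) ⟨le_rfl, by linarith⟩
    have hb' := hball (x := t + ε) ⟨by linarith, le_rfl⟩
    exact (h.hasDerivWithinAt hb (p := t - ε) (q := t + ε) ha.2.1.le hb'.2.2.le
      (fun a ha => (hball ha).1) ⟨by linarith, by linarith⟩).hasDerivAt
      (Icc_mem_nhds (by linarith) (by linarith))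

theorem IsForwardLine.isCharacteristic [CompleteSpace E] (hθ : θ ≤ 1)
    (hb : IsLocLipschitz U b) (h : IsForwardLine U b τ γ) : IsCharacteristic U b θ τ γ := by
  obtain ⟨L, hL⟩ := h.lipschitz
  obtain ⟨S, hS, hode⟩ := h.ode
  refine ⟨hL.continuousOn, fun s t hs hst ht hU => ?_, fun y n lam r hc s t hs hst ht hball => ?_⟩
  · have hbc : ContinuousOn b U := fun y hy => (hb.continuousAt hy).continuousWithinAt
    have hc : ContinuousOn γ (Icc s t) := hL.continuousOn.mono (Icc_subset_Icc hs ht)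
    refine (integral_eq_of_hasDerivAt_off_countable_of_le γ (fun a => b (γ a)) hst hS hc
      (fun a ha => (hode a ⟨⟨hs.trans_lt ha.1.1, ha.1.2.trans_le ht⟩, ha.2⟩).2) ?_).symm
    rw [← uIcc_of_le hst] at hc hU
    exact (hbc.comp hc hU).intervalIntegrable
  · set f : ℝ → ℝ := fun a => inner ℝ n (γ a)
    have hf : ContinuousOn f (Icc s t) := by
      have := hL.continuousOn.mono (Icc_subset_Icc hs ht)
      fun_prop
    have hd : ∀ a ∈ Ioo s t \ S, HasDerivAt f (inner ℝ n (b (γ a))) a := fun a ha => by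
      have := (hode a ⟨⟨hs.trans_lt ha.1.1, ha.1.2.trans_le ht⟩, ha.2⟩).2
      simpa using (hasDerivAt_const a n).inner ℝ this
    have hfL : LipschitzOnWith (‖n‖₊ * L) f (Icc 0 τ) := by
      refine LipschitzOnWith.of_dist_le_mul fun a ha c hc' => ?_
      simp only [f, Real.dist_eq, ← inner_sub_right]
      refine (abs_real_inner_le_norm _ _).trans ?_
      have := hL.dist_le_mul a ha c hc'
      rw [dist_eq_norm, Real.dist_eq] at this
      simp only [NNReal.coe_mul, coe_nnnorm, mul_assoc]
      gcongr
    have hint : IntervalIntegrable (deriv f) volume s t := by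
      rw [intervalIntegrable_iff_integrableOn_Ioo_of_le hst]
      refine Measure.integrableOn_of_bounded (M := (‖n‖₊ * L : ℝ≥0)) (by simp)
        (stronglyMeasurable_deriv f).aestronglyMeasurable ?_
      filter_upwards [ae_restrict_mem measurableSet_Ioo] with a ha
      exact norm_deriv_le_of_lipschitzOn
        (Icc_mem_nhds (hs.trans_lt ha.1) (ha.2.trans_le ht)) hfL
    have hI := integral_eq_of_hasDerivAt_off_countable_of_le f (deriv f) hst hS hf
      (fun a ha => by rw [(hd a ha).deriv]; exact hd a ha) hint
    rw [inner_sub_right, ← hI]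
    have hle : ∫ _ in s..t, θ * lam ≤ ∫ a in s..t, deriv f a := by
      refine intervalIntegral.integral_mono_ae_restrict hst (by simp) hint ?_
      have h1 : ∀ᵐ a ∂(volume.restrict (Icc s t)), a ∈ Ioo s t := by
        rw [restrict_Ioo_eq_restrict_Icc.symm]; exact ae_restrict_mem measurableSet_Ioo
      have h2 : ∀ᵐ a ∂(volume.restrict (Icc s t)), a ∉ S :=
        ae_restrict_of_ae (hS.ae_notMem volume)
      filter_upwards [h1, h2] with a ha haS
      rw [(hd a ⟨ha, haS⟩).deriv]
      have hU := (hode a ⟨⟨hs.trans_lt ha.1, ha.2.trans_le ht⟩, haS⟩).1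
      refine le_trans ?_ (hc.le (γ a) (Metric.ball_subset_ball (by linarith [hc.r_pos])
        (hball a (Ioo_subset_Icc_self ha))) hU)
      have := hc.lam_pos
      nlinarith
    rw [intervalIntegral.integral_const, smul_eq_mul, mul_comm] at hle
    exact hle

/-- Uniform limits of solutions for approximate fields are characteristics. -/
theorem isCharacteristic_of_tendsto [CompleteSpace E]
    {β : ℕ → E → E} {σ : ℕ → ℝ → E} {L : ℝ≥0} (hβ : ∀ i x, ‖β i x‖ ≤ L)
    (hβc : ∀ i, Continuous (β i)) (hσ : ∀ i t, HasDerivAt (σ i) (β i (σ i t)) t)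
    (hlim : TendstoUniformlyOn σ γ atTop (Icc 0 τ))
    (hU : ∀ y ∈ U, ∀ z : ℕ → E, Tendsto z atTop (𝓝 y) →
      Tendsto (fun i => β i (z i)) atTop (𝓝 (b y)))
    (hcross : ∀ y n lam r, IsCrossing U b y n lam r → ∀ᶠ i in atTop, ∀ x ∈ Metric.ball y (r / 2),
      θ * lam ≤ inner ℝ n (β i x)) : IsCharacteristic U b θ τ γ := by
  have hσc : ∀ i, Continuous (σ i) := fun i =>
    continuous_iff_continuousAt.2 fun t => (hσ i t).continuousAt
  have hcont : ContinuousOn γ (Icc 0 τ) :=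
    hlim.continuousOn (Eventually.of_forall fun i => (hσc i).continuousOn).frequently
  refine ⟨hcont, fun s t hs hst ht hmem => ?_, fun y n lam r hc s t hs hst ht hball => ?_⟩
  · have hpt : ∀ a ∈ Icc 0 τ, Tendsto (fun i => σ i a) atTop (𝓝 (γ a)) := fun a ha =>
      hlim.tendsto_at ha
    have h1 : ∀ i, σ i t - σ i s = ∫ a in s..t, β i (σ i a) := fun i =>
      (intervalIntegral.integral_eq_sub_of_hasDerivAt (fun a _ => hσ i a)
        ((hβc i).comp (hσc i)).continuousOn.intervalIntegrable).symm
    have h2 : Tendsto (fun i => ∫ a in s..t, β i (σ i a)) atTop (𝓝 (∫ a in s..t, b (γ a))) := by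
      refine intervalIntegral.tendsto_integral_filter_of_dominated_convergence (fun _ => (L : ℝ))
        (Eventually.of_forall fun i => ((hβc i).comp (hσc i)).aestronglyMeasurable)
        (Eventually.of_forall fun i => ae_of_all _ fun a _ => hβ i _) (by simp)
        (ae_of_all _ fun a ha => ?_)
      rw [uIoc_of_le hst] at ha
      exact hU _ (hmem a (Ioc_subset_Icc_self ha)) _ (hpt a ⟨hs.trans ha.1.le, ha.2.trans ht⟩)
    have h3 := (hpt t ⟨hs.trans hst, ht⟩).sub (hpt s ⟨hs, hst.trans ht⟩)
    simp only [h1] at h3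
    exact tendsto_nhds_unique h3 h2
  · have hcomp : IsCompact (γ '' Icc s t) :=
      isCompact_Icc.image_of_continuousOn (hcont.mono (Icc_subset_Icc hs ht))
    have hsub : γ '' Icc s t ⊆ Metric.ball y (r / 2) := by
      rintro _ ⟨a, ha, rfl⟩; exact hball a ha
    obtain ⟨δ, hδ, hthick⟩ := hcomp.exists_thickening_subset_open Metric.isOpen_ball hsub
    have hpt : ∀ a ∈ Icc 0 τ, Tendsto (fun i => σ i a) atTop (𝓝 (γ a)) := fun a ha =>
      hlim.tendsto_at ha
    have hl : Tendsto (fun i => inner ℝ n (σ i t - σ i s)) atTop (𝓝 (inner ℝ n (γ t - γ s))) :=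
      tendsto_const_nhds.inner ((hpt t ⟨hs.trans hst, ht⟩).sub (hpt s ⟨hs, hst.trans ht⟩))
    refine ge_of_tendsto hl ?_
    filter_upwards [Metric.tendstoUniformlyOn_iff.1 hlim δ hδ, hcross y n lam r hc] with i hi hi'
    have hin : ∀ a ∈ Icc s t, σ i a ∈ Metric.ball y (r / 2) := fun a ha =>
      hthick (Metric.mem_thickening_iff.2 ⟨γ a, mem_image_of_mem _ ha, by
        rw [dist_comm]; exact hi a ⟨hs.trans ha.1, ha.2.trans ht⟩⟩)
    have hd : ∀ a, HasDerivAt (fun a => inner ℝ n (σ i a)) (inner ℝ n (β i (σ i a))) a :=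
      fun a => by simpa using (hasDerivAt_const a n).inner ℝ (hσ i a)
    have hm := (convex_Icc s t).mul_sub_le_image_sub_of_le_deriv
      (f := fun a => inner ℝ n (σ i a)) (C := θ * lam)
      (fun a _ => (hd a).continuousAt.continuousWithinAt)
      (fun a _ => (hd a).differentiableAt.differentiableWithinAt)
      (fun a ha => by
        rw [(hd a).deriv]
        exact hi' _ (hin a (interior_subset ha)))
      s (left_mem_Icc.2 hst) t (right_mem_Icc.2 hst) hst
    rwa [inner_sub_right]

/-- Arzelà–Ascoli for Lipschitz curves with a common starting point. -/
theorem exists_subseq_tendstoUniformlyOn [FiniteDimensional ℝ E] (hτ : 0 ≤ τ) {σ : ℕ → ℝ → E}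
    {L : ℝ≥0} (hσ : ∀ i, LipschitzWith L (σ i)) {x : E} (hx : ∀ i, σ i 0 = x) :
    ∃ (κ : ℕ → ℕ) (γ : ℝ → E), StrictMono κ ∧ LipschitzOnWith L γ (Icc 0 τ) ∧
      TendstoUniformlyOn (fun i => σ (κ i)) γ atTop (Icc 0 τ) := by
  have : ProperSpace E := FiniteDimensional.proper ℝ E
  set z : Icc (0 : ℝ) τ := ⟨0, left_mem_Icc.2 hτ⟩
  set A : Set (BoundedContinuousFunction (Icc (0 : ℝ) τ) E) := {f | LipschitzWith L f ∧ f z = x}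
  have hA : IsCompact A := by
    refine BoundedContinuousFunction.arzela_ascoli₂ (Metric.closedBall x (L * τ))
      (isCompact_closedBall _ _) A ?_ ?_ ?_
    · have hA' : A = (⋂ (a : Icc (0 : ℝ) τ) (c : Icc (0 : ℝ) τ),
          {f : BoundedContinuousFunction (Icc (0 : ℝ) τ) E | dist (f a) (f c) ≤ L * dist a c}) ∩
          {f | f z = x} := by
        ext f
        simp only [A, lipschitzWith_iff_dist_le_mul, mem_inter_iff, mem_iInter, mem_ofPred]
      rw [hA']
      refine IsClosed.inter (isClosed_iInter fun a => isClosed_iInter fun c =>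
        isClosed_le ?_ continuous_const) ?_
      · exact (BoundedContinuousFunction.lipschitz_eval_const a).continuous.dist
          (BoundedContinuousFunction.lipschitz_eval_const c).continuous
      · exact isClosed_eq (BoundedContinuousFunction.lipschitz_eval_const z).continuous continuous_const
    · rintro f a ⟨hf, hf0⟩
      rw [Metric.mem_closedBall, ← hf0]
      refine (hf.dist_le_mul a z).trans ?_
      have : dist a z ≤ τ := by
        rw [Subtype.dist_eq, Real.dist_0_eq_abs, abs_of_nonneg a.2.1]; exact a.2.2
      gcongr
    · exact (LipschitzWith.uniformEquicontinuous _ L fun f => f.2.1).equicontinuous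
  set F : ℕ → BoundedContinuousFunction (Icc (0 : ℝ) τ) E := fun i =>
    BoundedContinuousFunction.mkOfCompact ⟨fun a => σ i a, (hσ i).continuous.comp continuous_subtype_val⟩
  have hF : ∀ i, F i ∈ A := fun i =>
    ⟨fun a c => (hσ i) a c, hx i⟩
  obtain ⟨f, hf, κ, hκ, hlim⟩ := hA.tendsto_subseq hF
  refine ⟨κ, fun t => f (projIcc 0 τ hτ t), hκ, ?_, ?_⟩
  · have := hf.1.comp (LipschitzWith.projIcc hτ)
    rw [mul_one] at this
    exact this.lipschitzOnWith
  · rw [BoundedContinuousFunction.tendsto_iff_tendstoUniformly] at hlim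
    rw [Metric.tendstoUniformlyOn_iff]
    intro ε hε
    filter_upwards [Metric.tendstoUniformly_iff.1 hlim ε hε] with i hi t ht
    have := hi ⟨t, ht⟩
    simp only [projIcc_of_mem hτ ht]
    exact this

end Characteristics


/-! ### Thin sets: subsets of hyperplanes which are null for the hyperplane measure -/

theorem AnalyticOnNhd.countable_zeros {f : ℝ → ℝ} (hf : AnalyticOnNhd ℝ f univ) {t₀ : ℝ}
    (h0 : f t₀ ≠ 0) : {t | f t = 0}.Countable := by
  refine (countable_setOfPred_isolated_right_within (s := {t | f t = 0})).mono fun t ht => ?_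
  refine mem_ofPred.2 ⟨ht, ?_⟩
  have h1 : ∀ᶠ z in 𝓝[≠] t, f z ≠ 0 := by
    rcases (hf t trivial).eventually_eq_zero_or_eventually_ne_zero with h | h
    · have h2 : ∃ᶠ z in 𝓝[≠] t, f z = 0 :=
        (h.filter_mono nhdsWithin_le_nhds).frequently
      exact absurd (hf.eqOn_zero_of_preconnected_of_frequently_eq_zero isPreconnected_univ
        trivial h2 trivial) h0
    · exact h
  rw [← empty_mem_iff_bot]
  have h2 : ∀ᶠ z in 𝓝[{t | f t = 0} ∩ Ioi t] t, f z ≠ 0 :=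
    h1.filter_mono (nhdsWithin_mono _ fun z hz => ne_of_gt hz.2)
  filter_upwards [h2, self_mem_nhdsWithin] with z hz hz' using hz hz'.1

section Thin

variable {E : Type*} [NormedAddCommGroup E] [InnerProductSpace ℝ E] [FiniteDimensional ℝ E]
  [MeasurableSpace E] [BorelSpace E]

theorem AnalyticOnNhd.volume_zeros {f : E → ℝ} (hf : AnalyticOnNhd ℝ f univ) {z₀ : E}
    (h0 : f z₀ ≠ 0) : volume {x | f x = 0} = 0 := by
  set g : E → ℝ := fun x => f (z₀ + x)
  have hfc : Continuous f := continuous_iff_continuousAt.2 fun x => (hf x trivial).continuousAt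
  have hgc : Continuous g := by fun_prop
  set Z : Set (E × ℝ) := {p | g (p.2 • p.1) = 0}
  have hZ : MeasurableSet Z :=
    (isClosed_eq (by fun_prop) continuous_const : IsClosed Z).measurableSet
  have h1 : (volume.prod volume) Z = 0 := by
    rw [Measure.measure_prod_null hZ]
    refine ae_of_all _ fun x => ?_
    have ha : AnalyticOnNhd ℝ (fun t : ℝ => g (t • x)) univ := fun t _ => by
      have h2 : AnalyticAt ℝ (fun t : ℝ => z₀ + t • x) t :=
        analyticAt_const.add (analyticAt_id.smul analyticAt_const)
      exact AnalyticAt.fun_comp (f := fun t : ℝ => z₀ + t • x) (hf _ trivial) h2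
    exact (ha.countable_zeros (t₀ := 0) (by simpa [g] using h0)).measure_zero _
  have h2 : ∀ᵐ r : ℝ, volume {x : E | g (r • x) = 0} = 0 := by
    have h3 : (volume.prod volume) (Prod.swap ⁻¹' Z : Set (ℝ × E)) = 0 := by
      rw [← Measure.prod_swap, Measure.map_apply measurable_swap (measurable_swap hZ)]
      exact h1
    exact Measure.measure_ae_null_of_prod_null h3
  obtain ⟨r, hr, hr0⟩ := (h2.and (Measure.ae_ne volume (0 : ℝ))).exists
  have h4 : {x : E | g (r • x) = 0} = (r • ·) ⁻¹' {x : E | g x = 0} := rfl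
  rw [h4, Measure.addHaar_preimage_smul _ hr0] at hr
  have h5 : volume {x : E | g x = 0} = 0 := by
    rcases mul_eq_zero.1 hr with h | h
    · exfalso
      rw [ENNReal.ofReal_eq_zero] at h
      have : 0 < |(r ^ Module.finrank ℝ E)⁻¹| := by positivity
      linarith
    · exact h
  have h6 : {x : E | g x = 0} = (z₀ + ·) ⁻¹' {x | f x = 0} := rfl
  rwa [h6, measure_preimage_add] at h5

/-- The volume of the `ε`-neighbourhoods of `Z` is `o(ε)`. -/
def IsThin (Z : Set E) : Prop :=
  Tendsto (fun k : ℕ => (k + 1 : ℝ≥0∞) * volume (Metric.thickening (1 / (2 * (k + 1))) Z)) atTop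
    (𝓝 0)

theorem IsThin.biUnion {ι : Type*} (s : Finset ι) {Z : ι → Set E} (h : ∀ i ∈ s, IsThin (Z i)) :
    IsThin (⋃ i ∈ s, Z i) := by
  have h1 := tendsto_finsetSum s fun i hi => h i hi
  rw [Finset.sum_const_zero] at h1
  refine tendsto_of_tendsto_of_tendsto_of_le_of_le tendsto_const_nhds h1 (fun _ => zero_le)
    fun k => ?_
  simp only [Metric.thickening_iUnion]
  rw [← Finset.mul_sum]
  gcongr
  exact measure_biUnion_finset_le _ _

theorem mul_volume_slab_le {n : E} (hn : ‖n‖ = 1) {A : Set E} (hA : MeasurableSet A)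
    (hinv : ∀ (s : ℝ) (x : E), x ∈ A → x + s • n ∈ A) (a : ℝ) (k : ℕ) :
    (k + 1 : ℝ≥0∞) * volume (A ∩ {x | a ≤ inner ℝ n x ∧ inner ℝ n x < a + 1 / (k + 1)}) ≤
      volume (A ∩ {x | a ≤ inner ℝ n x ∧ inner ℝ n x < a + 1}) := by
  set S : ℕ → Set E := fun i =>
    A ∩ {x | a + i / (k + 1) ≤ inner ℝ n x ∧ inner ℝ n x < a + (i + 1) / (k + 1)}
  have hSm : ∀ i, MeasurableSet (S i) := fun i => by
    have hm : Measurable fun x : E => (inner ℝ n x : ℝ) := by fun_prop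
    exact hA.inter ((measurableSet_le measurable_const hm).inter
      (measurableSet_lt hm measurable_const))
  have hk : (0 : ℝ) < k + 1 := by positivity
  have hnn : inner ℝ n n = (1 : ℝ) := by rw [real_inner_self_eq_norm_sq, hn]; norm_num
  have hvol : ∀ i, volume (S 0) ≤ volume (S i) := by
    intro i
    rw [← measure_preimage_add_right volume ((i / (k + 1) : ℝ) • n) (S i)]
    refine measure_mono fun x hx => ⟨hinv _ _ hx.1, ?_⟩
    have h1 := hx.2
    simp only [mem_ofPred_eq, inner_add_right, inner_smul_right, hnn, Nat.cast_zero, zero_div,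
      add_zero, mul_one, zero_add, add_div] at h1 ⊢
    constructor <;> linarith [h1.1, h1.2]
  have hdisj : (↑(Finset.range (k + 1)) : Set ℕ).PairwiseDisjoint S := by
    intro i _ j _ hij
    refine disjoint_left.2 fun x hi hj => hij ?_
    have h1 := hi.2
    have h2 := hj.2
    simp only [mem_ofPred_eq] at h1 h2
    have h3 : (i : ℝ) / (k + 1) < (j + 1) / (k + 1) := by linarith [h1.1, h2.2]
    have h4 : (j : ℝ) / (k + 1) < (i + 1) / (k + 1) := by linarith [h2.1, h1.2]
    rw [div_lt_div_iff_of_pos_right hk] at h3 h4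
    have h5 : i < j + 1 := by exact_mod_cast h3
    have h6 : j < i + 1 := by exact_mod_cast h4
    omega
  have hsum : ∑ i ∈ Finset.range (k + 1), volume (S i) ≤
      volume (A ∩ {x | a ≤ inner ℝ n x ∧ inner ℝ n x < a + 1}) := by
    rw [← measure_biUnion_finset hdisj fun i _ => hSm i]
    refine measure_mono (iUnion₂_subset fun i hi x hx => ⟨hx.1, ?_⟩)
    have h1 := hx.2
    simp only [mem_ofPred_eq] at h1 ⊢
    have h2 : (0 : ℝ) ≤ i / (k + 1) := by positivity
    have h3 : ((i : ℝ) + 1) / (k + 1) ≤ 1 := by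
      rw [div_le_one hk]
      have := Finset.mem_range.1 hi
      exact_mod_cast this
    constructor <;> linarith [h1.1, h1.2]
  refine le_trans ?_ hsum
  calc _ = ∑ i ∈ Finset.range (k + 1), volume (S 0) := by
        rw [Finset.sum_const, Finset.card_range, nsmul_eq_mul]
        simp [S]
    _ ≤ _ := Finset.sum_le_sum fun i _ => hvol i

theorem isThin_zeros {n : E} (hn : ‖n‖ = 1) (c R : ℝ) {q : E → ℝ}
    (hq : AnalyticOnNhd ℝ q univ) {z₀ : E} (hz₀ : inner ℝ n z₀ = c) (hqz : q z₀ ≠ 0) :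
    IsThin {x | x ∈ Metric.closedBall (0 : E) R ∧ inner ℝ n x = c ∧ q x = 0} := by
  set Z : Set E := {x | x ∈ Metric.closedBall (0 : E) R ∧ inner ℝ n x = c ∧ q x = 0}
  have hqc : Continuous q := continuous_iff_continuousAt.2 fun x => (hq x trivial).continuousAt
  have hZc : IsClosed Z := by
    refine IsClosed.inter Metric.isClosed_closedBall (IsClosed.inter ?_ ?_)
    · exact isClosed_eq (by fun_prop) continuous_const
    · exact isClosed_eq hqc continuous_const
  have hZb : Bornology.IsBounded Z := Metric.isBounded_closedBall.subset fun x hx => hx.1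
  have hnn : inner ℝ n n = (1 : ℝ) := by rw [real_inner_self_eq_norm_sq, hn]; norm_num
  set pr : E → E := fun x => x - (inner ℝ n x - c) • n
  have hprc : Continuous pr := by fun_prop
  have hprn : ∀ (s : ℝ) x, pr (x + s • n) = pr x := fun s x => by
    simp only [pr, inner_add_right, inner_smul_right, hnn]
    module
  have hprZ : ∀ x, inner ℝ n x = c → pr x = x := fun x hx => by simp [pr, hx]
  have hprl : ∀ x y, dist (pr x) (pr y) ≤ dist x y := by
    intro x y
    have h1 : pr x - pr y = (x - y) - (inner ℝ n (x - y)) • n := by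
      simp only [pr, inner_sub_right]; module
    rw [dist_eq_norm, dist_eq_norm, h1]
    refine le_of_sq_le_sq ?_ (norm_nonneg _)
    rw [norm_sub_sq_real, inner_smul_right, norm_smul, hn, real_inner_comm]
    simp only [Real.norm_eq_abs, mul_one, sq_abs]
    nlinarith [sq_nonneg (inner ℝ n (x - y))]
  set ε : ℕ → ℝ := fun k => 1 / (2 * (k + 1))
  set A : ℕ → Set E := fun k => pr ⁻¹' Metric.cthickening (ε k) Z
  set T : Set E := {x | c - 1 ≤ inner ℝ n x ∧ inner ℝ n x < c + 1}
  have hε : ∀ k, 0 < ε k := fun k => by positivity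
  have hεa : Antitone ε := fun i j hij => by
    have : (i : ℝ) ≤ j := by exact_mod_cast hij
    simp only [ε]; gcongr
  have hε2 : ∀ k : ℕ, ε k ≤ 1 / 2 := fun k => by
    have := hεa (Nat.zero_le k)
    simpa [ε] using this
  have hAm : ∀ k, MeasurableSet (A k) := fun k =>
    (Metric.isClosed_cthickening.preimage hprc).measurableSet
  have hTm : MeasurableSet T := by
    have hm : Measurable fun x : E => (inner ℝ n x : ℝ) := by fun_prop
    exact (measurableSet_le measurable_const hm).inter (measurableSet_lt hm measurable_const)
  have hlim : Tendsto (fun k => volume (A k ∩ T)) atTop (𝓝 0) := by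
    have hnull : volume (⋂ k, A k ∩ T) = 0 := by
      refine measure_mono_null ?_ (AnalyticOnNhd.volume_zeros (f := fun x => q (pr x)) (z₀ := z₀)
        (fun x _ => ?_) (by rw [hprZ _ hz₀]; exact hqz))
      · intro x hx
        have hx' : pr x ∈ ⋂ k, Metric.cthickening (ε k) Z :=
          mem_iInter.2 fun k => (mem_iInter.1 hx k).1
        have h0 : pr x ∈ Z := by
          rw [← hZc.closure_eq, Metric.closure_eq_iInter_cthickening' Z (range ε)]
          · simpa using hx'
          · intro δ hδ
            obtain ⟨k, hk⟩ := exists_nat_one_div_lt hδ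
            refine ⟨ε k, ⟨k, rfl⟩, hε k, le_trans ?_ hk.le⟩
            simp only [ε]
            apply one_div_le_one_div_of_le <;> linarith [k.cast_nonneg (α := ℝ)]
        exact h0.2.2
      · refine AnalyticAt.fun_comp (hq _ trivial) ?_
        refine analyticAt_id.sub (AnalyticAt.smul (AnalyticAt.sub ?_ analyticAt_const)
          analyticAt_const)
        exact (innerSL ℝ n).analyticAt x
    rw [← hnull]
    refine tendsto_measure_iInter_atTop (fun k => ((hAm k).inter hTm).nullMeasurableSet) ?_ ⟨0, ?_⟩
    · intro i j hij
      exact inter_subset_inter_left _ (preimage_mono (Metric.cthickening_mono (hεa hij) _))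
    · refine ne_of_lt (Bornology.IsBounded.measure_lt_top ?_)
      have hb : Bornology.IsBounded (Metric.cthickening (ε 0) Z) := hZb.cthickening
      obtain ⟨R', hR'⟩ := hb.exists_norm_le
      refine isBounded_iff_forall_norm_le.2 ⟨R' + 1, fun x hx => ?_⟩
      have h1 := hR' _ hx.1
      have h2 : x = pr x + (inner ℝ n x - c) • n := by simp [pr]
      have h3 : |inner ℝ n x - c| ≤ 1 := abs_le.2 ⟨by linarith [hx.2.1], by linarith [hx.2.2]⟩
      calc ‖x‖ = ‖pr x + (inner ℝ n x - c) • n‖ := by rw [← h2]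
        _ ≤ ‖pr x‖ + ‖(inner ℝ n x - c) • n‖ := norm_add_le _ _
        _ ≤ R' + 1 := by rw [norm_smul, hn, mul_one]; exact add_le_add h1 h3
  refine tendsto_of_tendsto_of_tendsto_of_le_of_le tendsto_const_nhds hlim (fun _ => zero_le)
    fun k => ?_
  have hsub : Metric.thickening (ε k) Z ⊆
      A k ∩ {x | (c - ε k) ≤ inner ℝ n x ∧ inner ℝ n x < (c - ε k) + 1 / (k + 1)} := by
    intro x hx
    obtain ⟨z, hz, hxz⟩ := Metric.mem_thickening_iff.1 hx
    refine ⟨?_, ?_⟩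
    · refine Metric.mem_cthickening_of_dist_le (pr x) z _ _ hz ?_
      rw [← hprZ z hz.2.1]
      exact (hprl x z).trans hxz.le
    · have h1 : |inner ℝ n x - c| < ε k := by
        rw [← hz.2.1, ← inner_sub_right]
        refine (abs_real_inner_le_norm _ _).trans_lt ?_
        rwa [hn, one_mul, ← dist_eq_norm]
      have h2 : ε k + ε k = 1 / (k + 1) := by simp only [ε]; field_simp; norm_num
      have h3 := abs_lt.1 h1
      rw [← h2]
      constructor <;> linarith [h3.1, h3.2]
  calc (k + 1 : ℝ≥0∞) * volume (Metric.thickening (1 / (2 * (k + 1))) Z)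
      ≤ (k + 1 : ℝ≥0∞) * volume (A k ∩
        {x | (c - ε k) ≤ inner ℝ n x ∧ inner ℝ n x < (c - ε k) + 1 / (k + 1)}) := by
        gcongr
    _ ≤ volume (A k ∩ {x | (c - ε k) ≤ inner ℝ n x ∧ inner ℝ n x < (c - ε k) + 1}) :=
        mul_volume_slab_le hn (hAm k) (fun s x hx => by
          simp only [A, mem_preimage, hprn]; exact hx) _ _
    _ ≤ volume (A k ∩ T) := by
        refine measure_mono (inter_subset_inter_right _ fun x hx => ?_)
        have := hε k
        have := hε2 k
        exact ⟨by linarith [hx.1], by linarith [hx.2]⟩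

end Thin


/-! ### The geometry of a polytopal mesh -/

theorem IsThin.empty {E : Type*} [NormedAddCommGroup E] [InnerProductSpace ℝ E]
    [FiniteDimensional ℝ E] [MeasurableSpace E] [BorelSpace E] : IsThin (∅ : Set E) := by
  simp [IsThin]

/-- A finite family of analytic functions on finitely many hyperplanes: off a thin set, the ones
that vanish at a point of a hyperplane vanish on the whole hyperplane. -/
theorem exists_isThin_forall_zero {E : Type*} [NormedAddCommGroup E] [InnerProductSpace ℝ E]
    [FiniteDimensional ℝ E] [MeasurableSpace E] [BorelSpace E] {ι : Type*} (s : Finset ι)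
    (H : Finset (E × ℝ)) (hH : ∀ h ∈ H, ‖h.1‖ = 1) (q : ι → E × ℝ → E → ℝ)
    (hq : ∀ i ∈ s, ∀ h ∈ H, AnalyticOnNhd ℝ (q i h) univ) (R : ℝ) :
    ∃ B : Set E, IsThin B ∧ ∀ y ∈ Metric.closedBall (0 : E) R, y ∉ B → ∀ h ∈ H,
      inner ℝ h.1 y = h.2 → ∀ i ∈ s, q i h y = 0 → ∀ z, inner ℝ h.1 z = h.2 → q i h z = 0 := by
  classical
  set Z : ι × (E × ℝ) → Set E := fun p =>
    if ∃ z, inner ℝ p.2.1 z = p.2.2 ∧ q p.1 p.2 z ≠ 0 then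
      {x | x ∈ Metric.closedBall (0 : E) R ∧ inner ℝ p.2.1 x = p.2.2 ∧ q p.1 p.2 x = 0} else ∅
  refine ⟨⋃ p ∈ s ×ˢ H, Z p, IsThin.biUnion _ fun p hp => ?_, fun y hy hyB h hh hyh i hi h0 z hz => ?_⟩
  · rw [Finset.mem_product] at hp
    by_cases h : ∃ z, inner ℝ p.2.1 z = p.2.2 ∧ q p.1 p.2 z ≠ 0
    · simp only [Z, if_pos h]
      obtain ⟨z, hz, hqz⟩ := h
      exact isThin_zeros (hH _ hp.2) _ R (hq _ hp.1 _ hp.2) hz hqz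
    · simp only [Z, if_neg h]
      exact IsThin.empty
  · by_contra hne
    refine hyB (mem_iUnion₂.2 ⟨(i, h), Finset.mem_product.2 ⟨hi, hh⟩, ?_⟩)
    have : ∃ z, inner ℝ h.1 z = h.2 ∧ q i h z ≠ 0 := ⟨z, hz, hne⟩
    simp only [Z, if_pos this]
    exact ⟨hy, hyh, h0⟩

/-- The data of a mollifiable field: `φ` and `V` are defined on the whole space, `V` vanishes off
the open set `U`, has bounded divergence, and the closure of `U` consists of points of the good
set, tangential points, and a thin set `B`. -/
structure FieldData {E : Type*} [NormedAddCommGroup E] [InnerProductSpace ℝ E]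
    [FiniteDimensional ℝ E] [MeasurableSpace E] [BorelSpace E] (U : Set E) (φ : E → ℝ)
    (V : E → E) (φmin φmax Γ C : ℝ) (B : Set E) : Prop where
  pos : 0 < φmin
  le : φmin ≤ φmax
  gamma_nonneg : 0 ≤ Γ
  bounded : Bornology.IsBounded U
  phi_meas : AEStronglyMeasurable φ volume
  phi_bounds : ∀ x, φmin ≤ φ x ∧ φ x ≤ φmax
  meas : AEStronglyMeasurable V volume
  norm_le : ∀ x, ‖V x‖ ≤ C
  eq_zero : ∀ x, x ∉ U → V x = 0
  weakDiv : HasBoundedWeakDiv V Γ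
  cont : ∀ x ∈ U, ContinuousAt φ x ∧ ContinuousAt V x
  ae_cont : ∀ᵐ x, ContinuousAt φ x ∧ ContinuousAt V x
  lip : IsLocLipschitz U fun x => (φ x)⁻¹ • V x
  thin : IsThin B
  classify : ∀ y ∈ closure U, y ∉ B → y ∈ goodSet U (fun x => (φ x)⁻¹ • V x) ∨
    ∃ n C r, IsTangential U (fun x => (φ x)⁻¹ • V x) y n C r

namespace PolytopalMesh

variable {d : ℕ} {Ω : Set (Pt d)} (M : PolytopalMesh Ω)

/-- The union of the open cells. -/
def inside : Set (Pt d) := ⋃ K ∈ M.cells, K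

variable {M}

theorem isOpen_cell {K : Set (Pt d)} (hK : K ∈ M.cells) : IsOpen K := by
  rw [← (M.polytopal K hK).regular]; exact isOpen_interior

theorem isOpen_inside : IsOpen M.inside := isOpen_biUnion fun _ hK => isOpen_cell hK

theorem cell_subset_inside {K : Set (Pt d)} (hK : K ∈ M.cells) : K ⊆ M.inside :=
  subset_biUnion_of_mem (u := fun K => K) hK

theorem mem_inside {x : Pt d} : x ∈ M.inside ↔ ∃ K ∈ M.cells, x ∈ K := by
  simp [inside]

theorem closure_inside : closure M.inside = ⋃ K ∈ M.cells, closure K :=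
  M.finite.closure_biUnion _

theorem inside_subset : M.inside ⊆ Ω := by
  exact (interior_maximal (biUnion_mono subset_rfl fun K _ => subset_closure)
    isOpen_inside).trans M.cover.subset

theorem subset_closure_inside : Ω ⊆ closure M.inside := by
  rw [closure_inside]
  exact M.cover.symm.subset.trans interior_subset

theorem isBounded_inside : Bornology.IsBounded M.inside :=
  (Bornology.isBounded_biUnion M.finite).2 fun K hK => (M.polytopal K hK).bounded

theorem mem_frontier_of_notMem {y : Pt d} (hy : y ∈ closure M.inside) (hy' : y ∉ M.inside) :
    ∃ K ∈ M.cells, y ∈ frontier K := by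
  rw [closure_inside] at hy
  obtain ⟨K, hK, hyK⟩ := mem_iUnion₂.1 hy
  refine ⟨K, hK, ?_⟩
  rw [(isOpen_cell hK).frontier_eq]
  exact ⟨hyK, fun h => hy' (cell_subset_inside hK h)⟩

theorem exists_unit_normals (M : PolytopalMesh Ω) : ∃ H : Finset (Pt d × ℝ), (∀ h ∈ H, ‖h.1‖ = 1) ∧
    ∀ K ∈ M.cells, ∀ x ∈ frontier K, ∃ h ∈ H, inner ℝ h.1 x = h.2 := by
  classical
  have h0 : ∀ K : Set (Pt d), ∃ H : Finset (Pt d × ℝ), K ∈ M.cells → (∀ h ∈ H, h.1 ≠ 0) ∧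
      ∀ x ∈ frontier K, ∃ h ∈ H, inner ℝ h.1 x = h.2 := fun K => by
    by_cases hK : K ∈ M.cells
    · obtain ⟨H, hH⟩ := (M.polytopal K hK).flat
      exact ⟨H, fun _ => hH⟩
    · exact ⟨∅, fun h => absurd h hK⟩
  choose H hH using h0
  refine ⟨(M.finite.toFinset.biUnion H).image fun h => (‖h.1‖⁻¹ • h.1, ‖h.1‖⁻¹ * h.2), ?_, ?_⟩
  · intro h hh
    simp only [Finset.mem_image, Finset.mem_biUnion, Set.Finite.mem_toFinset] at hh
    obtain ⟨h', ⟨K, hK, hh'⟩, rfl⟩ := hh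
    have := (hH K hK).1 h' hh'
    simp [norm_smul, this]
  · intro K hK x hx
    obtain ⟨h, hh, hx'⟩ := (hH K hK).2 x hx
    refine ⟨(‖h.1‖⁻¹ • h.1, ‖h.1‖⁻¹ * h.2), ?_, by rw [inner_smul_left, hx']; simp⟩
    exact Finset.mem_image.2 ⟨h, Finset.mem_biUnion.2 ⟨K, M.finite.mem_toFinset.2 hK, hh⟩, rfl⟩

theorem volume_closure_diff : volume (closure M.inside \ M.inside) = 0 := by
  obtain ⟨H, hH1, hH⟩ := M.exists_unit_normals
  refine measure_mono_null (t := ⋃ h ∈ H, {x : Pt d | inner ℝ h.1 x = h.2}) ?_ ?_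
  · rintro y ⟨hy, hy'⟩
    obtain ⟨K, hK, hyK⟩ := mem_frontier_of_notMem hy hy'
    obtain ⟨h, hh, hx⟩ := hH K hK y hyK
    exact mem_iUnion₂.2 ⟨h, hh, hx⟩
  · refine (measure_biUnion_null_iff H.countable_toSet).2 fun h hh => ?_
    refine volume_hyperplane (fun h0 => ?_) h.2
    have := hH1 h hh
    simp [h0] at this

theorem inside_ae_eq : M.inside =ᵐ[volume] Ω := by
  refine (inside_subset.eventuallyLE).antisymm ?_
  refine ae_le_set.2 (measure_mono_null ?_ (volume_closure_diff (M := M)))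
  exact sdiff_subset_sdiff_left subset_closure_inside

theorem restrict_inside : volume.restrict M.inside = volume.restrict Ω :=
  Measure.restrict_congr_set inside_ae_eq

end PolytopalMesh

theorem analyticOnNhd_sum_smul {E F ι : Type*} [NormedAddCommGroup E] [NormedSpace ℝ E]
    [NormedAddCommGroup F] [NormedSpace ℝ F] (s : Finset ι) (p : ι → E → ℝ) (v : ι → F)
    (hp : ∀ i ∈ s, AnalyticOnNhd ℝ (p i) univ) :
    AnalyticOnNhd ℝ (fun x => ∑ i ∈ s, p i x • v i) univ :=
  Finset.analyticOnNhd_fun_sum s fun i hi => (hp i hi).smul analyticOnNhd_const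

theorem PiecewisePolynomial.exists_analytic {d : ℕ} {Ω : Set (Pt d)} {M : PolytopalMesh Ω}
    {V : Pt d → Pt d} (h : PiecewisePolynomial M V) :
    ∀ K ∈ M.cells, ∃ W : Pt d → Pt d, AnalyticOnNhd ℝ W univ ∧ ∀ x ∈ K, V x = W x := by
  intro K hK
  obtain ⟨P, hP⟩ := h K hK
  refine ⟨fun x => ∑ i, MvPolynomial.eval (fun j => x j) (P i) • EuclideanSpace.single i (1 : ℝ),
    ?_, fun x hx => ?_⟩
  · have h1 : ∀ i, AnalyticOnNhd ℝ (fun x : Pt d => MvPolynomial.eval (fun j => x j) (P i)) univ :=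
      fun i => AnalyticOnNhd.eval_continuousLinearMap'
        (fun j => (EuclideanSpace.proj j : Pt d →L[ℝ] ℝ)) (P i)
    exact analyticOnNhd_sum_smul _ _ _ fun i _ => h1 i
  · ext i
    simp [hP x hx i, Pi.single_apply]

section LocalStructure

variable {E : Type*} [NormedAddCommGroup E] [InnerProductSpace ℝ E]

theorem inner_ne_of_hyperplane_subset {n n' x y : E} {c c' : ℝ} (hn' : n' ≠ 0)
    (hy : inner ℝ n y = c) (hsub : ∀ z, inner ℝ n z = c → inner ℝ n' z = c')
    (hx : inner ℝ n (x - y) ≠ 0) : inner ℝ n' x ≠ c' := by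
  intro hx'
  have hy' := hsub y hy
  set w := x - y
  have hw' : inner ℝ n' w = (0 : ℝ) := by rw [inner_sub_right, hx', hy', sub_self]
  have h1 := hsub (y + (n' - (inner ℝ n n' / inner ℝ n w) • w)) (by
    rw [inner_add_right, inner_sub_right, inner_smul_right, div_mul_cancel₀ _ hx, sub_self,
      add_zero, hy])
  rw [inner_add_right, inner_sub_right, inner_smul_right, hw', hy', mul_zero, sub_zero] at h1
  exact hn' (inner_self_eq_zero.1 (by linarith : (inner ℝ n' n' : ℝ) = 0))

/-- One of the two open half-balls cut out by a hyperplane. -/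
theorem convex_halfBall (y n : E) (r : ℝ) :
    Convex ℝ (Metric.ball y r ∩ {x | 0 < inner ℝ n (x - y)}) := by
  refine (convex_ball y r).inter ?_
  have : {x | (0 : ℝ) < inner ℝ n (x - y)} = {x | inner ℝ n y < innerSL ℝ n x} := by
    ext x; simp [inner_sub_right]
  rw [this]
  exact convex_halfSpace_gt (innerSL ℝ n).isLinear _

theorem exists_mem_halfBall {y n z : E} {r : ℝ} (hn : n ≠ 0) (hz : z ∈ Metric.ball y r)
    (hzn : 0 ≤ inner ℝ n (z - y)) {s : Set E} (hs : s ∈ 𝓝 z) :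
    ∃ x ∈ s, x ∈ Metric.ball y r ∩ {x | 0 < inner ℝ n (x - y)} := by
  have hc : Tendsto (fun a : ℝ => z + a • n) (𝓝[>] 0) (𝓝 z) := by
    have : Continuous fun a : ℝ => z + a • n := by fun_prop
    simpa using (this.tendsto 0).mono_left nhdsWithin_le_nhds
  obtain ⟨a, h1, h2, h3⟩ := ((hc.eventually_mem hs).and
    ((hc.eventually_mem (Metric.isOpen_ball.mem_nhds hz)).and self_mem_nhdsWithin)).exists
  refine ⟨_, h1, h2, ?_⟩
  have : (0 : ℝ) < a * inner ℝ n n := mul_pos h3 (real_inner_self_pos.2 hn)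
  simp only [mem_ofPred_eq, add_sub_right_comm, inner_add_right, inner_smul_right]
  linarith

end LocalStructure

theorem IsPreconnected.subset_or_disjoint {X : Type*} [TopologicalSpace X] {s K : Set X}
    (hs : IsPreconnected s) (hK : IsOpen K) (hd : Disjoint s (frontier K)) :
    s ⊆ K ∨ Disjoint s K := by
  by_cases h : (s ∩ K).Nonempty
  · refine Or.inl (hs.subset_left_of_subset_union hK isClosed_closure.isOpen_compl
      (disjoint_compl_right.mono_left subset_closure) (fun x hx => ?_) h)
    by_cases hxK : x ∈ K
    · exact Or.inl hxK
    · exact Or.inr fun h' => disjoint_left.1 hd hx (by rw [hK.frontier_eq]; exact ⟨h', hxK⟩)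
  · exact Or.inr (disjoint_iff_inter_eq_empty.2 (not_nonempty_iff_eq_empty.1 h))

theorem exists_lipschitzOnWith_inv_smul {E : Type*} [NormedAddCommGroup E]
    [InnerProductSpace ℝ E] [FiniteDimensional ℝ E] {p : E → ℝ} {W : E → E} {y : E}
    (hp : ContDiff ℝ ∞ p) (hW : AnalyticOnNhd ℝ W univ) (hy : p y ≠ 0) :
    ∃ r > 0, ∃ C : ℝ≥0, LipschitzOnWith C (fun x => (p x)⁻¹ • W x) (Metric.ball y r) := by
  have h1 : ContDiffAt ℝ 1 (fun x => (p x)⁻¹ • W x) y :=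
    ((hp.of_le (mod_cast le_top)).contDiffAt.inv hy).smul (hW y (mem_univ _)).contDiffAt
  obtain ⟨C, t, ht, hC⟩ := h1.exists_lipschitzOnWith
  obtain ⟨r, hr, hrt⟩ := Metric.mem_nhds_iff.1 ht
  exact ⟨r, hr, C, hC.mono hrt⟩

theorem exists_lipschitzOnWith_analytic {E : Type*} [NormedAddCommGroup E]
    [InnerProductSpace ℝ E] [FiniteDimensional ℝ E] {W : E → E} {y : E}
    (hW : AnalyticOnNhd ℝ W univ) :
    ∃ r > 0, ∃ C : ℝ≥0, LipschitzOnWith C W (Metric.ball y r) := by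
  obtain ⟨C, t, ht, hC⟩ := ((hW y (mem_univ _)).contDiffAt (n := 1)).exists_lipschitzOnWith
  obtain ⟨r, hr, hrt⟩ := Metric.mem_nhds_iff.1 ht
  exact ⟨r, hr, C, hC.mono hrt⟩

/-- What a field looks like on one side of the hyperplane through `y` with normal `n`: it is given
by smooth data, or the side does not meet `U`. -/
structure IsSide {E : Type*} [NormedAddCommGroup E] [InnerProductSpace ℝ E] (U : Set E)
    (φ : E → ℝ) (V : E → E) (y n : E) (r : ℝ) (p : E → ℝ) (W : E → E) : Prop where
  smooth : ContDiff ℝ ∞ p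
  analytic : AnalyticOnNhd ℝ W univ
  eq : ∀ x ∈ Metric.ball y r ∩ {x | 0 < inner ℝ n (x - y)}, V x = W x ∧ φ x = p x
  dichotomy : Metric.ball y r ∩ {x | 0 < inner ℝ n (x - y)} ⊆ U ∨
    Disjoint (Metric.ball y r ∩ {x | 0 < inner ℝ n (x - y)}) U ∧ W = 0
  zero : inner ℝ n (W y) = 0 → ∀ z, inner ℝ n (z - y) = 0 → inner ℝ n (W z) = 0

section Sides

variable {E : Type*} [NormedAddCommGroup E] [InnerProductSpace ℝ E] [FiniteDimensional ℝ E]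
  {U : Set E} {φ : E → ℝ} {V : E → E} {y n : E} {r φmin φmax : ℝ} {p p₁ p₂ : E → ℝ}
  {W W₁ W₂ : E → E}

theorem IsSide.le (h : IsSide U φ V y n r p W) (hn : n ≠ 0) (hr : 0 < r)
    (hφ : ∀ x, φmin ≤ φ x) : φmin ≤ p y := by
  by_contra! hlt
  have : ∀ᶠ x in 𝓝 y, p x < φmin := h.smooth.continuous.continuousAt.eventually_lt_const hlt
  obtain ⟨x, hx, hxs⟩ := exists_mem_halfBall hn (Metric.mem_ball_self hr) (by simp) this
  have h1 := hφ x
  rw [(h.eq x hxs).2] at h1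
  exact absurd hx (not_lt.2 h1)

/-- On a side, the flux through the hyperplane is at most linear in the distance if it vanishes. -/
theorem IsSide.exists_le (h : IsSide U φ V y n r p W) (hn : ‖n‖ = 1) (hr : 0 < r)
    (hφ : ∀ x, φmin ≤ φ x) (hmin : 0 < φmin) (h0 : inner ℝ n (W y) = 0) :
    ∃ C ρ : ℝ, 0 ≤ C ∧ 0 < ρ ∧ ρ ≤ r ∧ ∀ x ∈ Metric.ball y ρ, 0 < inner ℝ n (x - y) →
      |inner ℝ n ((φ x)⁻¹ • V x)| ≤ C * |inner ℝ n (x - y)| := by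
  obtain ⟨ρ, hρ, C, hC⟩ := exists_lipschitzOnWith_analytic (y := y) h.analytic
  refine ⟨φmin⁻¹ * C, min ρ r, by positivity, lt_min hρ hr, min_le_right _ _, fun x hx hxn => ?_⟩
  have hxρ : x ∈ Metric.ball y ρ := Metric.ball_subset_ball (min_le_left _ _) hx
  have hxr : x ∈ Metric.ball y r := Metric.ball_subset_ball (min_le_right _ _) hx
  set a := inner ℝ n (x - y) with ha
  have hnn : inner ℝ n n = (1 : ℝ) := by rw [real_inner_self_eq_norm_sq, hn]; norm_num
  set z := x - a • n
  have hzn : inner ℝ n (z - y) = 0 := by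
    simp only [z]
    rw [sub_right_comm, inner_sub_right, inner_smul_right, ← ha, hnn]; ring
  have hzρ : z ∈ Metric.ball y ρ := by
    rw [mem_ball_iff_norm] at hxρ ⊢
    refine lt_of_le_of_lt ?_ hxρ
    have e : x - y = (z - y) + a • n := by simp only [z]; abel
    have : ‖x - y‖ ^ 2 = ‖z - y‖ ^ 2 + ‖a • n‖ ^ 2 := by
      rw [e, norm_add_sq_real, inner_smul_right, real_inner_comm, hzn]; ring
    exact le_of_sq_le_sq (by nlinarith [sq_nonneg ‖a • n‖]) (norm_nonneg _)
  have h1 : |inner ℝ n (W x)| ≤ C * |a| := by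
    have h2 : inner ℝ n (W x) = inner ℝ n (W x - W z) := by
      rw [inner_sub_right, h.zero h0 z hzn, sub_zero]
    rw [h2]
    refine (abs_real_inner_le_norm _ _).trans ?_
    rw [hn, one_mul, ← dist_eq_norm]
    refine (hC.dist_le_mul x hxρ z hzρ).trans_eq ?_
    simp [z, norm_smul, hn]
  rw [(h.eq x ⟨hxr, hxn⟩).1, inner_smul_right, abs_mul, mul_assoc]
  have h3 := hφ x
  refine mul_le_mul ?_ h1 (abs_nonneg _) (by positivity)
  rw [abs_of_nonneg (by have := hmin.trans_le h3; positivity)]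
  gcongr

theorem isTangential_of_isSide (h₁ : IsSide U φ V y n r p₁ W₁) (h₂ : IsSide U φ V y (-n) r p₂ W₂)
    (hn : ‖n‖ = 1) (hr : 0 < r) (hφ : ∀ x, φmin ≤ φ x) (hmin : 0 < φmin)
    (hU : ∀ x ∈ Metric.ball y r, inner ℝ n (x - y) = 0 → x ∉ U) (h01 : inner ℝ n (W₁ y) = 0)
    (h02 : inner ℝ n (W₂ y) = 0) :
    ∃ C ρ, IsTangential U (fun x => (φ x)⁻¹ • V x) y n C ρ := by
  obtain ⟨C₁, ρ₁, hC₁, hρ₁, hr₁, hle₁⟩ := h₁.exists_le hn hr hφ hmin h01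
  obtain ⟨C₂, ρ₂, hC₂, hρ₂, hr₂, hle₂⟩ := h₂.exists_le (by rwa [norm_neg]) hr hφ hmin
    (by rw [inner_neg_left, h02, neg_zero])
  have hs₁ : Metric.ball y (min ρ₁ ρ₂) ⊆ Metric.ball y ρ₁ := Metric.ball_subset_ball (min_le_left _ _)
  have hs₂ : Metric.ball y (min ρ₁ ρ₂) ⊆ Metric.ball y ρ₂ := Metric.ball_subset_ball (min_le_right _ _)
  have hs : Metric.ball y (min ρ₁ ρ₂) ⊆ Metric.ball y r := hs₁.trans (Metric.ball_subset_ball hr₁)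
  refine ⟨max C₁ C₂, min ρ₁ ρ₂, lt_min hρ₁ hρ₂, fun x hx => hU x (hs hx), ?_, ?_, ?_⟩
  · intro x hx x' hx' hxn hxn' hxU
    rcases h₁.dichotomy with h | h
    · exact h ⟨hs hx', hxn'⟩
    · exact absurd hxU (disjoint_left.1 h.1 ⟨hs hx, hxn⟩)
  · intro x hx x' hx' hxn hxn' hxU
    have e : ∀ z, inner ℝ n (z - y) < 0 → 0 < inner ℝ (-n) (z - y) := fun z hz => by
      rw [inner_neg_left]; linarith
    rcases h₂.dichotomy with h | h
    · exact h ⟨hs hx', e _ hxn'⟩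
    · exact absurd hxU (disjoint_left.1 h.1 ⟨hs hx, e _ hxn⟩)
  · intro x hx hxU
    rcases lt_trichotomy (inner ℝ n (x - y)) 0 with h | h | h
    · have := hle₂ x (hs₂ hx) (by rw [inner_neg_left]; linarith)
      rw [inner_neg_left, inner_neg_left, abs_neg, abs_neg] at this
      exact this.trans (mul_le_mul_of_nonneg_right (le_max_right _ _) (abs_nonneg _))
    · exact absurd hxU (hU x (hs hx) h)
    · exact (hle₁ x (hs₁ hx) h).trans
        (mul_le_mul_of_nonneg_right (le_max_left _ _) (abs_nonneg _))

theorem IsSide.exists_crossing (h : IsSide U φ V y n r p W) (hn : n ≠ 0) (hr : 0 < r)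
    (hφ : ∀ x, φmin ≤ φ x ∧ φ x ≤ φmax) (hmin : 0 < φmin) {m : E} (h0 : 0 < inner ℝ m (W y)) :
    ∃ ρ : ℝ, 0 < ρ ∧ ρ ≤ r ∧ Metric.ball y ρ ∩ {x | 0 < inner ℝ n (x - y)} ⊆ U ∧
      (∀ x ∈ Metric.ball y ρ, 0 < inner ℝ n (x - y) →
        inner ℝ m (W y) / 2 / φmax ≤ inner ℝ m ((φ x)⁻¹ • V x)) ∧
      ∃ C : ℝ≥0, LipschitzOnWith C (fun x => (φ x)⁻¹ • V x)
        (Metric.ball y ρ ∩ {x | 0 < inner ℝ n (x - y)}) := by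
  have hU : Metric.ball y r ∩ {x | 0 < inner ℝ n (x - y)} ⊆ U := by
    rcases h.dichotomy with h' | h'
    · exact h'
    · rw [h'.2] at h0; simp at h0
  have hpy : p y ≠ 0 := (hmin.trans_le (h.le hn hr fun x => (hφ x).1)).ne'
  obtain ⟨ρ₁, hρ₁, C, hC⟩ := exists_lipschitzOnWith_inv_smul (y := y) h.smooth h.analytic hpy
  have hc : ∀ᶠ x in 𝓝 y, inner ℝ m (W y) / 2 < inner ℝ m (W x) := by
    have : ContinuousAt (fun x => inner ℝ m (W x)) y :=
      continuousAt_const.inner (h.analytic y (mem_univ _)).continuousAt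
    exact this.eventually_const_lt (by linarith)
  obtain ⟨ρ₂, hρ₂, hc⟩ := Metric.mem_nhds_iff.1 hc
  obtain ⟨ρ, hρ, hρr, hρ1, hρ2⟩ : ∃ ρ : ℝ, 0 < ρ ∧ ρ ≤ r ∧ ρ ≤ ρ₁ ∧ ρ ≤ ρ₂ :=
    ⟨min (min ρ₁ ρ₂) r, lt_min (lt_min hρ₁ hρ₂) hr, min_le_right _ _,
      (min_le_left _ _).trans (min_le_left _ _), (min_le_left _ _).trans (min_le_right _ _)⟩
  refine ⟨ρ, hρ, hρr, (inter_subset_inter_left _ (Metric.ball_subset_ball hρr)).trans hU,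
    fun x hx hxn => ?_, C, ?_⟩
  · have h1 : inner ℝ m (W y) / 2 < inner ℝ m (W x) := hc (Metric.ball_subset_ball hρ2 hx)
    have h2 := hφ x
    have h3 := hmin.trans_le h2.1
    rw [(h.eq x ⟨Metric.ball_subset_ball hρr hx, hxn⟩).1, inner_smul_right, div_eq_inv_mul]
    exact mul_le_mul (inv_anti₀ h3 h2.2) h1.le (by positivity) (by positivity)
  · intro x hx x' hx'
    obtain ⟨e1, e2⟩ := h.eq x ⟨Metric.ball_subset_ball hρr hx.1, hx.2⟩
    obtain ⟨e1', e2'⟩ := h.eq x' ⟨Metric.ball_subset_ball hρr hx'.1, hx'.2⟩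
    simp only [e1, e2, e1', e2']
    exact hC (Metric.ball_subset_ball hρ1 hx.1) (Metric.ball_subset_ball hρ1 hx'.1)

theorem isCrossing_of_isSide (h₁ : IsSide U φ V y n r p₁ W₁) (h₂ : IsSide U φ V y (-n) r p₂ W₂)
    (hn : n ≠ 0) (hr : 0 < r) (hφ : ∀ x, φmin ≤ φ x ∧ φ x ≤ φmax) (hmin : 0 < φmin)
    (hU : ∀ x ∈ Metric.ball y r, inner ℝ n (x - y) = 0 → x ∉ U) {m : E} (hm : m = n ∨ m = -n)
    (h0 : 0 < inner ℝ m (W₁ y)) (h12 : inner ℝ m (W₁ y) = inner ℝ m (W₂ y)) :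
    ∃ lam ρ, IsCrossing U (fun x => (φ x)⁻¹ • V x) y m lam ρ := by
  obtain ⟨ρ₁, hρ₁, hr₁, hU₁, hle₁, C₁, hC₁⟩ := h₁.exists_crossing hn hr hφ hmin h0
  obtain ⟨ρ₂, hρ₂, hr₂, hU₂, hle₂, C₂, hC₂⟩ := h₂.exists_crossing (neg_ne_zero.2 hn) hr hφ hmin
    (h12 ▸ h0)
  obtain ⟨ρ, hρ, hρ1, hρ2⟩ : ∃ ρ : ℝ, 0 < ρ ∧ ρ ≤ ρ₁ ∧ ρ ≤ ρ₂ :=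
    ⟨min ρ₁ ρ₂, lt_min hρ₁ hρ₂, min_le_left _ _, min_le_right _ _⟩
  have hmax : 0 < φmax := hmin.trans_le ((hφ y).1.trans (hφ y).2)
  have en : ∀ z, inner ℝ n (z - y) < 0 → 0 < inner ℝ (-n) (z - y) := fun z hz => by
    rw [inner_neg_left]; linarith
  have b1 := Metric.ball_subset_ball (x := y) hρ1
  have b2 := Metric.ball_subset_ball (x := y) hρ2
  have hside : ∀ x, inner ℝ m (x - y) ≠ 0 → 0 < inner ℝ n (x - y) ∨ 0 < inner ℝ (-n) (x - y) := by
    intro x hx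
    rcases hm with rfl | rfl
    · exact (lt_or_gt_of_ne hx).symm.imp_right (en x)
    · exact (lt_or_gt_of_ne hx).imp_left fun h => by rw [inner_neg_left] at h; linarith
  have l1 : LipschitzOnWith (max C₁ C₂) (fun x => (φ x)⁻¹ • V x)
      (Metric.ball y ρ ∩ {x | 0 < inner ℝ n (x - y)}) :=
    (hC₁.weaken (le_max_left _ _)).mono (inter_subset_inter_left _ b1)
  have l2 : LipschitzOnWith (max C₁ C₂) (fun x => (φ x)⁻¹ • V x)
      (Metric.ball y ρ ∩ {x | 0 < inner ℝ (-n) (x - y)}) :=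
    (hC₂.weaken (le_max_right _ _)).mono (inter_subset_inter_left _ b2)
  refine ⟨inner ℝ m (W₁ y) / 2 / φmax, ρ, ⟨?_, by positivity, hρ, fun x hx hxm => ?_,
    fun x hx hxU => ?_, max C₁ C₂, ?_⟩⟩
  · rcases hm with rfl | rfl
    · exact hn
    · exact neg_ne_zero.2 hn
  · rcases hside x hxm with h | h
    · exact hU₁ ⟨b1 hx, h⟩
    · exact hU₂ ⟨b2 hx, h⟩
  · by_cases hxm : inner ℝ m (x - y) = 0
    · refine absurd hxU (hU x (Metric.ball_subset_ball (hρ1.trans hr₁) hx) ?_)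
      rcases hm with rfl | rfl
      · exact hxm
      · rwa [inner_neg_left, neg_eq_zero] at hxm
    · rcases hside x hxm with h | h
      · exact hle₁ x (b1 hx) h
      · rw [h12]; exact hle₂ x (b2 hx) h
  · rcases hm with rfl | rfl
    · refine ⟨l1, l2.mono ?_⟩
      exact fun x hx => ⟨hx.1, en x hx.2⟩
    · refine ⟨l2, l1.mono fun x hx => ⟨hx.1, ?_⟩⟩
      have := hx.2
      simp only [mem_ofPred_eq, inner_neg_left] at this ⊢
      linarith

theorem goodSet_or_isTangential_of_isSide [MeasurableSpace E] [BorelSpace E] {Γ : ℝ}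
    (h₁ : IsSide U φ V y n r p₁ W₁) (h₂ : IsSide U φ V y (-n) r p₂ W₂)
    (hn : ‖n‖ = 1) (hr : 0 < r) (hφ : ∀ x, φmin ≤ φ x ∧ φ x ≤ φmax) (hmin : 0 < φmin)
    (hU : ∀ x ∈ Metric.ball y r, inner ℝ n (x - y) = 0 → x ∉ U)
    (hVi : LocallyIntegrable V) (hdiv : HasBoundedWeakDiv V Γ) :
    y ∈ goodSet U (fun x => (φ x)⁻¹ • V x) ∨
      ∃ n C r, IsTangential U (fun x => (φ x)⁻¹ • V x) y n C r := by
  obtain ⟨ρ₁, hρ₁, C₁, hC₁⟩ := exists_lipschitzOnWith_analytic (y := y) h₁.analytic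
  obtain ⟨ρ₂, hρ₂, C₂, hC₂⟩ := exists_lipschitzOnWith_analytic (y := y) h₂.analytic
  obtain ⟨ρ, hρ, hρr, hρ1, hρ2⟩ : ∃ ρ : ℝ, 0 < ρ ∧ ρ ≤ r ∧ ρ ≤ ρ₁ ∧ ρ ≤ ρ₂ :=
    ⟨min (min ρ₁ ρ₂) r, lt_min (lt_min hρ₁ hρ₂) hr, min_le_right _ _,
      (min_le_left _ _).trans (min_le_left _ _), (min_le_left _ _).trans (min_le_right _ _)⟩
  have br := Metric.ball_subset_ball (x := y) hρr
  have htr : inner ℝ n (W₁ y) = inner ℝ n (W₂ y) := by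
    refine inner_eq_of_hasBoundedWeakDiv (C := max C₁ C₂) hVi hdiv hn hρ
      ((hC₁.weaken (le_max_left _ _)).mono (Metric.ball_subset_ball hρ1))
      ((hC₂.weaken (le_max_right _ _)).mono (Metric.ball_subset_ball hρ2))
      (fun x hx hxn => (h₁.eq x ⟨br hx, hxn⟩).1) (fun x hx hxn => (h₂.eq x ⟨br hx, ?_⟩).1)
    simp only [mem_ofPred_eq, inner_neg_left]; linarith
  have hn0 : n ≠ 0 := by rintro rfl; simp at hn
  rcases lt_trichotomy (inner ℝ n (W₁ y)) 0 with h | h | h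
  · obtain ⟨lam, s, hs⟩ := isCrossing_of_isSide h₁ h₂ hn0 hr hφ hmin hU (Or.inr rfl)
      (by rw [inner_neg_left]; linarith) (by rw [inner_neg_left, inner_neg_left, htr])
    exact Or.inl (Or.inr ⟨_, lam, s, hs⟩)
  · obtain ⟨C, s, hs⟩ := isTangential_of_isSide h₁ h₂ hn hr (fun x => (hφ x).1) hmin hU h
      (htr ▸ h)
    exact Or.inr ⟨n, C, s, hs⟩
  · obtain ⟨lam, s, hs⟩ := isCrossing_of_isSide h₁ h₂ hn0 hr hφ hmin hU (Or.inl rfl) h htr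
    exact Or.inl (Or.inr ⟨_, lam, s, hs⟩)

end Sides

section MeshData

variable {d : ℕ} {Ω : Set (Pt d)} {M : PolytopalMesh Ω}

open Classical in
/-- The porosity, with the value `c` off the cells. -/
noncomputable def PolytopalMesh.extendPorosity (M : PolytopalMesh Ω) (φ : Pt d → ℝ) (c : ℝ) : Pt d → ℝ :=
  M.inside.piecewise φ fun _ => c

/-- The velocity, extended by zero off the cells. -/
noncomputable def PolytopalMesh.extendVelocity (M : PolytopalMesh Ω) (V : Pt d → Pt d) : Pt d → Pt d :=
  M.inside.indicator V

variable {φ : Pt d → ℝ} {V : Pt d → Pt d} {c φmin φmax Γ : ℝ}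

theorem PolytopalMesh.extendPorosity_of_mem {x : Pt d} (hx : x ∈ M.inside) :
    M.extendPorosity φ c x = φ x := by
  classical exact piecewise_eq_of_mem _ _ _ hx

theorem PolytopalMesh.extendPorosity_of_notMem {x : Pt d} (hx : x ∉ M.inside) :
    M.extendPorosity φ c x = c := by
  classical exact piecewise_eq_of_notMem _ _ _ hx

theorem PolytopalMesh.extendVelocity_of_mem {x : Pt d} (hx : x ∈ M.inside) :
    M.extendVelocity V x = V x := indicator_of_mem hx _

theorem PolytopalMesh.extendVelocity_of_notMem {x : Pt d} (hx : x ∉ M.inside) :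
    M.extendVelocity V x = 0 := indicator_of_notMem hx _

theorem IsAdmissible.exists_cellData (hA : IsAdmissible M φ φmin φmax V Γ) :
    ∃ (p : Set (Pt d) → Pt d → ℝ) (W : Set (Pt d) → Pt d → Pt d), ∀ K ∈ M.cells,
      ContDiff ℝ ∞ (p K) ∧ AnalyticOnNhd ℝ (W K) univ ∧ ∀ x ∈ K,
        M.extendVelocity V x = W K x ∧ M.extendPorosity φ c x = p K x := by
  have h0 : ∀ K : Set (Pt d), ∃ (p : Pt d → ℝ) (W : Pt d → Pt d), K ∈ M.cells →
      ContDiff ℝ ∞ p ∧ AnalyticOnNhd ℝ W univ ∧ ∀ x ∈ K,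
        M.extendVelocity V x = W x ∧ M.extendPorosity φ c x = p x := fun K => by
    by_cases hK : K ∈ M.cells
    · obtain ⟨p, hp, hpφ⟩ := hA.phi_smooth K hK
      obtain ⟨W, hW, hWV⟩ := hA.poly.exists_analytic K hK
      refine ⟨p, W, fun _ => ⟨hp, hW, fun x hx => ?_⟩⟩
      have hx' := PolytopalMesh.cell_subset_inside hK hx
      rw [M.extendVelocity_of_mem hx', M.extendPorosity_of_mem hx']
      exact ⟨hWV x hx, hpφ x hx⟩
    · exact ⟨0, 0, fun h => absurd h hK⟩
  choose p W h using h0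
  exact ⟨p, W, h⟩

theorem IsAdmissible.extendPorosity_bounds (hA : IsAdmissible M φ φmin φmax V Γ)
    (hle : φmin ≤ φmax) (x : Pt d) :
    φmin ≤ M.extendPorosity φ φmin x ∧ M.extendPorosity φ φmin x ≤ φmax := by
  by_cases hx : x ∈ M.inside
  · rw [M.extendPorosity_of_mem hx]; exact hA.phi_bounds x (PolytopalMesh.inside_subset hx)
  · rw [M.extendPorosity_of_notMem hx]; exact ⟨le_rfl, hle⟩

theorem PolytopalMesh.isOpen_domain (M : PolytopalMesh Ω) : IsOpen Ω :=
  M.cover ▸ isOpen_interior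

theorem IsAdmissible.le (hA : IsAdmissible M φ φmin φmax V Γ) (hΩ : Ω.Nonempty) :
    φmin ≤ φmax := by
  obtain ⟨x, hx⟩ := hΩ
  exact (hA.phi_bounds x hx).1.trans (hA.phi_bounds x hx).2

theorem IsAdmissible.gamma_nonneg (hA : IsAdmissible M φ φmin φmax V Γ) (hΩ : Ω.Nonempty) :
    0 ≤ Γ := by
  obtain ⟨g, -, hg, -⟩ := hA.hdiv
  have : NeZero (volume.restrict Ω) := ⟨by
    rw [Ne, Measure.restrict_eq_zero]
    exact (M.isOpen_domain.measure_pos _ hΩ).ne'⟩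
  obtain ⟨x, hx⟩ := hg.exists
  exact (abs_nonneg _).trans hx

theorem IsAdmissible.hasBoundedWeakDiv (hA : IsAdmissible M φ φmin φmax V Γ) (hΓ : 0 ≤ Γ) :
    HasBoundedWeakDiv (M.extendVelocity V) Γ := by
  obtain ⟨g, -, hg, hz⟩ := hA.hdiv
  intro w hw hwc
  have h1 : ∫ x, fderiv ℝ w x (M.extendVelocity V x) = ∫ x in Ω, fderiv ℝ w x (V x) := by
    rw [← PolytopalMesh.restrict_inside (M := M),
      ← integral_indicator PolytopalMesh.isOpen_inside.measurableSet]
    congr 1 with x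
    by_cases hx : x ∈ M.inside
    · rw [M.extendVelocity_of_mem hx, indicator_of_mem hx]
    · rw [M.extendVelocity_of_notMem hx, indicator_of_notMem hx, map_zero]
  rw [h1, eq_neg_of_add_eq_zero_left (hz w hw), abs_neg]
  have hwi : Integrable (fun x => |w x|) := (hw.continuous.integrable_of_hasCompactSupport hwc).abs
  refine (abs_integral_le_integral_abs).trans ?_
  rw [← integral_const_mul]
  refine (integral_mono_of_nonneg (ae_of_all _ fun x => abs_nonneg _)
    (hwi.const_mul Γ).restrict ?_).trans
    (setIntegral_le_integral (hwi.const_mul Γ) (ae_of_all _ fun x => by positivity))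
  filter_upwards [hg] with x hx
  rw [abs_mul]
  exact mul_le_mul_of_nonneg_right hx (abs_nonneg _)

/-- Near a point of the mesh skeleton off a thin set, the mesh looks like two half-balls. -/
theorem exists_isSide {p : Set (Pt d) → Pt d → ℝ} {W : Set (Pt d) → Pt d → Pt d} {y n : Pt d}
    {r : ℝ} (hpW : ∀ K ∈ M.cells, ContDiff ℝ ∞ (p K) ∧ AnalyticOnNhd ℝ (W K) univ ∧ ∀ x ∈ K,
        M.extendVelocity V x = W K x ∧ M.extendPorosity φ c x = p K x)
    (hr : ∀ x ∈ Metric.ball y r, inner ℝ n (x - y) ≠ 0 → ∀ K ∈ M.cells, x ∉ frontier K)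
    (hz : ∀ K ∈ M.cells, inner ℝ n (W K y) = 0 → ∀ z, inner ℝ n (z - y) = 0 →
      inner ℝ n (W K z) = 0) :
    (∃ p W, IsSide M.inside (M.extendPorosity φ c) (M.extendVelocity V) y n r p W) ∧
      ∀ K ∈ M.cells, Metric.ball y r ∩ {x | 0 < inner ℝ n (x - y)} ⊆ K ∨
        Disjoint (Metric.ball y r ∩ {x | 0 < inner ℝ n (x - y)}) K := by
  have hdich : ∀ K ∈ M.cells, Metric.ball y r ∩ {x | 0 < inner ℝ n (x - y)} ⊆ K ∨
        Disjoint (Metric.ball y r ∩ {x | 0 < inner ℝ n (x - y)}) K := fun K hK =>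
    (convex_halfBall y n r).isPreconnected.subset_or_disjoint (PolytopalMesh.isOpen_cell hK)
      (disjoint_left.2 fun x hx => hr x hx.1 (ne_of_gt hx.2) K hK)
  refine ⟨?_, hdich⟩
  by_cases hex : ∃ K ∈ M.cells, Metric.ball y r ∩ {x | 0 < inner ℝ n (x - y)} ⊆ K
  · obtain ⟨K, hK, hsub⟩ := hex
    obtain ⟨h1, h2, h3⟩ := hpW K hK
    exact ⟨p K, W K, h1, h2, fun x hx => h3 x (hsub hx),
      Or.inl (hsub.trans (PolytopalMesh.cell_subset_inside hK)), hz K hK⟩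
  · push Not at hex
    have hd : Disjoint (Metric.ball y r ∩ {x | 0 < inner ℝ n (x - y)}) M.inside := by
      refine disjoint_left.2 fun x hx hxU => ?_
      obtain ⟨K, hK, hxK⟩ := PolytopalMesh.mem_inside.1 hxU
      exact disjoint_left.1 ((hdich K hK).resolve_left (hex K hK)) hx hxK
    refine ⟨fun _ => c, 0, contDiff_const, analyticOnNhd_const, fun x hx => ?_,
      Or.inr ⟨hd, rfl⟩, by simp⟩
    have hx' := disjoint_left.1 hd hx
    rw [M.extendVelocity_of_notMem hx', M.extendPorosity_of_notMem hx']
    exact ⟨rfl, rfl⟩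

theorem notMem_inside_of_dichotomy {y n : Pt d} {r : ℝ} (hn : n ≠ 0) (hy : y ∉ M.inside)
    (hr : 0 < r)
    (h1 : ∀ K ∈ M.cells, Metric.ball y r ∩ {x | 0 < inner ℝ n (x - y)} ⊆ K ∨
        Disjoint (Metric.ball y r ∩ {x | 0 < inner ℝ n (x - y)}) K)
    (h2 : ∀ K ∈ M.cells, Metric.ball y r ∩ {x | 0 < inner ℝ (-n) (x - y)} ⊆ K ∨
        Disjoint (Metric.ball y r ∩ {x | 0 < inner ℝ (-n) (x - y)}) K) {x : Pt d}
    (hx : x ∈ Metric.ball y r) (hxn : inner ℝ n (x - y) = 0) : x ∉ M.inside := by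
  intro hxU
  obtain ⟨K, hK, hxK⟩ := PolytopalMesh.mem_inside.1 hxU
  have hKx := (PolytopalMesh.isOpen_cell hK).mem_nhds hxK
  have s1 : Metric.ball y r ∩ {x | 0 < inner ℝ n (x - y)} ⊆ K := by
    refine (h1 K hK).resolve_right fun hd => ?_
    obtain ⟨z, hz, hz'⟩ := exists_mem_halfBall hn hx hxn.ge hKx
    exact disjoint_left.1 hd hz' hz
  have s2 : Metric.ball y r ∩ {x | 0 < inner ℝ (-n) (x - y)} ⊆ K := by
    refine (h2 K hK).resolve_right fun hd => ?_
    obtain ⟨z, hz, hz'⟩ := exists_mem_halfBall (neg_ne_zero.2 hn) hx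
      (by rw [inner_neg_left, hxn, neg_zero]) hKx
    exact disjoint_left.1 hd hz' hz
  have hcl : Metric.ball y r ⊆ closure K := by
    intro z hz
    have : 0 ≤ inner ℝ n (z - y) ∨ 0 ≤ inner ℝ (-n) (z - y) := by
      rw [inner_neg_left, neg_nonneg]; exact le_total _ _
    rw [mem_closure_iff_nhds]
    intro s hs
    rcases this with h | h
    · obtain ⟨z', hz', hz''⟩ := exists_mem_halfBall hn hz h hs
      exact ⟨z', hz', s1 hz''⟩
    · obtain ⟨z', hz', hz''⟩ := exists_mem_halfBall (neg_ne_zero.2 hn) hz h hs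
      exact ⟨z', hz', s2 hz''⟩
  have := interior_maximal hcl Metric.isOpen_ball (Metric.mem_ball_self hr)
  rw [(M.polytopal K hK).regular] at this
  exact hy (PolytopalMesh.cell_subset_inside hK this)

theorem IsAdmissible.exists_fieldData (hA : IsAdmissible M φ φmin φmax V Γ) (hmin : 0 < φmin)
    (hΩ : Ω.Nonempty) : ∃ C B, FieldData M.inside (M.extendPorosity φ φmin) (M.extendVelocity V)
      φmin φmax Γ C B := by
  classical
  have hle := hA.le hΩ
  have hΓ := hA.gamma_nonneg hΩ
  have hU := PolytopalMesh.isOpen_inside (M := M)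
  have hbd := hA.extendPorosity_bounds hle
  obtain ⟨p, W, hpW⟩ := hA.exists_cellData (c := φmin)
  -- continuity
  have hcont : ∀ x ∈ M.inside, ContinuousAt (M.extendPorosity φ φmin) x ∧
      ContinuousAt (M.extendVelocity V) x := by
    intro x hx
    obtain ⟨K, hK, hxK⟩ := PolytopalMesh.mem_inside.1 hx
    obtain ⟨h1, h2, h3⟩ := hpW K hK
    have hKx := (PolytopalMesh.isOpen_cell hK).mem_nhds hxK
    exact ⟨h1.continuous.continuousAt.congr (mem_of_superset hKx fun z hz => (h3 z hz).2.symm),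
      (h2 x (mem_univ _)).continuousAt.congr (mem_of_superset hKx fun z hz => (h3 z hz).1.symm)⟩
  have hae : ∀ᵐ x, ContinuousAt (M.extendPorosity φ φmin) x ∧
      ContinuousAt (M.extendVelocity V) x := by
    filter_upwards [measure_eq_zero_iff_ae_notMem.1 (PolytopalMesh.volume_closure_diff (M := M))]
      with x hx
    by_cases hxU : x ∈ M.inside
    · exact hcont x hxU
    · have hx' : (closure M.inside)ᶜ ∈ 𝓝 x :=
        isClosed_closure.isOpen_compl.mem_nhds fun h => hx ⟨h, hxU⟩
      have hnot : ∀ z ∈ (closure M.inside)ᶜ, z ∉ M.inside := fun z hz h => hz (subset_closure h)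
      exact ⟨continuousAt_const.congr (mem_of_superset hx' fun z hz =>
          (M.extendPorosity_of_notMem (hnot z hz)).symm),
        continuousAt_const.congr (mem_of_superset hx' fun z hz =>
          (M.extendVelocity_of_notMem (hnot z hz)).symm)⟩
  have hφm : AEStronglyMeasurable (M.extendPorosity φ φmin) volume := by
    have h1 : ContinuousOn (M.extendPorosity φ φmin) M.inside :=
      fun x hx => (hcont x hx).1.continuousWithinAt
    have h2 := h1.aestronglyMeasurable (μ := volume) hU.measurableSet
    have h3 : AEStronglyMeasurable φ (volume.restrict M.inside) := h2.congr
      ((ae_restrict_iff' hU.measurableSet).2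
        (ae_of_all _ fun x hx => M.extendPorosity_of_mem hx))
    exact AEStronglyMeasurable.piecewise hU.measurableSet h3 aestronglyMeasurable_const
  have hVm : AEStronglyMeasurable (M.extendVelocity V) volume := by
    have h1 : ContinuousOn (M.extendVelocity V) M.inside :=
      fun x hx => (hcont x hx).2.continuousWithinAt
    have h2 := h1.aestronglyMeasurable (μ := volume) hU.measurableSet
    have h3 : AEStronglyMeasurable V (volume.restrict M.inside) := h2.congr
      ((ae_restrict_iff' hU.measurableSet).2
        (ae_of_all _ fun x hx => M.extendVelocity_of_mem hx))
    exact (aestronglyMeasurable_indicator_iff hU.measurableSet).2 h3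
  -- bound
  obtain ⟨C, hC0, hC⟩ : ∃ C : ℝ, 0 ≤ C ∧ ∀ x, ‖M.extendVelocity V x‖ ≤ C := by
    have hb : Bornology.IsBounded (⋃ K ∈ M.cells, M.extendVelocity V '' K) := by
      refine (Bornology.isBounded_biUnion M.finite).2 fun K hK => ?_
      obtain ⟨-, h2, h3⟩ := hpW K hK
      have hc : IsCompact (closure K) := (M.polytopal K hK).bounded.isCompact_closure
      have hW : ContinuousOn (W K) (closure K) := fun x _ =>
        (h2 x (mem_univ _)).continuousAt.continuousWithinAt
      refine (hc.image_of_continuousOn hW).isBounded.subset ?_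
      rintro _ ⟨x, hx, rfl⟩
      exact ⟨x, subset_closure hx, ((h3 x hx).1).symm⟩
    obtain ⟨C, hC⟩ := hb.exists_norm_le
    refine ⟨max C 0, le_max_right _ _, fun x => ?_⟩
    by_cases hx : x ∈ M.inside
    · obtain ⟨K, hK, hxK⟩ := PolytopalMesh.mem_inside.1 hx
      exact (hC _ (mem_iUnion₂.2 ⟨K, hK, mem_image_of_mem _ hxK⟩)).trans (le_max_left _ _)
    · rw [M.extendVelocity_of_notMem hx, norm_zero]; exact le_max_right _ _
  have hdiv := hA.hasBoundedWeakDiv hΓ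
  have hlip : IsLocLipschitz M.inside
      fun x => (M.extendPorosity φ φmin x)⁻¹ • M.extendVelocity V x := by
    intro y hy
    obtain ⟨K, hK, hyK⟩ := PolytopalMesh.mem_inside.1 hy
    obtain ⟨h1, h2, h3⟩ := hpW K hK
    obtain ⟨r, hr, D, hD⟩ := exists_lipschitzOnWith_inv_smul (y := y) h1 h2
      (by rw [← (h3 y hyK).2]; exact (hmin.trans_le (hbd y).1).ne')
    obtain ⟨r', hr', hrK⟩ := Metric.isOpen_iff.1 (PolytopalMesh.isOpen_cell hK) y hyK
    have b1 := Metric.ball_subset_ball (x := y) (min_le_left r r')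
    have b2 := (Metric.ball_subset_ball (x := y) (min_le_right r r')).trans hrK
    refine ⟨min r r', lt_min hr hr', b2.trans (PolytopalMesh.cell_subset_inside hK), D, ?_⟩
    intro x hx x' hx'
    simp only [(h3 x (b2 hx)).1, (h3 x (b2 hx)).2, (h3 x' (b2 hx')).1, (h3 x' (b2 hx')).2]
    exact hD (b1 hx) (b1 hx')
  -- the bad set
  obtain ⟨H, hH1, hH⟩ := M.exists_unit_normals
  obtain ⟨R, hR⟩ := (PolytopalMesh.isBounded_inside (M := M)).closure.subset_closedBall 0
  obtain ⟨B, hB, hBz⟩ := exists_isThin_forall_zero (H.disjSum M.finite.toFinset) H hH1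
    (Sum.elim (fun h' _ z => inner ℝ h'.1 z - h'.2) (fun K h z => inner ℝ h.1 (W K z)))
    (by
      rintro (h' | K) hi h -
      · exact ((innerSL ℝ h'.1).analyticOnNhd univ).sub analyticOnNhd_const
      · have hK : K ∈ M.cells := by simpa using hi
        exact (innerSL ℝ h.1).comp_analyticOnNhd (hpW K hK).2.1) R
  refine ⟨C, B, ⟨hmin, hle, hΓ, PolytopalMesh.isBounded_inside, hφm, hbd, hVm, hC,
    fun x hx => M.extendVelocity_of_notMem hx, hdiv, hcont, hae, hlip, hB, fun y hy hyB => ?_⟩⟩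
  by_cases hyU : y ∈ M.inside
  · exact Or.inl (Or.inl hyU)
  obtain ⟨K₀, hK₀, hyK₀⟩ := PolytopalMesh.mem_frontier_of_notMem hy hyU
  obtain ⟨h, hh, hyh⟩ := hH K₀ hK₀ y hyK₀
  have hz := hBz y (hR hy) hyB h hh hyh
  have hn0 : h.1 ≠ 0 := by intro h0; have := hH1 h hh; simp [h0] at this
  have hpl : ∀ z, inner ℝ h.1 (z - y) = 0 → inner ℝ h.1 z = h.2 := fun z hz' => by
    rw [inner_sub_right, hyh] at hz'; linarith
  obtain ⟨r, hr, hrf⟩ : ∃ r > 0, ∀ x ∈ Metric.ball y r, inner ℝ h.1 (x - y) ≠ 0 →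
      ∀ K ∈ M.cells, x ∉ frontier K := by
    have : ∀ᶠ x in 𝓝 y, ∀ h' ∈ H, inner ℝ h'.1 y ≠ h'.2 → inner ℝ h'.1 x ≠ h'.2 := by
      refine (Filter.eventually_all_finset H).2 fun h' _ => ?_
      by_cases hy' : inner ℝ h'.1 y = h'.2
      · exact Eventually.of_forall fun x hx => absurd hy' hx
      · have hc : ContinuousAt (fun x : Pt d => inner ℝ h'.1 x) y := by fun_prop
        exact (hc.eventually_ne hy').mono fun x hx _ => hx
    obtain ⟨r, hr, hrs⟩ := Metric.mem_nhds_iff.1 this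
    refine ⟨r, hr, fun x hx hxn K hK hxK => ?_⟩
    obtain ⟨h', hh', hxh'⟩ := hH K hK x hxK
    by_cases hy' : inner ℝ h'.1 y = h'.2
    · have h0 := hz (Sum.inl h') (by simpa using hh') (by simp [hy'])
      have hn' : h'.1 ≠ 0 := by intro h0; have := hH1 h' hh'; simp [h0] at this
      exact inner_ne_of_hyperplane_subset hn' hyh
        (fun z hz' => sub_eq_zero.1 (by simpa using h0 z hz')) hxn hxh'
    · exact hrs hx h' hh' hy' hxh'
  have hzW : ∀ K ∈ M.cells, inner ℝ h.1 (W K y) = 0 → ∀ z, inner ℝ h.1 (z - y) = 0 →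
      inner ℝ h.1 (W K z) = 0 := fun K hK h0 z hz' => by
    simpa using hz (Sum.inr K) (by simpa using hK) (by simpa using h0) z (hpl z hz')
  obtain ⟨⟨p₁, W₁, hs₁⟩, hd₁⟩ := exists_isSide hpW hrf hzW
  obtain ⟨⟨p₂, W₂, hs₂⟩, hd₂⟩ := exists_isSide (n := -h.1) hpW
    (fun x hx hxn => hrf x hx fun h0 => hxn (by rw [inner_neg_left, h0, neg_zero]))
    (fun K hK h0 z hz' => by
      rw [inner_neg_left, neg_eq_zero] at h0 hz' ⊢
      exact hzW K hK h0 z hz')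
  exact goodSet_or_isTangential_of_isSide hs₁ hs₂ (hH1 h hh) hr hbd hmin
    (fun x hx hxn => notMem_inside_of_dichotomy hn0 hyU hr hd₁ hd₂ hx hxn)
    (locallyIntegrable_of_norm_le hVm hC) hdiv

end MeshData


/-! ### Approximate flows and their limit -/

/-- The regularized characteristic field `φₖ⁻¹ Vₖ`. -/
noncomputable def molField {E : Type*} [NormedAddCommGroup E] [InnerProductSpace ℝ E]
    [FiniteDimensional ℝ E] [MeasurableSpace E] [BorelSpace E] (φ : E → ℝ) (V : E → E) (k : ℕ)
    (x : E) : E :=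
  (mollify k φ x)⁻¹ • mollify k V x

theorem goodSet_subset_interior_closure {E : Type*} [NormedAddCommGroup E] [InnerProductSpace ℝ E]
    {U : Set E} {b : E → E} (hU : IsOpen U) : goodSet U b ⊆ interior (closure U) :=
  interior_maximal goodSet_subset_closure (isOpen_goodSet hU)

namespace FieldData

variable {E : Type*} [NormedAddCommGroup E] [InnerProductSpace ℝ E] [FiniteDimensional ℝ E]
  [MeasurableSpace E] [BorelSpace E] {U : Set E} {φ : E → ℝ} {V : E → E}
  {φmin φmax Γ C : ℝ} {B : Set E} {k : ℕ} {x : E}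

section Mollify

variable (D : FieldData U φ V φmin φmax Γ C B)

include D

theorem max_pos : 0 < φmax := D.pos.trans_le D.le

theorem norm_phi_le (x : E) : ‖φ x‖ ≤ φmax := by
  rw [Real.norm_of_nonneg (D.pos.le.trans (D.phi_bounds x).1)]; exact (D.phi_bounds x).2

theorem phi_locInt : LocallyIntegrable φ volume :=
  locallyIntegrable_of_norm_le D.phi_meas D.norm_phi_le

theorem locInt : LocallyIntegrable V volume := locallyIntegrable_of_norm_le D.meas D.norm_le

theorem const_nonneg : 0 ≤ C := (norm_nonneg _).trans (D.norm_le 0)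

theorem le_mollify_phi : φmin ≤ mollify k φ x := le_mollify D.phi_locInt fun z => (D.phi_bounds z).1

theorem mollify_phi_pos : 0 < mollify k φ x := D.pos.trans_le D.le_mollify_phi

theorem mollify_phi_le : mollify k φ x ≤ φmax :=
  (le_abs_self _).trans (norm_mollify_le D.norm_phi_le x)

theorem hasCompactSupport : HasCompactSupport V :=
  HasCompactSupport.intro D.bounded.isCompact_closure fun x hx =>
    D.eq_zero x fun h => hx (subset_closure h)

theorem contDiff_molField : ContDiff ℝ 1 (molField φ V k) :=
  ((contDiff_mollify (n := 1) D.phi_locInt).inv fun _ => D.mollify_phi_pos.ne').smul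
    (contDiff_mollify (n := 1) D.locInt)

theorem exists_lipschitzWith_molField (k : ℕ) : ∃ K, LipschitzWith K (molField φ V k) :=
  D.contDiff_molField.lipschitzWith_of_hasCompactSupport
    ((hasCompactSupport_mollify D.hasCompactSupport).smul_left) one_ne_zero

theorem norm_molField_le' : ‖molField φ V k x‖ ≤ φmin⁻¹ * ‖mollify k V x‖ := by
  rw [molField, norm_smul, norm_inv, Real.norm_of_nonneg D.mollify_phi_pos.le]
  exact mul_le_mul_of_nonneg_right (inv_anti₀ D.pos D.le_mollify_phi) (norm_nonneg _)

theorem norm_molField_le (k : ℕ) (x : E) : ‖molField φ V k x‖ ≤ (φmin⁻¹ * C).toNNReal := by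
  rw [Real.coe_toNNReal _ (mul_nonneg (inv_nonneg.2 D.pos.le) D.const_nonneg)]
  exact D.norm_molField_le'.trans
    (mul_le_mul_of_nonneg_left (norm_mollify_le D.norm_le x) (inv_nonneg.2 D.pos.le))

theorem tendsto_molField {κ : ℕ → ℕ} (hκ : Tendsto κ atTop atTop) {y : E} (hy : y ∈ U)
    {z : ℕ → E} (hz : Tendsto z atTop (𝓝 y)) :
    Tendsto (fun i => molField φ V (κ i) (z i)) atTop (𝓝 ((φ y)⁻¹ • V y)) :=
  ((tendsto_mollify D.phi_meas (D.cont y hy).1 hκ hz).inv₀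
    (D.pos.trans_le (D.phi_bounds y).1).ne').smul (tendsto_mollify D.meas (D.cont y hy).2 hκ hz)

theorem eventually_le_molField {y n : E} {lam r : ℝ}
    (h : IsCrossing U (fun x => (φ x)⁻¹ • V x) y n lam r) :
    ∀ᶠ k in atTop, ∀ x ∈ Metric.ball y (r / 2), φmin / φmax * lam ≤ inner ℝ n (molField φ V k x) := by
  have h0 : ∀ᶠ k : ℕ in atTop, (1 : ℝ) / (k + 1) < r / 2 :=
    tendsto_one_div_add_atTop_nhds_zero_nat.eventually_lt_const (half_pos h.r_pos)
  filter_upwards [h0] with k hk x hx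
  have h1 : φmin * lam ≤ inner ℝ n (mollify k V x) := by
    refine le_inner_mollify D.locInt ?_
    filter_upwards [ae_inner_ne h.ne (inner ℝ n y)] with z hz hzx
    have hzb : z ∈ Metric.ball y r := by
      rw [Metric.mem_ball] at *
      linarith [dist_triangle z x y]
    have hzU : z ∈ U := h.mem z hzb (by rw [inner_sub_right]; exact sub_ne_zero.2 hz)
    have h2 := h.le z hzb hzU
    rw [inner_smul_right, le_inv_mul_iff₀ (D.pos.trans_le (D.phi_bounds z).1)] at h2
    exact (mul_le_mul_of_nonneg_right (D.phi_bounds z).1 h.lam_pos.le).trans h2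
  rw [molField, inner_smul_right, div_mul_eq_mul_div, div_eq_inv_mul]
  exact mul_le_mul (inv_anti₀ D.mollify_phi_pos D.mollify_phi_le) h1
    (mul_nonneg D.pos.le h.lam_pos.le) (inv_nonneg.2 D.mollify_phi_pos.le)

theorem ae_tendsto_mollify : ∀ᵐ x, Tendsto (fun k => mollify k φ x) atTop (𝓝 (φ x)) ∧
    Tendsto (fun k => mollify k V x) atTop (𝓝 (V x)) := by
  filter_upwards [D.ae_cont] with x hx
  exact ⟨tendsto_mollify D.phi_meas hx.1 tendsto_id tendsto_const_nhds,
    tendsto_mollify D.meas hx.2 tendsto_id tendsto_const_nhds⟩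

theorem exists_flow : ∃ X : ℕ → ℝ → E → E, ∀ k, IsGlobalFlow (molField φ V k) (X k) := by
  have : ∀ k, ∃ X : ℝ → E → E, IsGlobalFlow (molField φ V k) X := fun k => by
    obtain ⟨K, hK⟩ := D.exists_lipschitzWith_molField k
    exact exists_isGlobalFlow hK (D.norm_molField_le k)
  choose X hX using this
  exact ⟨X, hX⟩

end Mollify

section Flow

variable (D : FieldData U φ V φmin φmax Γ C B) {X : ℕ → ℝ → E → E}
  (hX : ∀ k, IsGlobalFlow (molField φ V k) (X k))

include D hX

theorem continuous_flow (k : ℕ) : Continuous (Function.uncurry (X k)) := by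
  obtain ⟨K, hK⟩ := D.exists_lipschitzWith_molField k
  exact (hX k).continuous_uncurry hK (D.norm_molField_le k)

theorem continuous_flow_apply (k : ℕ) (t : ℝ) : Continuous (X k t) :=
  (D.continuous_flow hX k).comp (Continuous.prodMk_right t)

theorem lipschitzWith_flow (k : ℕ) (x : E) :
    LipschitzWith (φmin⁻¹ * C).toNNReal fun t => X k t x :=
  (hX k).lipschitzWith_time (D.norm_molField_le k) x

theorem integral_flow_le {h : E → ℝ} {K : ℝ≥0} (hh : LipschitzWith K h)
    (hhc : HasCompactSupport h) (hh0 : ∀ x, 0 ≤ h x) (k : ℕ) {t : ℝ} (ht : 0 ≤ t) :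
    ∫ x, h (X k t x) * mollify k φ x ≤ Real.exp (Γ / φmin * t) * ∫ x, h x * mollify k φ x := by
  obtain ⟨K', hK'⟩ := D.exists_lipschitzWith_molField k
  exact (hX k).integral_comp_mul_le (contDiff_mollify (n := 0) D.phi_locInt).continuous D.pos
    (fun _ => D.le_mollify_phi) (contDiff_mollify (n := 1) D.locInt)
    (hasCompactSupport_mollify D.hasCompactSupport)
    (fun x => abs_trace_fderiv_mollify_le D.locInt D.weakDiv x) hK' (D.norm_molField_le k) hh hhc
    hh0 ht

/-- The flow `Xₖ` increases volumes at most by a factor which does not depend on `k`. -/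
theorem map_volume_flow_le (k : ℕ) {t τ : ℝ} (ht : 0 ≤ t) (htτ : t ≤ τ) :
    volume.map (X k t) ≤
      ENNReal.ofReal (φmin⁻¹ * Real.exp (Γ / φmin * τ) * φmax) • (volume : Measure E) := by
  obtain ⟨K', hK'⟩ := D.exists_lipschitzWith_molField k
  have h1 := (hX k).map_withDensity_le (contDiff_mollify (n := 0) D.phi_locInt).continuous D.pos
    (fun _ => D.le_mollify_phi) (contDiff_mollify (n := 1) D.locInt)
    (hasCompactSupport_mollify D.hasCompactSupport)
    (fun x => abs_trace_fderiv_mollify_le D.locInt D.weakDiv x) hK' (D.norm_molField_le k) ht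
  have hm : Measurable (X k t) := (D.continuous_flow_apply hX k t).measurable
  have lo : ENNReal.ofReal φmin • (volume : Measure E) ≤
      volume.withDensity fun x => ENNReal.ofReal (mollify k φ x) := by
    rw [← withDensity_const]
    exact withDensity_mono (ae_of_all _ fun x => ENNReal.ofReal_le_ofReal D.le_mollify_phi)
  have hi : volume.withDensity (fun x => ENNReal.ofReal (mollify k φ x)) ≤
      ENNReal.ofReal φmax • (volume : Measure E) := by
    rw [← withDensity_const]
    exact withDensity_mono (ae_of_all _ fun x => ENNReal.ofReal_le_ofReal D.mollify_phi_le)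
  have h2 : ENNReal.ofReal φmin • volume.map (X k t) ≤
      ENNReal.ofReal (Real.exp (Γ / φmin * τ) * φmax) • (volume : Measure E) := by
    rw [← Measure.map_smul, ENNReal.ofReal_mul (Real.exp_nonneg _), mul_smul]
    refine (Measure.map_mono lo hm).trans (h1.trans ?_)
    intro s
    simp only [Measure.smul_apply, smul_eq_mul]
    refine mul_le_mul' (ENNReal.ofReal_le_ofReal (Real.exp_le_exp.2 ?_)) (hi s)
    exact mul_le_mul_of_nonneg_left htτ (div_nonneg D.gamma_nonneg D.pos.le)
  intro s
  have h3 := h2 s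
  simp only [Measure.smul_apply, smul_eq_mul] at h3 ⊢
  have hp : ENNReal.ofReal φmin ≠ 0 := by simpa using D.pos
  rw [mul_assoc φmin⁻¹, ENNReal.ofReal_mul (inv_nonneg.2 D.pos.le), ENNReal.ofReal_inv_of_pos D.pos,
    mul_assoc, ← ENNReal.div_eq_inv_mul, ENNReal.le_div_iff_mul_le (Or.inl hp)
    (Or.inl ENNReal.ofReal_ne_top), mul_comm]
  exact h3

/-- The points whose trajectories come close to a set `B` on `[0, τ]`. -/
theorem mul_volume_le_of_near (k : ℕ) {τ δ : ℝ} (hδ1 : δ ≤ 1) (B' : Set E) :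
    ENNReal.ofReal (δ / (φmin⁻¹ * C + 1)) *
        volume {x | ∃ t ∈ Icc 0 τ, X k t x ∈ Metric.thickening δ B'} ≤
      ENNReal.ofReal (τ + 1) * (ENNReal.ofReal (φmin⁻¹ * Real.exp (Γ / φmin * (τ + 1)) * φmax) *
        volume (Metric.thickening (2 * δ) B')) := by
  set S := {x | ∃ t ∈ Icc 0 τ, X k t x ∈ Metric.thickening δ B'}
  set L := φmin⁻¹ * C with hL
  have hL0 : 0 ≤ L := mul_nonneg (inv_nonneg.2 D.pos.le) D.const_nonneg
  have hS : MeasurableSet S := by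
    have : S = ⋃ t ∈ Icc 0 τ, X k t ⁻¹' Metric.thickening δ B' := by ext; simp [S]
    rw [this]
    exact (isOpen_biUnion fun t _ => Metric.isOpen_thickening.preimage
      (D.continuous_flow_apply hX k t)).measurableSet
  set O : Set (ℝ × E) := Function.uncurry (X k) ⁻¹' Metric.thickening (2 * δ) B'
  have hO : MeasurableSet O := (Metric.isOpen_thickening.preimage (D.continuous_flow hX k)).measurableSet
  set f : ℝ → E → ℝ≥0∞ := fun s x => O.indicator 1 (s, x)
  have hf : Measurable (Function.uncurry f) := measurable_one.indicator hO
  have h1 : ∀ x ∈ S, ENNReal.ofReal (δ / (L + 1)) ≤ ∫⁻ s in Icc 0 (τ + 1), f s x := by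
    rintro x ⟨t, ht, htB⟩
    have hsub : Icc t (t + δ / (L + 1)) ⊆ Icc 0 (τ + 1) := by
      refine Icc_subset_Icc ht.1 ?_
      have : δ / (L + 1) ≤ 1 := by rw [div_le_one (by linarith)]; linarith
      linarith [ht.2]
    have h2 : ∀ s ∈ Icc t (t + δ / (L + 1)), f s x = 1 := by
      intro s hs
      refine indicator_of_mem (s := O) ?_ _
      obtain ⟨z, hz, hzt⟩ := Metric.mem_thickening_iff.1 htB
      refine Metric.mem_thickening_iff.2 ⟨z, hz, ?_⟩
      have h3 := (D.lipschitzWith_flow hX k x).dist_le_mul s t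
      rw [Real.coe_toNNReal _ hL0, Real.dist_eq, abs_of_nonneg (by linarith [hs.1])] at h3
      have h4 : L * (s - t) ≤ δ := by
        have h5 : (L + 1) * (s - t) ≤ δ := by
          rw [mul_comm, ← le_div_iff₀ (by linarith)]; linarith [hs.2]
        nlinarith [hs.1]
      have := dist_triangle (X k s x) (X k t x) z
      simp only [Function.uncurry]
      linarith
    calc ENNReal.ofReal (δ / (L + 1)) = ∫⁻ s in Icc t (t + δ / (L + 1)), 1 := by
          simp
      _ = ∫⁻ s in Icc t (t + δ / (L + 1)), f s x :=
          setLIntegral_congr_fun measurableSet_Icc fun s hs => (h2 s hs).symm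
      _ ≤ _ := lintegral_mono_set hsub
  calc ENNReal.ofReal (δ / (L + 1)) * volume S = ∫⁻ x in S, ENNReal.ofReal (δ / (L + 1)) := by
        rw [setLIntegral_const]
    _ ≤ ∫⁻ x in S, ∫⁻ s in Icc 0 (τ + 1), f s x := setLIntegral_mono' hS h1
    _ ≤ ∫⁻ x, ∫⁻ s in Icc 0 (τ + 1), f s x := setLIntegral_le_lintegral _ _
    _ = ∫⁻ s in Icc 0 (τ + 1), ∫⁻ x, f s x :=
        lintegral_lintegral_swap (hf.comp measurable_swap).aemeasurable
    _ ≤ ∫⁻ s in Icc 0 (τ + 1), ENNReal.ofReal (φmin⁻¹ * Real.exp (Γ / φmin * (τ + 1)) * φmax) *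
        volume (Metric.thickening (2 * δ) B') := by
        refine setLIntegral_mono' measurableSet_Icc fun s hs => ?_
        have e : ∫⁻ x, f s x = volume.map (X k s) (Metric.thickening (2 * δ) B') := by
          rw [Measure.map_apply (D.continuous_flow_apply hX k s).measurable
            Metric.isOpen_thickening.measurableSet, ← lintegral_indicator_one
            (Metric.isOpen_thickening.preimage (D.continuous_flow_apply hX k s)).measurableSet]
          rfl
        rw [e]
        exact D.map_volume_flow_le hX k hs.1 hs.2 _
    _ = _ := by rw [setLIntegral_const, Real.volume_Icc, sub_zero, mul_comm]

theorem volume_liminf_near_eq_zero (τ : ℝ) :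
    volume {x | ∀ j : ℕ, ∀ᶠ k in atTop, ∃ t ∈ Icc 0 τ,
      X k t x ∈ Metric.thickening (1 / (4 * (j + 1))) B} = 0 := by
  set N := {x | ∀ j : ℕ, ∀ᶠ k in atTop, ∃ t ∈ Icc 0 τ,
      X k t x ∈ Metric.thickening (1 / (4 * (j + 1))) B}
  set Q : ℝ≥0∞ := ENNReal.ofReal (φmin⁻¹ * Real.exp (Γ / φmin * (τ + 1)) * φmax)
  set L := φmin⁻¹ * C + 1 with hL
  have hL0 : 0 < L := by
    have := mul_nonneg (inv_nonneg.2 D.pos.le) D.const_nonneg; linarith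
  set A : ℝ≥0∞ := ENNReal.ofReal (4 * L) * ENNReal.ofReal (τ + 1) * Q
  have hj : ∀ j : ℕ, volume N ≤ A * ((j + 1 : ℝ≥0∞) *
      volume (Metric.thickening (1 / (2 * (j + 1))) B)) := by
    intro j
    set δ : ℝ := 1 / (4 * (j + 1)) with hδdef
    have hδ : 0 < δ := by positivity
    have hδ1 : δ ≤ 1 := by
      rw [hδdef, div_le_one (by positivity)]; linarith [j.cast_nonneg (α := ℝ)]
    set S : ℕ → Set E := fun k => {x | ∃ t ∈ Icc 0 τ, X k t x ∈ Metric.thickening δ B}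
    have h1 : ∀ k, volume (S k) ≤ A * ((j + 1 : ℝ≥0∞) *
        volume (Metric.thickening (1 / (2 * (j + 1))) B)) := by
      intro k
      have h2 := D.mul_volume_le_of_near hX k (τ := τ) hδ1 B
      rw [show 2 * δ = 1 / (2 * (j + 1)) by rw [hδdef]; field_simp; norm_num] at h2
      have h3 : ENNReal.ofReal (4 * L) * (j + 1) * ENNReal.ofReal (δ / L) = 1 := by
        have : (j + 1 : ℝ≥0∞) = ENNReal.ofReal (j + 1) := by
          rw [ENNReal.ofReal_add (by positivity) zero_le_one]; simp
        rw [this, ← ENNReal.ofReal_mul (by positivity), ← ENNReal.ofReal_mul (by positivity),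
          hδdef, show 4 * L * ((j : ℝ) + 1) * (1 / (4 * (j + 1)) / L) = 1 by field_simp,
          ENNReal.ofReal_one]
      calc volume (S k) = ENNReal.ofReal (4 * L) * (j + 1) * (ENNReal.ofReal (δ / L) *
            volume (S k)) := by rw [← mul_assoc, h3, one_mul]
        _ ≤ ENNReal.ofReal (4 * L) * (j + 1) * (ENNReal.ofReal (τ + 1) * (Q *
            volume (Metric.thickening (1 / (2 * (j + 1))) B))) := by gcongr
        _ = _ := by ring
    have h2 : N ⊆ ⋃ m : ℕ, ⋂ k ≥ m, S k := by
      intro x hx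
      obtain ⟨m, hm⟩ := eventually_atTop.1 (hx j)
      exact mem_iUnion.2 ⟨m, mem_iInter₂.2 fun k hk => hm k hk⟩
    refine (measure_mono h2).trans ?_
    have hmono : Monotone fun m : ℕ => ⋂ k ≥ m, S k := fun m m' hm =>
      biInter_subset_biInter_left fun k hk => le_trans hm hk
    rw [hmono.measure_iUnion]
    exact iSup_le fun m => (measure_mono (biInter_subset_of_mem (le_refl m))).trans (h1 m)
  have hA : A ≠ ⊤ := ENNReal.mul_ne_top (ENNReal.mul_ne_top ENNReal.ofReal_ne_top
    ENNReal.ofReal_ne_top) ENNReal.ofReal_ne_top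
  have hlim := ENNReal.Tendsto.const_mul (a := A) D.thin (Or.inr hA)
  rw [mul_zero] at hlim
  exact le_antisymm (ge_of_tendsto' hlim hj) (zero_le)

/-- For almost every starting point, the approximate trajectories converge to the only forward
line. -/
theorem ae_exists_forwardLine {τ : ℝ} (hτ : 0 ≤ τ) : ∀ᵐ x, x ∈ U → ∃ γ : ℝ → E, γ 0 = x ∧
    IsForwardLine U (fun x => (φ x)⁻¹ • V x) τ γ ∧
    (∀ t ∈ Icc 0 τ, γ t ∈ goodSet U fun x => (φ x)⁻¹ • V x) ∧
    (∀ t ∈ Icc 0 τ, Tendsto (fun k => X k t x) atTop (𝓝 (γ t))) ∧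
    ∀ τ' ≤ τ, ∀ γ', γ' 0 = x → IsForwardLine U (fun x => (φ x)⁻¹ • V x) τ' γ' →
      EqOn γ γ' (Icc 0 τ') := by
  filter_upwards [measure_eq_zero_iff_ae_notMem.1 (D.volume_liminf_near_eq_zero hX τ)] with x hx hxU
  simp only [not_forall] at hx
  obtain ⟨j, hj⟩ := hx
  set δ : ℝ := 1 / (4 * (j + 1))
  have hδ : 0 < δ := by positivity
  set θ := φmin / φmax
  have hθ : 0 < θ := div_pos D.pos D.max_pos
  have hθ1 : θ ≤ 1 := div_le_one_of_le₀ D.le D.max_pos.le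
  have hlim : ∀ (κ : ℕ → ℕ), Tendsto κ atTop atTop → ∀ γ : ℝ → E,
      TendstoUniformlyOn (fun i t => X (κ i) t x) γ atTop (Icc 0 τ) →
      IsCharacteristic U (fun x => (φ x)⁻¹ • V x) θ τ γ := by
    intro κ hκ γ hγ
    exact isCharacteristic_of_tendsto (β := fun i => molField φ V (κ i))
      (L := (φmin⁻¹ * C).toNNReal) (fun i => D.norm_molField_le _)
      (fun i => D.contDiff_molField.continuous) (fun i t => (hX (κ i)).deriv x t) hγ
      (fun y hy z hz => D.tendsto_molField hκ hy hz)
      (fun y n lam r hy => hκ.eventually (D.eventually_le_molField hy))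
  have hlim0 : ∀ (κ : ℕ → ℕ) (γ : ℝ → E),
      TendstoUniformlyOn (fun i t => X (κ i) t x) γ atTop (Icc 0 τ) → γ 0 = x := by
    intro κ γ hγ
    refine tendsto_nhds_unique (hγ.tendsto_at (left_mem_Icc.2 hτ)) ?_
    simp only [(hX _).zero]; exact tendsto_const_nhds
  obtain ⟨κ, hκ, hκj⟩ := extraction_of_frequently_atTop (not_eventually.1 hj)
  push Not at hκj
  obtain ⟨ι, γ, hι, hγL, hγ⟩ := exists_subseq_tendstoUniformlyOn hτ
    (fun i => D.lipschitzWith_flow hX (κ i) x) (fun i => (hX (κ i)).zero x)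
  have hγc := hlim (κ ∘ ι) (hκ.comp hι).tendsto_atTop γ hγ
  have hγ0 := hlim0 (κ ∘ ι) γ hγ
  have hγB : ∀ t ∈ Icc 0 τ, γ t ∉ B := by
    intro t ht htB
    have h1 : γ t ∈ (Metric.thickening δ B)ᶜ :=
      Metric.isOpen_thickening.isClosed_compl.mem_of_tendsto (hγ.tendsto_at ht)
        (Eventually.of_forall fun i => hκj (ι i) t ht)
    exact h1 (Metric.self_subset_thickening hδ B htB)
  have hgood := hγc.mem_goodSet hθ D.lip D.classify (hγ0.symm ▸ hxU) hγB
  refine ⟨γ, hγ0, hγc.isForwardLine hθ D.lip ⟨_, hγL⟩ hgood, hgood, fun t ht => ?_,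
    fun τ' hτ' γ' hγ'0 hγ' => ?_⟩
  · refine tendsto_of_subseq_tendsto fun κ' hκ' => ?_
    obtain ⟨ι', γ', hι', -, hγ'⟩ := exists_subseq_tendstoUniformlyOn hτ
      (fun i => D.lipschitzWith_flow hX (κ' i) x) (fun i => (hX (κ' i)).zero x)
    have h1 := hlim (κ' ∘ ι') (hκ'.comp hι'.tendsto_atTop) γ' hγ'
    have h2 := hlim0 (κ' ∘ ι') γ' hγ'
    have h3 := hγc.eqOn hθ D.lip h1 (hγ0.trans h2.symm) hgood ht
    exact ⟨ι', h3 ▸ hγ'.tendsto_at ht⟩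
  · exact (hγc.mono hτ').eqOn hθ D.lip (hγ'.isCharacteristic hθ1 D.lip) (hγ0.trans hγ'0.symm)
      fun t ht => hgood t (Icc_subset_Icc_right hτ' ht)

theorem ae_tendsto_mollify_restrict : ∀ᵐ x ∂volume.restrict U,
    Tendsto (fun k => mollify k φ x) atTop (𝓝 (φ x)) :=
  ae_restrict_of_ae (D.ae_tendsto_mollify.mono fun _ h => h.1)

theorem aemeasurable_limit {t : ℝ} {G : E → E}
    (hG : ∀ᵐ x ∂volume.restrict U, Tendsto (fun k => X k t x) atTop (𝓝 (G x))) :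
    AEMeasurable G (volume.restrict U) :=
  aemeasurable_of_tendsto_metrizable_ae atTop
    (fun k => (D.continuous_flow_apply hX k t).measurable.aemeasurable) hG

/-- The limit flow multiplies the measure `φ dx` at most by `exp (Γ t / φmin)`. -/
theorem map_limit_le {t : ℝ} (ht : 0 ≤ t) {G : E → E}
    (hG : ∀ᵐ x ∂volume.restrict U, Tendsto (fun k => X k t x) atTop (𝓝 (G x))) :
    ((volume.restrict U).withDensity fun x => ENNReal.ofReal (φ x)).map G ≤
      ENNReal.ofReal (Real.exp (Γ / φmin * t)) •
        volume.withDensity fun x => ENNReal.ofReal (φ x) := by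
  have hU : volume U < ⊤ := D.bounded.measure_lt_top
  have : IsFiniteMeasure (volume.restrict U) := ⟨by simpa using hU⟩
  have hφm : AEMeasurable (fun x => (φ x).toNNReal) volume :=
    D.phi_meas.aemeasurable.real_toNNReal
  have hGm := D.aemeasurable_limit hX hG
  set μ : Measure E := volume.withDensity fun x => ENNReal.ofReal (φ x)
  set μU : Measure E := (volume.restrict U).withDensity fun x => ENNReal.ofReal (φ x)
  have hle : ∀ ν : Measure E, ν.withDensity (fun x => ENNReal.ofReal (φ x)) ≤
      ENNReal.ofReal φmax • ν := fun ν => by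
    rw [← withDensity_const]
    exact withDensity_mono (ae_of_all _ fun x => ENNReal.ofReal_le_ofReal (D.phi_bounds x).2)
  have hfU : IsFiniteMeasure μU := by
    refine ⟨(hle _ univ).trans_lt ?_⟩
    rw [Measure.smul_apply, Measure.restrict_apply_univ, smul_eq_mul]
    exact ENNReal.mul_lt_top ENNReal.ofReal_lt_top hU
  have hfμ : IsFiniteMeasureOnCompacts μ := by
    refine ⟨fun K hK => (hle _ K).trans_lt ?_⟩
    rw [Measure.smul_apply, smul_eq_mul]
    exact ENNReal.mul_lt_top ENNReal.ofReal_lt_top hK.measure_lt_top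
  have hGm' : AEMeasurable G μU := hGm.mono_ac (withDensity_absolutelyContinuous _ _)
  have hint : ∀ (ν : Measure E), ν ≪ volume → ∀ f : E → ℝ,
      ∫ x, f x ∂ν.withDensity (fun x => ENNReal.ofReal (φ x)) = ∫ x, f x * φ x ∂ν := by
    intro ν hν f
    refine (integral_withDensity_eq_integral_smul₀ (hφm.mono_ac hν) f).trans
      (integral_congr_ae (ae_of_all _ fun x => ?_))
    simp only [NNReal.smul_def, Real.coe_toNNReal _ (D.pos.le.trans (D.phi_bounds x).1),
      smul_eq_mul, mul_comm]
  refine measure_le_of_forall_lipschitz (Real.exp_nonneg _) fun f hf hfc hf0 => ?_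
  obtain ⟨K, hK⟩ := hf
  rw [integral_map hGm' hK.continuous.aestronglyMeasurable,
    hint _ Measure.restrict_le_self.absolutelyContinuous, hint _ Measure.AbsolutelyContinuous.rfl]
  obtain ⟨M, hM⟩ := hfc.exists_bound_of_continuous hK.continuous
  have hM0 : 0 ≤ M := (norm_nonneg _).trans (hM 0)
  have hmc : ∀ k, Continuous (mollify k φ) := fun k =>
    (contDiff_mollify (n := 0) D.phi_locInt).continuous
  have hφk : ∀ k x, ‖mollify k φ x‖ ≤ φmax := fun k x => norm_mollify_le D.norm_phi_le x
  have l1 : Tendsto (fun k => ∫ x in U, f (X k t x) * mollify k φ x) atTop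
      (𝓝 (∫ x in U, f (G x) * φ x)) := by
    refine tendsto_integral_of_dominated_convergence (fun _ => M * φmax) (fun k => ?_)
      (integrable_const _) (fun k => ae_of_all _ fun x => ?_) ?_
    · exact ((hK.continuous.comp (D.continuous_flow_apply hX k t)).mul
        (hmc k)).aestronglyMeasurable
    · rw [norm_mul]; exact mul_le_mul (hM _) (hφk k x) (norm_nonneg _) hM0
    · filter_upwards [hG, D.ae_tendsto_mollify_restrict hX] with x h1 h2
      exact ((hK.continuous.tendsto _).comp h1).mul h2
  have l2 : Tendsto (fun k => ∫ x, f x * mollify k φ x) atTop (𝓝 (∫ x, f x * φ x)) := by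
    refine tendsto_integral_of_dominated_convergence (fun x => ‖f x‖ * φmax) (fun k => ?_)
      ((hK.continuous.integrable_of_hasCompactSupport hfc).norm.mul_const _)
      (fun k => ae_of_all _ fun x => ?_) ?_
    · exact (hK.continuous.mul (hmc k)).aestronglyMeasurable
    · rw [norm_mul]; exact mul_le_mul_of_nonneg_left (hφk k x) (norm_nonneg _)
    · filter_upwards [D.ae_tendsto_mollify] with x h
      exact tendsto_const_nhds.mul h.1
  refine le_of_tendsto_of_tendsto' l1 (l2.const_mul _) fun k => ?_
  refine le_trans ?_ (D.integral_flow_le hX hK hfc hf0 k ht)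
  refine setIntegral_le_integral ?_ (ae_of_all _ fun x => mul_nonneg (hf0 _) D.mollify_phi_pos.le)
  obtain ⟨K', hK'⟩ := D.exists_lipschitzWith_molField k
  have hc : HasCompactSupport fun x => f (X k t x) :=
    HasCompactSupport.intro ((hX k).isCompact_preimage hK' hfc t) fun x hx =>
      image_eq_zero_of_notMem_tsupport hx
  exact ((hK.continuous.comp (D.continuous_flow_apply hX k t)).mul
    (hmc k)).integrable_of_hasCompactSupport hc.mul_right

theorem tendsto_lintegral_mollify :
    Tendsto (fun k => ∫⁻ x, ‖mollify k V x‖ₑ) atTop (𝓝 (∫⁻ x, ‖V x‖ₑ)) := by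
  set S := Metric.cthickening 1 (closure U)
  have hS : IsCompact S := D.bounded.isCompact_closure.cthickening
  have h0 : ∀ k x, x ∉ S → mollify k V x = 0 := by
    intro k x hx
    rw [← norm_le_zero_iff]
    refine norm_mollify_le_of_ae (ae_of_all _ fun z hz => ?_)
    have hzU : z ∉ U := fun hzU => hx <|
      Metric.mem_cthickening_of_dist_le x z 1 _ (subset_closure hzU) <| by
        rw [dist_comm]
        exact (Metric.mem_ball.1 hz).le.trans
          (div_le_one_of_le₀ (by linarith [k.cast_nonneg (α := ℝ)]) (by positivity))
    rw [D.eq_zero z hzU, norm_zero]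
  refine tendsto_lintegral_of_dominated_convergence' (S.indicator fun _ => ENNReal.ofReal C)
    (fun k => ?_) (fun k => ae_of_all _ fun x => ?_) ?_ ?_
  · exact (contDiff_mollify (n := 0) D.locInt).continuous.enorm.measurable.aemeasurable
  · by_cases hx : x ∈ S
    · rw [indicator_of_mem hx]
      change ‖mollify k V x‖ₑ ≤ _
      rw [← ofReal_norm]
      exact ENNReal.ofReal_le_ofReal (norm_mollify_le D.norm_le x)
    · change ‖mollify k V x‖ₑ ≤ _
      rw [indicator_of_notMem hx, h0 k x hx, enorm_zero]
  · rw [lintegral_indicator_const hS.measurableSet]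
    exact (ENNReal.mul_lt_top ENNReal.ofReal_lt_top hS.measure_lt_top).ne
  · filter_upwards [D.ae_tendsto_mollify] with x h
    exact (continuous_enorm.tendsto _).comp h.2

/-- The mean displacement by the limit flow is bounded by the mean velocity. -/
theorem lintegral_displacement_le {t τ : ℝ} (ht : 0 ≤ t) (htτ : t ≤ τ) {G : E → E}
    (hG : ∀ᵐ x ∂volume.restrict U, Tendsto (fun k => X k t x) atTop (𝓝 (G x))) :
    ∫⁻ x in U, ‖G x - x‖ₑ ≤ ENNReal.ofReal t *
      (ENNReal.ofReal (φmin⁻¹ * Real.exp (Γ / φmin * τ) * φmax) *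
        (ENNReal.ofReal φmin⁻¹ * ∫⁻ x, ‖V x‖ₑ)) := by
  set Q : ℝ≥0∞ := ENNReal.ofReal (φmin⁻¹ * Real.exp (Γ / φmin * τ) * φmax)
  have hbc : ∀ k, Continuous (molField φ V k) := fun k => D.contDiff_molField.continuous
  have h1 : ∀ k, ∫⁻ x in U, ‖X k t x - x‖ₑ ≤ ENNReal.ofReal t *
      (Q * (ENNReal.ofReal φmin⁻¹ * ∫⁻ x, ‖mollify k V x‖ₑ)) := by
    intro k
    have hcc : Continuous fun p : ℝ × E => molField φ V k (X k p.1 p.2) :=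
      (hbc k).comp (D.continuous_flow hX k)
    have h2 : ∀ x, ‖X k t x - x‖ₑ ≤ ∫⁻ s in Icc 0 t, ‖molField φ V k (X k s x)‖ₑ := by
      intro x
      have h3 : X k t x - x = ∫ s in 0..t, molField φ V k (X k s x) := by
        rw [intervalIntegral.integral_eq_sub_of_hasDerivAt (fun s _ => (hX k).deriv x s)
          ((hcc.comp (Continuous.prodMk_left x)).intervalIntegrable _ _), (hX k).zero]
      rw [h3, intervalIntegral.integral_of_le ht, restrict_Ioc_eq_restrict_Icc]
      exact enorm_integral_le_lintegral_enorm _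
    calc ∫⁻ x in U, ‖X k t x - x‖ₑ ≤ ∫⁻ x, ‖X k t x - x‖ₑ := setLIntegral_le_lintegral _ _
      _ ≤ ∫⁻ x, ∫⁻ s in Icc 0 t, ‖molField φ V k (X k s x)‖ₑ := lintegral_mono h2
      _ = ∫⁻ s in Icc 0 t, ∫⁻ x, ‖molField φ V k (X k s x)‖ₑ :=
          lintegral_lintegral_swap (hcc.comp continuous_swap).enorm.measurable.aemeasurable
      _ ≤ ∫⁻ s in Icc 0 t, Q * (ENNReal.ofReal φmin⁻¹ * ∫⁻ x, ‖mollify k V x‖ₑ) := by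
          refine setLIntegral_mono' measurableSet_Icc fun s hs => ?_
          rw [← lintegral_map (hbc k).enorm.measurable (D.continuous_flow_apply hX k s).measurable]
          refine (lintegral_mono' (D.map_volume_flow_le hX k hs.1 (hs.2.trans htτ)) le_rfl).trans ?_
          have h4 : ∫⁻ x, ‖molField φ V k x‖ₑ ≤
              ENNReal.ofReal φmin⁻¹ * ∫⁻ x, ‖mollify k V x‖ₑ := by
            rw [← lintegral_const_mul' _ _ ENNReal.ofReal_ne_top]
            refine lintegral_mono fun x => ?_
            rw [← ofReal_norm, ← ofReal_norm, ← ENNReal.ofReal_mul (inv_nonneg.2 D.pos.le)]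
            exact ENNReal.ofReal_le_ofReal D.norm_molField_le'
          rw [lintegral_smul_measure, smul_eq_mul]
          gcongr
      _ = _ := by rw [setLIntegral_const, Real.volume_Icc, sub_zero, mul_comm]
  have h2 : ∫⁻ x in U, ‖G x - x‖ₑ ≤ liminf (fun k => ∫⁻ x in U, ‖X k t x - x‖ₑ) atTop := by
    refine le_trans (lintegral_mono_ae ?_) (lintegral_liminf_le' fun k =>
      ((D.continuous_flow_apply hX k t).sub continuous_id).enorm.measurable.aemeasurable)
    filter_upwards [hG] with x hx
    exact (((continuous_enorm.tendsto _).comp (hx.sub_const x)).liminf_eq).ge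
  refine h2.trans ((liminf_le_liminf (Eventually.of_forall h1)).trans_eq (Tendsto.liminf_eq ?_))
  refine ENNReal.Tendsto.const_mul (ENNReal.Tendsto.const_mul (ENNReal.Tendsto.const_mul
    (D.tendsto_lintegral_mollify hX) (Or.inr ENNReal.ofReal_ne_top))
    (Or.inr ENNReal.ofReal_ne_top)) (Or.inr ENNReal.ofReal_ne_top)

end Flow

end FieldData


/-! ### The flow of an admissible pair -/

section AdmissibleFlow

variable {d : ℕ} {Ω : Set (Pt d)} {M : PolytopalMesh Ω} {φ : Pt d → ℝ} {V : Pt d → Pt d}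
  {φmin φmax Γ T : ℝ}

theorem IsAdmissible.neg (hA : IsAdmissible M φ φmin φmax V Γ) :
    IsAdmissible M φ φmin φmax (fun x => -V x) Γ := by
  refine ⟨hA.phi_smooth, hA.phi_bounds, fun K hK => ?_, ?_⟩
  · obtain ⟨P, hP⟩ := hA.poly K hK
    exact ⟨fun i => -P i, fun x hx i => by simp [hP x hx i]⟩
  · obtain ⟨g, hg, hgΓ, hz⟩ := hA.hdiv
    refine ⟨fun x => -g x, ⟨hg.memLp.neg, hg.memLp_div.neg, fun w h1 h2 h3 => ?_⟩, ?_, fun w hw => ?_⟩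
    · simp only [map_neg, neg_mul, integral_neg, hg.weak_div w h1 h2 h3]
    · simpa only [abs_neg] using hgΓ
    · have := hz w hw
      simp only [map_neg, neg_mul, integral_neg]
      linarith

/-- The characteristic field of an admissible pair, extended by zero. -/
noncomputable def PolytopalMesh.field (M : PolytopalMesh Ω) (φ : Pt d → ℝ) (c : ℝ)
    (V : Pt d → Pt d) (x : Pt d) : Pt d :=
  (M.extendPorosity φ c x)⁻¹ • M.extendVelocity V x

theorem PolytopalMesh.field_of_mem {c : ℝ} {x : Pt d} (hx : x ∈ M.inside) :
    M.field φ c V x = (φ x)⁻¹ • V x := by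
  rw [PolytopalMesh.field, M.extendPorosity_of_mem hx, M.extendVelocity_of_mem hx]

theorem PolytopalMesh.field_neg {c : ℝ} (x : Pt d) :
    M.field φ c (fun x => -V x) x = -M.field φ c V x := by
  by_cases hx : x ∈ M.inside
  · rw [M.field_of_mem hx, M.field_of_mem hx, smul_neg]
  · rw [PolytopalMesh.field, PolytopalMesh.field, M.extendVelocity_of_notMem hx,
      M.extendVelocity_of_notMem hx, smul_zero, neg_zero]

theorem PolytopalMesh.interior_closure_inside : interior (closure M.inside) = Ω := by
  rw [PolytopalMesh.closure_inside, M.cover]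

theorem IsFlowLine.isForwardLine {x : Pt d} {γ : ℝ → Pt d} (hT : 0 ≤ T) (c : ℝ)
    (h : IsFlowLine M φ V T x γ) : IsForwardLine M.inside (M.field φ c V) T γ := by
  obtain ⟨L, hL⟩ := h.lipschitz
  obtain ⟨S, hS, hode⟩ := h.ode
  refine ⟨⟨L, hL.mono (Icc_subset_Icc_left (by linarith))⟩, S, hS, fun t ht => ?_⟩
  obtain ⟨hK, hd⟩ := hode t ⟨⟨by linarith [ht.1.1], ht.1.2⟩, ht.2⟩
  have hU : γ t ∈ M.inside := PolytopalMesh.mem_inside.2 hK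
  exact ⟨hU, by rwa [PolytopalMesh.field_of_mem hU]⟩

/-- A segment of a forward line, run backwards, is a forward line of the opposite field. -/
theorem IsForwardLine.reverse {E : Type*} [NormedAddCommGroup E] [InnerProductSpace ℝ E]
    {U : Set E} {b b' : E → E} {τ t : ℝ} {γ : ℝ → E} (h : IsForwardLine U b τ γ)
    (htτ : t ≤ τ) (hb : ∀ x, b' x = -b x) : IsForwardLine U b' t fun s => γ (t - s) := by
  obtain ⟨L, hL⟩ := h.lipschitz
  obtain ⟨S, hS, hode⟩ := h.ode
  refine ⟨⟨L, ?_⟩, (fun s => t - s) ⁻¹' S, hS.preimage sub_right_injective, fun s hs => ?_⟩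
  · have h1 : LipschitzOnWith 1 (fun s : ℝ => t - s) (Icc 0 t) :=
      (LipschitzWith.of_dist_le_mul fun x y => by
        rw [NNReal.coe_one, one_mul, dist_sub_left]).lipschitzOnWith
    have := hL.comp h1 fun s hs => ⟨by linarith [hs.2], by linarith [hs.1]⟩
    rwa [mul_one] at this
  · obtain ⟨h1, h2⟩ := hode (t - s) ⟨⟨by linarith [hs.1.2], by linarith [hs.1.1]⟩, hs.2⟩
    refine ⟨h1, ?_⟩
    have h3 : HasDerivAt (fun s : ℝ => t - s) (-1) s := by
      simpa using (hasDerivAt_id s).const_sub t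
    have := h2.scomp s h3
    rwa [neg_one_smul, ← hb] at this

theorem isFlowLine_of_isForwardLine {x : Pt d} {γ₁ γ₂ : ℝ → Pt d} {c : ℝ}
    (h₁ : IsForwardLine M.inside (M.field φ c V) T γ₁)
    (h₂ : IsForwardLine M.inside (M.field φ c fun x => -V x) T γ₂) (h₁0 : γ₁ 0 = x)
    (h₂0 : γ₂ 0 = x) (hm₁ : ∀ t ∈ Icc 0 T, γ₁ t ∈ Ω) (hm₂ : ∀ t ∈ Icc 0 T, γ₂ t ∈ Ω) :
    IsFlowLine M φ V T x fun t => if 0 ≤ t then γ₁ t else γ₂ (-t) := by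
  obtain ⟨L₁, hL₁⟩ := h₁.lipschitz
  obtain ⟨L₂, hL₂⟩ := h₂.lipschitz
  obtain ⟨S₁, hS₁, hode₁⟩ := h₁.ode
  obtain ⟨S₂, hS₂, hode₂⟩ := h₂.ode
  have hL₁' := hL₁.weaken (le_max_left L₁ L₂)
  have hL₂' := hL₂.weaken (le_max_right L₁ L₂)
  set L := max L₁ L₂
  refine ⟨by simp [h₁0], ⟨L, ?_⟩, fun t ht => ?_, S₁ ∪ (fun s => -s) ⁻¹' S₂ ∪ {0}, ?_,
    fun t ht => ?_⟩
  · have key : ∀ s ∈ Icc (-T) T, ∀ t ∈ Icc (-T) T, s ≤ t →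
        dist (if 0 ≤ s then γ₁ s else γ₂ (-s)) (if 0 ≤ t then γ₁ t else γ₂ (-t)) ≤
          L * dist s t := by
      intro s hs t ht hst
      rw [dist_comm s t, Real.dist_eq, abs_of_nonneg (by linarith)]
      by_cases h0 : 0 ≤ s
      · rw [if_pos h0, if_pos (h0.trans hst), dist_comm]
        have := hL₁'.dist_le_mul t ⟨h0.trans hst, ht.2⟩ s ⟨h0, hs.2⟩
        rwa [Real.dist_eq, abs_of_nonneg (by linarith)] at this
      · push Not at h0
        rw [if_neg (not_le.2 h0)]
        by_cases h1 : 0 ≤ t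
        · rw [if_pos h1]
          have e1 := hL₁'.dist_le_mul t ⟨h1, ht.2⟩ 0 ⟨le_rfl, h1.trans ht.2⟩
          have e2 := hL₂'.dist_le_mul (-s) ⟨by linarith, by linarith [hs.1]⟩ 0
            ⟨le_rfl, by linarith [ht.2]⟩
          rw [Real.dist_eq, abs_of_nonneg (by linarith), h₁0] at e1
          rw [Real.dist_eq, abs_of_nonneg (by linarith), h₂0] at e2
          have := dist_triangle_right (γ₂ (-s)) (γ₁ t) x
          linarith
        · push Not at h1
          rw [if_neg (not_le.2 h1)]
          have := hL₂'.dist_le_mul (-s) ⟨by linarith, by linarith [hs.1]⟩ (-t)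
            ⟨by linarith, by linarith [ht.1]⟩
          rwa [Real.dist_eq, abs_of_nonneg (by linarith), neg_sub_neg] at this
    refine LipschitzOnWith.of_dist_le_mul fun s hs t ht => ?_
    rcases le_total s t with h | h
    · exact key s hs t ht h
    · rw [dist_comm, dist_comm s t]; exact key t ht s hs h
  · by_cases h0 : 0 ≤ t
    · simp only [if_pos h0]; exact hm₁ t ⟨h0, ht.2⟩
    · simp only [if_neg h0]
      exact hm₂ (-t) ⟨by linarith, by linarith [ht.1]⟩
  · exact (hS₁.union (hS₂.preimage neg_injective)).union (countable_singleton 0)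
  · obtain ⟨ht, hn⟩ := ht
    simp only [mem_union, mem_preimage, mem_singleton_iff, not_or] at hn
    rcases lt_or_gt_of_ne hn.2 with h0 | h0
    · obtain ⟨hU, hd⟩ := hode₂ (-t) ⟨⟨by linarith, by linarith [ht.1]⟩, hn.1.2⟩
      simp only [if_neg (not_le.2 h0)]
      refine ⟨PolytopalMesh.mem_inside.1 hU, ?_⟩
      have h3 := hd.scomp t (hasDerivAt_neg t)
      rw [neg_one_smul, PolytopalMesh.field_of_mem hU, smul_neg, neg_neg] at h3
      refine h3.congr_of_eventuallyEq ?_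
      filter_upwards [Iio_mem_nhds h0] with s hs
      simp [not_le.2 (mem_Iio.1 hs)]
    · obtain ⟨hU, hd⟩ := hode₁ t ⟨⟨h0, ht.2⟩, hn.1.1⟩
      simp only [if_pos h0.le]
      refine ⟨PolytopalMesh.mem_inside.1 hU, ?_⟩
      rw [PolytopalMesh.field_of_mem hU] at hd
      refine hd.congr_of_eventuallyEq ?_
      filter_upwards [Ioi_mem_nhds h0] with s hs
      simp [(mem_Ioi.1 hs).le]

theorem isFlowLine_flow {x : Pt d} (h : ∃ γ, IsFlowLine M φ V T x γ) :
    IsFlowLine M φ V T x fun t => flow M φ V T t x := by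
  have : (fun t => flow M φ V T t x) = h.choose := by
    funext t; simp only [flow, dif_pos h]
  rw [this]
  exact h.choose_spec

theorem flow_mem {x : Pt d} (hx : x ∈ Ω) {t : ℝ} (ht : t ∈ Icc (-T) T) :
    flow M φ V T t x ∈ Ω := by
  by_cases h : ∃ γ, IsFlowLine M φ V T x γ
  · exact (isFlowLine_flow h).mem t ht
  · simpa only [flow, dif_neg h] using hx

/-- The properties of the flow for nonnegative times, for almost every starting point. -/
structure RegularFlow (M : PolytopalMesh Ω) (φ : Pt d → ℝ) (φmin φmax Γ : ℝ)
    (V : Pt d → Pt d) (T : ℝ) : Prop where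
  approx : ∃ X : ℕ → ℝ → Pt d → Pt d, (∀ k, Continuous (Function.uncurry (X k))) ∧
    ∀ᵐ x ∂volume.restrict Ω, ∀ t ∈ Icc 0 T,
      Tendsto (fun k => X k t x) atTop (𝓝 (flow M φ V T t x))
  line : ∀ᵐ x ∂volume.restrict Ω,
    IsForwardLine M.inside (M.field φ φmin V) T fun t => flow M φ V T t x
  start : ∀ᵐ x ∂volume.restrict Ω, flow M φ V T 0 x = x
  unique : ∀ᵐ x ∂volume.restrict Ω, ∀ τ ≤ T, ∀ γ : ℝ → Pt d, γ 0 = x →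
    IsForwardLine M.inside (M.field φ φmin V) τ γ →
      EqOn (fun t => flow M φ V T t x) γ (Icc 0 τ)
  map_le : ∀ t ∈ Icc 0 T,
    ((volume.restrict Ω).withDensity fun x => ENNReal.ofReal (φ x)).map (flow M φ V T t) ≤
      ENNReal.ofReal (Real.exp (Γ / φmin * t)) •
        (volume.restrict Ω).withDensity fun x => ENNReal.ofReal (φ x)
  displacement : ∀ t ∈ Icc 0 T, ∫⁻ x in Ω, ‖flow M φ V T t x - x‖ₑ ≤ ENNReal.ofReal t *
      (ENNReal.ofReal (φmin⁻¹ * Real.exp (Γ / φmin * T) * φmax) *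
        (ENNReal.ofReal φmin⁻¹ * ∫⁻ x in Ω, ‖V x‖ₑ))

theorem IsAdmissible.regularFlow (hA : IsAdmissible M φ φmin φmax V Γ) (hmin : 0 < φmin)
    (hΩ : Ω.Nonempty) (hT : 0 ≤ T) : RegularFlow M φ φmin φmax Γ V T := by
  obtain ⟨C, B, D⟩ := hA.exists_fieldData hmin hΩ
  obtain ⟨C', B', D'⟩ := hA.neg.exists_fieldData hmin hΩ
  obtain ⟨X, hX⟩ := D.exists_flow
  obtain ⟨X', hX'⟩ := D'.exists_flow
  have hgood : ∀ W : Pt d → Pt d, goodSet M.inside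
      (fun x => (M.extendPorosity φ φmin x)⁻¹ • M.extendVelocity W x) ⊆ Ω := fun W =>
    (goodSet_subset_interior_closure PolytopalMesh.isOpen_inside).trans
      PolytopalMesh.interior_closure_inside.subset
  have hmain : ∀ᵐ x ∂volume.restrict Ω, IsFlowLine M φ V T x (fun t => flow M φ V T t x) ∧
      (∀ t ∈ Icc 0 T, Tendsto (fun k => X k t x) atTop (𝓝 (flow M φ V T t x))) ∧
      ∀ τ ≤ T, ∀ γ : ℝ → Pt d, γ 0 = x →
        IsForwardLine M.inside (M.field φ φmin V) τ γ →
          EqOn (fun t => flow M φ V T t x) γ (Icc 0 τ) := by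
    rw [← PolytopalMesh.restrict_inside (M := M)]
    filter_upwards [ae_restrict_of_ae (D.ae_exists_forwardLine hX hT),
      ae_restrict_of_ae (D'.ae_exists_forwardLine hX' hT),
      ae_restrict_mem PolytopalMesh.isOpen_inside.measurableSet] with x h1 h2 hx
    obtain ⟨γ, hγ0, hγ, hγg, hγX, hγu⟩ := h1 hx
    obtain ⟨γ', hγ'0, hγ', hγ'g, -, -⟩ := h2 hx
    have hfl := isFlowLine_flow ⟨_, isFlowLine_of_isForwardLine hγ hγ' hγ0 hγ'0
      (fun t ht => hgood V (hγg t ht)) (fun t ht => hgood _ (hγ'g t ht))⟩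
    have heq : EqOn γ (fun t => flow M φ V T t x) (Icc 0 T) :=
      hγu T le_rfl _ hfl.start (hfl.isForwardLine hT φmin)
    refine ⟨hfl, fun t ht => ?_, fun τ hτ σ hσ0 hσ t ht => ?_⟩
    · rw [← show γ t = flow M φ V T t x from heq ht]; exact hγX t ht
    · exact (heq ⟨ht.1, ht.2.trans hτ⟩).symm.trans (hγu τ hτ σ hσ0 hσ ht)
  have hlim : ∀ t ∈ Icc 0 T, ∀ᵐ x ∂volume.restrict M.inside,
      Tendsto (fun k => X k t x) atTop (𝓝 (flow M φ V T t x)) := fun t ht => by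
    rw [PolytopalMesh.restrict_inside]
    exact hmain.mono fun x hx => hx.2.1 t ht
  have hdens : (volume.restrict Ω).withDensity (fun x => ENNReal.ofReal (φ x)) =
      (volume.restrict Ω).withDensity fun x => ENNReal.ofReal (M.extendPorosity φ φmin x) := by
    refine withDensity_congr_ae ?_
    rw [← PolytopalMesh.restrict_inside (M := M)]
    filter_upwards [ae_restrict_mem PolytopalMesh.isOpen_inside.measurableSet] with x hx
    rw [M.extendPorosity_of_mem hx]
  refine ⟨⟨X, D.continuous_flow hX, hmain.mono fun x hx => hx.2.1⟩,
    hmain.mono fun x hx => hx.1.isForwardLine hT φmin, hmain.mono fun x hx => hx.1.start,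
    hmain.mono fun x hx => hx.2.2, fun t ht => ?_, fun t ht => ?_⟩
  · have h1 := D.map_limit_le hX ht.1 (hlim t ht)
    have hm := D.aemeasurable_limit hX (hlim t ht)
    rw [PolytopalMesh.restrict_inside] at h1 hm
    rw [hdens]
    set ν := ((volume.restrict Ω).withDensity
      fun x => ENNReal.ofReal (M.extendPorosity φ φmin x)).map (flow M φ V T t)
    have hmem : ∀ᵐ y ∂ν, y ∈ Ω := by
      have hm' := hm.mono_ac (withDensity_absolutelyContinuous (volume.restrict Ω)
        fun x => ENNReal.ofReal (M.extendPorosity φ φmin x))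
      refine (ae_map_iff hm' M.isOpen_domain.measurableSet).2 ?_
      refine (withDensity_absolutelyContinuous _ _).ae_le ?_
      filter_upwards [ae_restrict_mem M.isOpen_domain.measurableSet] with x hx
      exact flow_mem hx ⟨by linarith [ht.1], ht.2⟩
    rw [← Measure.restrict_eq_self_of_ae_mem hmem]
    refine (Measure.restrict_mono subset_rfl h1).trans_eq ?_
    rw [Measure.restrict_smul, restrict_withDensity M.isOpen_domain.measurableSet]
  · have h1 := D.lintegral_displacement_le hX ht.1 ht.2 (hlim t ht)
    rw [PolytopalMesh.restrict_inside] at h1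
    refine h1.trans_eq ?_
    congr 3
    rw [← PolytopalMesh.restrict_inside (M := M),
      ← lintegral_indicator PolytopalMesh.isOpen_inside.measurableSet]
    congr 1 with x
    by_cases hx : x ∈ M.inside
    · rw [M.extendVelocity_of_mem hx, indicator_of_mem hx]
    · rw [M.extendVelocity_of_notMem hx, indicator_of_notMem hx, enorm_zero]

end AdmissibleFlow


/-! ### Composition operators on `L²` and their adjoints -/

section Composition

variable {α : Type*} [MeasurableSpace α] {ν : Measure α} {Θ : α → α} {c : ℝ≥0}

theorem eLpNorm_comp_le (hΘ : AEMeasurable Θ ν) (hle : ν.map Θ ≤ (c : ℝ≥0∞) • ν) {f : α → ℝ}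
    (hf : AEStronglyMeasurable f ν) :
    eLpNorm (fun x => f (Θ x)) 2 ν ≤ (c : ℝ≥0∞) ^ (1 / 2 : ℝ) * eLpNorm f 2 ν := by
  have hac : ν.map Θ ≪ ν := (Measure.absolutelyContinuous_of_le hle).trans
    (Measure.smul_absolutelyContinuous)
  have h1 := eLpNorm_map_measure (p := 2) (hf.mono_ac hac) hΘ
  change eLpNorm (f ∘ Θ) 2 ν ≤ _
  rw [← h1]
  refine (eLpNorm_mono_measure f hle).trans ?_
  rw [eLpNorm_smul_measure_of_ne_top (by norm_num)]
  simp

theorem absolutelyContinuous_of_map_le (hle : ν.map Θ ≤ (c : ℝ≥0∞) • ν) : ν.map Θ ≪ ν :=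
  (Measure.absolutelyContinuous_of_le hle).trans Measure.smul_absolutelyContinuous

theorem MeasureTheory.MemLp.comp_of_map_le {f : α → ℝ} (hf : MemLp f 2 ν) (hΘ : AEMeasurable Θ ν)
    (hle : ν.map Θ ≤ (c : ℝ≥0∞) • ν) : MemLp (fun x => f (Θ x)) 2 ν := by
  refine ⟨(hf.1.mono_ac (absolutelyContinuous_of_map_le hle)).comp_aemeasurable hΘ, ?_⟩
  refine (eLpNorm_comp_le hΘ hle hf.1).trans_lt (ENNReal.mul_lt_top ?_ hf.2)
  exact ENNReal.rpow_lt_top_of_nonneg (by norm_num) ENNReal.coe_ne_top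

theorem ae_comp_of_map_le (hΘ : AEMeasurable Θ ν) (hle : ν.map Θ ≤ (c : ℝ≥0∞) • ν) {p : α → Prop}
    (hp : ∀ᵐ x ∂ν, p x) : ∀ᵐ x ∂ν, p (Θ x) :=
  ae_of_ae_map hΘ ((absolutelyContinuous_of_map_le hle).ae_le hp)

/-- Composition with a map which increases the measure at most by a factor is an operator on
`L²`. -/
theorem exists_compOperator (hΘ : AEMeasurable Θ ν) (hle : ν.map Θ ≤ (c : ℝ≥0∞) • ν) :
    ∃ A : Lp ℝ 2 ν →L[ℝ] Lp ℝ 2 ν, (∀ (f : α → ℝ) (hf : MemLp f 2 ν),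
      A (hf.toLp f) =ᵐ[ν] fun x => f (Θ x)) ∧ ∀ ψ, ‖A ψ‖ ≤ (c : ℝ) ^ (1 / 2 : ℝ) * ‖ψ‖ := by
  have hm : ∀ ψ : Lp ℝ 2 ν, MemLp (fun x => ψ (Θ x)) 2 ν := fun ψ =>
    (Lp.memLp ψ).comp_of_map_le hΘ hle
  have hb : ∀ ψ : Lp ℝ 2 ν, ‖(hm ψ).toLp _‖ ≤ (c : ℝ) ^ (1 / 2 : ℝ) * ‖ψ‖ := fun ψ => by
    rw [Lp.norm_toLp, Lp.norm_def]
    have h1 := eLpNorm_comp_le hΘ hle (Lp.aestronglyMeasurable ψ)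
    have h2 := ENNReal.toReal_mono (ENNReal.mul_ne_top
      (ENNReal.rpow_ne_top_of_nonneg (by norm_num) ENNReal.coe_ne_top) (Lp.eLpNorm_ne_top ψ)) h1
    rwa [ENNReal.toReal_mul, ← ENNReal.toReal_rpow, ENNReal.coe_toReal] at h2
  set A : Lp ℝ 2 ν →ₗ[ℝ] Lp ℝ 2 ν :=
    { toFun := fun ψ => (hm ψ).toLp _
      map_add' := fun ψ χ => by
        rw [← MemLp.toLp_add]
        refine MemLp.toLp_congr _ _ ?_
        exact ae_comp_of_map_le hΘ hle (Lp.coeFn_add ψ χ)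
      map_smul' := fun a ψ => by
        rw [RingHom.id_apply, ← MemLp.toLp_const_smul]
        refine MemLp.toLp_congr _ _ ?_
        exact ae_comp_of_map_le hΘ hle (Lp.coeFn_smul a ψ) }
  refine ⟨A.mkContinuous _ hb, fun f hf => ?_, hb⟩
  exact (MemLp.coeFn_toLp (hm (hf.toLp f))).trans (ae_comp_of_map_le hΘ hle hf.coeFn_toLp)

end Composition

/-- `Θ` and `Θ'` are inverse to each other and multiply the measure `φ ν` at most by `w`. -/
structure IsTransportPair {α : Type*} [MeasurableSpace α] (ν : Measure α) (φ w : α → ℝ)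
    (Θ Θ' : α → α) : Prop where
  aemeasurable : AEMeasurable Θ ν
  aemeasurable' : AEMeasurable Θ' ν
  map_le : (ν.withDensity fun x => ENNReal.ofReal (φ x)).map Θ ≤
    (ν.withDensity fun x => ENNReal.ofReal (φ x)).withDensity fun x => ENNReal.ofReal (w x)
  map_le' : (ν.withDensity fun x => ENNReal.ofReal (φ x)).map Θ' ≤
    (ν.withDensity fun x => ENNReal.ofReal (φ x)).withDensity fun x => ENNReal.ofReal (w x)
  left_inv : ∀ᵐ x ∂ν, Θ' (Θ x) = x
  right_inv : ∀ᵐ x ∂ν, Θ (Θ' x) = x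
  weight : ∀ᵐ x ∂ν, w (Θ x) = w x
  weight' : ∀ᵐ x ∂ν, w (Θ' x) = w x

namespace IsTransportPair

variable {α : Type*} [MeasurableSpace α] {ν : Measure α} [IsFiniteMeasure ν] {φ w : α → ℝ}
  {Θ Θ' : α → α} {φmin φmax W : ℝ}

theorem symm (h : IsTransportPair ν φ w Θ Θ') : IsTransportPair ν φ w Θ' Θ :=
  ⟨h.aemeasurable', h.aemeasurable, h.map_le', h.map_le, h.right_inv, h.left_inv, h.weight',
    h.weight⟩

variable (h : IsTransportPair ν φ w Θ Θ') (hmin : 0 < φmin) (hφm : AEMeasurable φ ν)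
  (hφ : ∀ᵐ x ∂ν, φmin ≤ φ x ∧ φ x ≤ φmax) (hw : Measurable w) (hw1 : ∀ x, 1 ≤ w x)
  (hwW : ∀ x, w x ≤ W)

include h hmin hφ hwW

theorem map_le_smul : ν.map Θ ≤ ((φmax / φmin * W).toNNReal : ℝ≥0∞) • ν := by
  have lo : ENNReal.ofReal φmin • ν ≤ ν.withDensity fun x => ENNReal.ofReal (φ x) := by
    rw [← withDensity_const]
    exact withDensity_mono (hφ.mono fun x hx => ENNReal.ofReal_le_ofReal hx.1)
  have hi : ν.withDensity (fun x => ENNReal.ofReal (φ x)) ≤ ENNReal.ofReal φmax • ν := by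
    rw [← withDensity_const]
    exact withDensity_mono (hφ.mono fun x hx => ENNReal.ofReal_le_ofReal hx.2)
  have hww : (ν.withDensity fun x => ENNReal.ofReal (φ x)).withDensity
      (fun x => ENNReal.ofReal (w x)) ≤
      ENNReal.ofReal W • ν.withDensity fun x => ENNReal.ofReal (φ x) := by
    rw [← withDensity_const]
    exact withDensity_mono (ae_of_all _ fun x => ENNReal.ofReal_le_ofReal (hwW x))
  have hΘ : AEMeasurable Θ (ν.withDensity fun x => ENNReal.ofReal (φ x)) :=
    h.aemeasurable.mono_ac (withDensity_absolutelyContinuous _ _)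
  intro s
  rcases eq_or_ne ν 0 with hν | hν
  · simp [hν]
  have : NeZero ν := ⟨hν⟩
  obtain ⟨x₀, hx₀⟩ := hφ.exists
  have hle : φmin ≤ φmax := hx₀.1.trans hx₀.2
  have hmax : 0 < φmax := hmin.trans_le hle
  have h1 : (ENNReal.ofReal φmin • ν).map Θ s ≤ ENNReal.ofReal W * (ENNReal.ofReal φmax * ν s) := by
    refine (Measure.map_mono_of_aemeasurable lo hΘ s).trans ((h.map_le s).trans ((hww s).trans ?_))
    rw [Measure.smul_apply, smul_eq_mul]
    exact mul_le_mul_right (hi s) _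
  rw [Measure.map_smul, Measure.smul_apply, smul_eq_mul] at h1
  have hp : ENNReal.ofReal φmin ≠ 0 := by simpa using hmin
  change _ ≤ ENNReal.ofReal (φmax / φmin * W) * ν s
  rw [ENNReal.ofReal_mul (div_pos hmax hmin).le, ENNReal.ofReal_div_of_pos hmin, mul_assoc,
    ENNReal.div_eq_inv_mul, mul_assoc, ← ENNReal.div_eq_inv_mul,
    ENNReal.le_div_iff_mul_le (Or.inl hp) (Or.inl ENNReal.ofReal_ne_top), mul_comm]
  refine h1.trans_eq ?_
  ring

include hφm hw hw1

/-- The Jacobian of `Θ` with respect to `φ ν`. -/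
theorem exists_jacobian : ∃ J : α → ℝ, AEMeasurable J ν ∧ (∀ᵐ x ∂ν, |J x - 1| ≤ w x - 1 ∧ 0 ≤ J x) ∧
    ∀ f g : α → ℝ, AEStronglyMeasurable f ν → AEStronglyMeasurable g ν →
      ∫ x, f (Θ x) * g x ∂ν = ∫ x, f x * (J x * φ x * (g (Θ' x) / φ (Θ' x))) ∂ν := by
  set ρ := ν.withDensity fun x => ENNReal.ofReal (φ x) with hρ
  have hρν : ρ ≪ ν := withDensity_absolutelyContinuous _ _
  have hφm' : AEMeasurable (fun x => (φ x).toNNReal) ν := hφm.real_toNNReal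
  have hνρ : ν ≪ ρ := by
    refine withDensity_absolutelyContinuous' hφm.ennreal_ofReal ?_
    filter_upwards [hφ] with x hx
    simpa using hmin.trans_le hx.1
  have hfin : IsFiniteMeasure ρ := by
    refine isFiniteMeasure_withDensity_ofReal ?_
    refine HasFiniteIntegral.of_bounded (C := φmax) (hφ.mono fun x hx => ?_)
    rw [Real.norm_of_nonneg (hmin.le.trans hx.1)]; exact hx.2
  have hΘ : AEMeasurable Θ ρ := h.aemeasurable.mono_ac hρν
  have hΘ' : AEMeasurable Θ' ρ := h.aemeasurable'.mono_ac hρν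
  have hac : ρ.map Θ ≪ ρ := (Measure.absolutelyContinuous_of_le h.map_le).trans
    (withDensity_absolutelyContinuous _ _)
  have hac' : ρ.map Θ' ≪ ρ := (Measure.absolutelyContinuous_of_le h.map_le').trans
    (withDensity_absolutelyContinuous _ _)
  have hfm : IsFiniteMeasure (ρ.map Θ) := Measure.isFiniteMeasure_map ρ Θ
  set J := (ρ.map Θ).rnDeriv ρ
  have hJm : Measurable J := Measure.measurable_rnDeriv _ _
  have hJ : ρ.withDensity J = ρ.map Θ := Measure.withDensity_rnDeriv_eq _ _ hac
  have hwm : Measurable fun x => ENNReal.ofReal (w x) := hw.ennreal_ofReal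
  have hJw : J ≤ᵐ[ρ] fun x => ENNReal.ofReal (w x) := by
    refine ae_le_of_forall_setLIntegral_le_of_sigmaFinite hJm fun s hs _ => ?_
    rw [← withDensity_apply _ hs, ← withDensity_apply _ hs, hJ]
    exact h.map_le s
  have hJ1 : (fun _ => 1) ≤ᵐ[ρ] fun x => J x * ENNReal.ofReal (w x) := by
    refine ae_le_of_forall_setLIntegral_le_of_sigmaFinite measurable_const fun s hs _ => ?_
    have e1 : (ρ.map Θ').map Θ = ρ := by
      rw [AEMeasurable.map_map_of_aemeasurable (hΘ.mono_ac hac') hΘ']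
      conv_rhs => rw [← Measure.map_id (μ := ρ)]
      exact Measure.map_congr (hρν.ae_le h.right_inv)
    have hws : Measurable (s.indicator fun x => ENNReal.ofReal (w x)) := hwm.indicator hs
    calc ∫⁻ x in s, 1 ∂ρ = ((ρ.map Θ').map Θ) s := by rw [e1, setLIntegral_const, one_mul]
      _ ≤ ((ρ.withDensity fun x => ENNReal.ofReal (w x)).map Θ) s :=
          Measure.map_mono_of_aemeasurable h.map_le' (hΘ.mono_ac (withDensity_absolutelyContinuous _ _)) s
      _ = ∫⁻ x, s.indicator (fun x => ENNReal.ofReal (w x)) (Θ x) ∂ρ := by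
          rw [Measure.map_apply_of_aemeasurable (hΘ.mono_ac (withDensity_absolutelyContinuous _ _)) hs,
            withDensity_apply₀ _ ?_, ← lintegral_indicator₀ ?_]
          · refine lintegral_congr_ae ?_
            filter_upwards [hρν.ae_le h.weight] with x hx
            by_cases hxs : Θ x ∈ s
            · rw [indicator_of_mem (show x ∈ Θ ⁻¹' s from hxs), indicator_of_mem hxs, hx]
            · rw [indicator_of_notMem (show x ∉ Θ ⁻¹' s from hxs), indicator_of_notMem hxs]
          · exact hΘ.nullMeasurableSet_preimage hs
          · exact hΘ.nullMeasurableSet_preimage hs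
      _ = ∫⁻ x, s.indicator (fun x => ENNReal.ofReal (w x)) x ∂(ρ.withDensity J) := by
          rw [hJ, lintegral_map' hws.aemeasurable hΘ]
      _ = ∫⁻ x in s, J x * ENNReal.ofReal (w x) ∂ρ := by
          rw [lintegral_withDensity_eq_lintegral_mul _ hJm hws, ← lintegral_indicator hs]
          congr 1 with x
          by_cases hxs : x ∈ s <;> simp [hxs]
  refine ⟨fun x => (J x).toReal, hJm.ennreal_toReal.aemeasurable, ?_, fun f g hf hg => ?_⟩
  · refine hνρ.ae_le ?_
    filter_upwards [hJw, hJ1] with x h1 h2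
    have hw0 : 0 ≤ w x := zero_le_one.trans (hw1 x)
    have h3 : (J x).toReal ≤ w x := by
      have := ENNReal.toReal_mono ENNReal.ofReal_ne_top h1
      rwa [ENNReal.toReal_ofReal hw0] at this
    have h4 : 1 ≤ (J x).toReal * w x := by
      have hne : J x ≠ ⊤ := (h1.trans_lt ENNReal.ofReal_lt_top).ne
      have := ENNReal.toReal_mono (ENNReal.mul_ne_top hne ENNReal.ofReal_ne_top) h2
      rwa [ENNReal.toReal_one, ENNReal.toReal_mul, ENNReal.toReal_ofReal hw0] at this
    refine ⟨abs_le.2 ⟨?_, by linarith⟩, ENNReal.toReal_nonneg⟩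
    nlinarith [hw1 x, sq_nonneg (w x - 1), sq_nonneg ((J x).toReal - 1)]
  · have hd : ∀ F : α → ℝ, ∫ x, F x ∂ρ = ∫ x, φ x * F x ∂ν := by
      intro F
      refine (integral_withDensity_eq_integral_smul₀ hφm' F).trans (integral_congr_ae ?_)
      filter_upwards [hφ] with x hx
      simp only [NNReal.smul_def, Real.coe_toNNReal _ (hmin.le.trans hx.1), smul_eq_mul]
    have hφa := hφm.aestronglyMeasurable
    have hgφ : AEStronglyMeasurable (fun x => g x / φ x) ρ :=
      (hg.aemeasurable.div hφm).aestronglyMeasurable.mono_ac hρν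
    have hG : AEStronglyMeasurable (fun x => f x * (g (Θ' x) / φ (Θ' x))) ρ :=
      (hf.mono_ac hρν).mul ((hgφ.mono_ac hac').comp_aemeasurable hΘ')
    calc ∫ x, f (Θ x) * g x ∂ν = ∫ x, f (Θ x) * (g x / φ x) ∂ρ := by
          rw [hd]
          refine integral_congr_ae ?_
          filter_upwards [hφ] with x hx
          have := (hmin.trans_le hx.1).ne'
          field_simp
      _ = ∫ x, f (Θ x) * (g (Θ' (Θ x)) / φ (Θ' (Θ x))) ∂ρ := by
          refine integral_congr_ae ?_
          filter_upwards [hρν.ae_le h.left_inv] with x hx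
          rw [hx]
      _ = ∫ x, f x * (g (Θ' x) / φ (Θ' x)) ∂(ρ.map Θ) :=
          (integral_map (φ := Θ) hΘ (f := fun x => f x * (g (Θ' x) / φ (Θ' x)))
            (hG.mono_ac hac)).symm
      _ = ∫ x, (J x).toReal * (f x * (g (Θ' x) / φ (Θ' x))) ∂ρ := by
          rw [← hJ, integral_withDensity_eq_integral_toReal_smul hJm
            (Measure.rnDeriv_lt_top _ _)]
          rfl
      _ = _ := by
          rw [hd]
          congr 1 with x
          ring

/-- The adjoint of the composition with `Θ`. -/
theorem exists_adjoint {A : Lp ℝ 2 ν →L[ℝ] Lp ℝ 2 ν}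
    (hA : ∀ (f : α → ℝ) (hf : MemLp f 2 ν), A (hf.toLp f) =ᵐ[ν] fun x => f (Θ x)) :
    ∃ R : α → ℝ, MemLp R ⊤ ν ∧ (∀ᵐ x ∂ν, |R x| ≤ (w x - 1) * (φmax / φmin)) ∧
      ∀ (g : α → ℝ) (hg : MemLp g 2 ν), ContinuousLinearMap.adjoint A (hg.toLp g) =ᵐ[ν]
        fun x => φ x * (g (Θ' x) / φ (Θ' x)) + R x * g (Θ' x) := by
  obtain ⟨J, hJm, hJ, hint⟩ := h.exists_jacobian hmin hφm hφ hw hw1 hwW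
  have hle := h.symm.map_le_smul hmin hφ hwW
  have hφΘ := ae_comp_of_map_le h.aemeasurable' hle hφ
  have hφΘm : AEMeasurable (fun x => φ (Θ' x)) ν :=
    (hφm.mono_ac (absolutelyContinuous_of_map_le hle)).comp_aemeasurable h.aemeasurable'
  set R : α → ℝ := fun x => (J x - 1) * (φ x / φ (Θ' x))
  have hRm : AEStronglyMeasurable R ν :=
    ((hJm.sub_const 1).mul (hφm.div hφΘm)).aestronglyMeasurable
  have hRb : ∀ᵐ x ∂ν, |R x| ≤ (w x - 1) * (φmax / φmin) := by
    filter_upwards [hJ, hφ, hφΘ] with x h1 h2 h3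
    rw [abs_mul]
    refine mul_le_mul h1.1 ?_ (abs_nonneg _) (by linarith [hw1 x])
    rw [abs_of_nonneg (div_nonneg (hmin.le.trans h2.1) (hmin.le.trans h3.1))]
    exact div_le_div₀ ((hmin.le.trans h2.1).trans h2.2) h2.2 hmin h3.1
  have hRt : MemLp R ⊤ ν := by
    refine memLp_top_of_bound hRm ((W - 1) * (φmax / φmin)) ?_
    filter_upwards [hRb, hφ] with x hx h2
    refine hx.trans (mul_le_mul_of_nonneg_right (by linarith [hwW x]) ?_)
    exact div_nonneg ((hmin.le.trans h2.1).trans h2.2) hmin.le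
  refine ⟨R, hRt, hRb, fun g hg => ?_⟩
  set H : α → ℝ := fun x => φ x * (g (Θ' x) / φ (Θ' x)) + R x * g (Θ' x)
  have hgφ : MemLp (fun x => g x / φ x) 2 ν := by
    refine MemLp.of_le_mul (c := φmin⁻¹) hg (hg.1.aemeasurable.div hφm).aestronglyMeasurable ?_
    filter_upwards [hφ] with x hx
    rw [norm_div, Real.norm_of_nonneg (hmin.le.trans hx.1), div_eq_inv_mul]
    exact mul_le_mul_of_nonneg_right (inv_anti₀ hmin hx.1) (norm_nonneg _)
  have hφt : MemLp φ ⊤ ν := by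
    refine memLp_top_of_bound hφm.aestronglyMeasurable φmax (hφ.mono fun x hx => ?_)
    rw [Real.norm_of_nonneg (hmin.le.trans hx.1)]; exact hx.2
  have hHm : MemLp H 2 ν :=
    ((hgφ.comp_of_map_le h.aemeasurable' hle).mul hφt).add
      ((hg.comp_of_map_le h.aemeasurable' hle).mul hRt)
  have key : ContinuousLinearMap.adjoint A (hg.toLp g) = hHm.toLp H := by
    refine ext_inner_right ℝ fun v => ?_
    rw [ContinuousLinearMap.adjoint_inner_left, L2.inner_def, L2.inner_def]
    have hv : A v =ᵐ[ν] fun x => v (Θ x) := by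
      have := hA v (Lp.memLp v)
      rwa [Lp.toLp_coeFn] at this
    calc ∫ x, inner ℝ (hg.toLp g x) (A v x) ∂ν = ∫ x, v (Θ x) * g x ∂ν := by
          refine integral_congr_ae ?_
          filter_upwards [hv, hg.coeFn_toLp] with x h1 h2
          rw [h1, h2]; simp
      _ = ∫ x, v x * (J x * φ x * (g (Θ' x) / φ (Θ' x))) ∂ν :=
          hint _ _ (Lp.aestronglyMeasurable v) hg.1
      _ = ∫ x, inner ℝ (hHm.toLp H x) (v x) ∂ν := by
          refine integral_congr_ae ?_
          filter_upwards [hHm.coeFn_toLp] with x h1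
          rw [h1]
          simp only [H, R, RCLike.inner_apply, conj_trivial]
          ring
  rw [key]
  exact hHm.coeFn_toLp

end IsTransportPair


/-! ### Time grids -/

section TimeGrid

variable {T : ℝ} {N : ℕ} {t : ℕ → ℝ}

theorem IsTimeGrid.mono (ht : IsTimeGrid T N t) {k n : ℕ} (hkn : k ≤ n) (hn : n ≤ N) :
    t k ≤ t n := by
  induction n, hkn using Nat.le_induction with
  | base => exact le_rfl
  | succ n _ ih => exact (ih (by omega)).trans (ht.lt n (by omega)).le

theorem IsTimeGrid.nonneg (ht : IsTimeGrid T N t) {n : ℕ} (hn : n ≤ N) : 0 ≤ t n :=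
  ht.zero ▸ ht.mono (Nat.zero_le n) hn

theorem IsTimeGrid.le_last (ht : IsTimeGrid T N t) {n : ℕ} (hn : n ≤ N) : t n ≤ T :=
  ht.last ▸ ht.mono hn le_rfl

theorem IsTimeGrid.step_le (ht : IsTimeGrid T N t) {n : ℕ} (hn : n < N) : t (n + 1) - t n ≤ T := by
  linarith [ht.nonneg hn.le, ht.le_last (show n + 1 ≤ N from hn)]

theorem IsTimeGrid.step_le_maxStep {n : ℕ} (hn : n < N) :
    t (n + 1) - t n ≤ maxStep N t :=
  le_ciSup (f := fun n : Fin N => t (n + 1) - t n) (Set.finite_range _).bddAbove ⟨n, hn⟩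

theorem IsTimeGrid.sum_indicator (ht : IsTimeGrid T N t) {β : Type*} [AddCommMonoid β]
    {I : ℕ → Set ℝ} (hI : ∀ n, I n ⊆ Ioc (t n) (t (n + 1))) {n : ℕ} (hn : n < N) {s : ℝ}
    (hs : s ∈ I n) (f : ℕ → ℝ → β) : ∑ k ∈ Finset.range N, (I k).indicator (f k) s = f n s := by
  rw [Finset.sum_eq_single_of_mem n (Finset.mem_range.2 hn), indicator_of_mem hs]
  intro k hk hkn
  refine indicator_of_notMem (fun hsk => ?_) _
  rw [Finset.mem_range] at hk
  have h1 := hI n hs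
  have h2 := hI k hsk
  rcases lt_or_gt_of_ne hkn with h | h
  · linarith [ht.mono (show k + 1 ≤ n from h) hn.le, h2.2, h1.1]
  · linarith [ht.mono (show n + 1 ≤ k from h) hk.le, h1.2, h2.1]

theorem exists_mem_Ioo_of_forall_ne (N : ℕ) (t : ℕ → ℝ) {s : ℝ} (hs : s ∈ Ioo (t 0) (t N))
    (hne : ∀ n, s ≠ t n) : ∃ n < N, s ∈ Ioo (t n) (t (n + 1)) := by
  induction N with
  | zero => exact absurd (hs.1.trans hs.2) (lt_irrefl _)
  | succ N ih =>
    rcases lt_or_gt_of_ne (hne N) with h | h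
    · obtain ⟨n, hn, h'⟩ := ih ⟨hs.1, h⟩
      exact ⟨n, hn.trans (Nat.lt_succ_self N), h'⟩
    · exact ⟨N, Nat.lt_succ_self N, h, hs.2⟩

theorem IsTimeGrid.ae_exists_mem (ht : IsTimeGrid T N t) :
    ∀ᵐ s ∂volume.restrict (Ioo 0 T), ∃ n < N, s ∈ Ioo (t n) (t (n + 1)) := by
  filter_upwards [ae_restrict_mem measurableSet_Ioo,
    ae_restrict_of_ae ((countable_range t).ae_notMem volume)] with s hs hne
  refine exists_mem_Ioo_of_forall_ne N t (by rwa [ht.zero, ht.last]) fun n h => hne ⟨n, h.symm⟩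

/-- The length of the time step around `s`. -/
noncomputable def stepSize (N : ℕ) (t : ℕ → ℝ) (s : ℝ) : ℝ :=
  ∑ n ∈ Finset.range N, (Ioo (t n) (t (n + 1))).indicator (fun _ => t (n + 1) - t n) s

theorem IsTimeGrid.stepSize_eq (ht : IsTimeGrid T N t) {n : ℕ} (hn : n < N) {s : ℝ}
    (hs : s ∈ Ioo (t n) (t (n + 1))) : stepSize N t s = t (n + 1) - t n :=
  ht.sum_indicator (fun _ => Ioo_subset_Ioc_self) hn hs fun n _ => t (n + 1) - t n

theorem measurable_stepSize : Measurable (stepSize N t) :=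
  Finset.measurable_fun_sum _ fun _ _ => measurable_const.indicator measurableSet_Ioo

theorem IsTimeGrid.stepSize_mem (ht : IsTimeGrid T N t) (hT : 0 ≤ T) (s : ℝ) :
    stepSize N t s ∈ Icc 0 T := by
  by_cases h : ∃ n < N, s ∈ Ioo (t n) (t (n + 1))
  · obtain ⟨n, hn, hs⟩ := h
    rw [ht.stepSize_eq hn hs]
    exact ⟨(sub_pos.2 (ht.lt n hn)).le, ht.step_le hn⟩
  · have : stepSize N t s = 0 := Finset.sum_eq_zero fun n hn => indicator_of_notMem
      (fun hs => h ⟨n, Finset.mem_range.1 hn, hs⟩) _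
    rw [this]
    exact ⟨le_rfl, hT⟩

end TimeGrid

/-! ### The space-time transport maps -/

section StepMap

variable {d : ℕ} {Ω : Set (Pt d)} {T : ℝ} {N : ℕ} {t : ℕ → ℝ} {M : ℕ → PolytopalMesh Ω}
  {φ : Pt d → ℝ} {φmin φmax Γ : ℝ} {V : ℕ → Pt d → Pt d} {τ : ℕ → ℝ → ℝ}

/-- The map `(x, s) ↦ (F^n_{τ n s}(x), s)` for `s ∈ (t n, t (n + 1))`. -/
noncomputable def stepMap (N : ℕ) (t : ℕ → ℝ) (F : ℕ → ℝ → Pt d → Pt d) (τ : ℕ → ℝ → ℝ)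
    (p : Pt d × ℝ) : Pt d × ℝ :=
  (∑ n ∈ Finset.range N, (Ioo (t n) (t (n + 1))).indicator (fun s => F n (τ n s) p.1) p.2, p.2)

theorem IsTimeGrid.stepMap_eq (ht : IsTimeGrid T N t) {F : ℕ → ℝ → Pt d → Pt d} {n : ℕ}
    (hn : n < N) {p : Pt d × ℝ} (hp : p.2 ∈ Ioo (t n) (t (n + 1))) :
    stepMap N t F τ p = (F n (τ n p.2) p.1, p.2) := by
  rw [stepMap, ht.sum_indicator (fun _ => Ioo_subset_Ioc_self) hn hp fun n s => F n (τ n s) p.1]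

theorem IsTimeGrid.ae_spaceTime (ht : IsTimeGrid T N t) {P : ℕ → Pt d → Prop}
    (hP : ∀ n < N, ∀ᵐ x ∂volume.restrict Ω, P n x) :
    ∀ᵐ p ∂spaceTime Ω T, ∃ n < N, p.2 ∈ Ioo (t n) (t (n + 1)) ∧ P n p.1 := by
  have h1 : ∀ᵐ x ∂volume.restrict Ω, ∀ n ∈ Finset.range N, P n x :=
    (Finset.eventually_all _).2 fun n hn => hP n (Finset.mem_range.1 hn)
  have h2 : ∀ᵐ p ∂spaceTime Ω T, ∀ n ∈ Finset.range N, P n p.1 :=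
    Measure.quasiMeasurePreserving_fst.ae h1
  have h3 : ∀ᵐ p ∂spaceTime Ω T, ∃ n < N, p.2 ∈ Ioo (t n) (t (n + 1)) :=
    Measure.quasiMeasurePreserving_snd.ae ht.ae_exists_mem
  filter_upwards [h2, h3] with p hp ⟨n, hn, hs⟩
  exact ⟨n, hn, hs, hp n (Finset.mem_range.2 hn)⟩

/-- Admissible elapsed times within a time step. -/
structure IsElapsed (N : ℕ) (t : ℕ → ℝ) (τ : ℕ → ℝ → ℝ) : Prop where
  measurable : ∀ n, Measurable (τ n)
  mem : ∀ n < N, ∀ s ∈ Ioo (t n) (t (n + 1)), τ n s ∈ Icc 0 (t (n + 1) - t n)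

theorem IsElapsed.mem_Icc (hτ : IsElapsed N t τ) (ht : IsTimeGrid T N t) {n : ℕ} (hn : n < N)
    {s : ℝ} (hs : s ∈ Ioo (t n) (t (n + 1))) : τ n s ∈ Icc 0 T :=
  ⟨(hτ.mem n hn s hs).1, (hτ.mem n hn s hs).2.trans (ht.step_le hn)⟩

theorem RegularFlow.aemeasurable {M : PolytopalMesh Ω} {V : Pt d → Pt d}
    (h : RegularFlow M φ φmin φmax Γ V T) {t : ℝ} (ht : t ∈ Icc 0 T) :
    AEMeasurable (flow M φ V T t) (volume.restrict Ω) := by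
  obtain ⟨X, hX, hlim⟩ := h.approx
  exact aemeasurable_of_tendsto_metrizable_ae atTop
    (fun k => ((hX k).comp (Continuous.prodMk_right t)).measurable.aemeasurable)
    (hlim.mono fun x hx => hx t ht)

theorem aemeasurable_stepMap (ht : IsTimeGrid T N t) (hτ : IsElapsed N t τ)
    (hF : ∀ n < N, RegularFlow (M n) φ φmin φmax Γ (V n) T) :
    AEMeasurable (stepMap N t (fun n => flow (M n) φ (V n) T) τ) (spaceTime Ω T) := by
  have h0 : ∀ n, ∃ X : ℕ → ℝ → Pt d → Pt d, (∀ k, Continuous (Function.uncurry (X k))) ∧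
      (n < N → ∀ᵐ x ∂volume.restrict Ω, ∀ s ∈ Icc 0 T,
        Tendsto (fun k => X k s x) atTop (𝓝 (flow (M n) φ (V n) T s x))) := by
    intro n
    by_cases hn : n < N
    · obtain ⟨X, h1, h2⟩ := (hF n hn).approx
      exact ⟨X, h1, fun _ => h2⟩
    · exact ⟨fun _ _ _ => 0, fun k => continuous_const, fun h => absurd h hn⟩
  choose X hXc hX using h0
  refine aemeasurable_of_tendsto_metrizable_ae atTop
    (f := fun k => stepMap N t (fun n => X n k) τ) (fun k => Measurable.aemeasurable ?_) ?_
  · refine Measurable.prodMk (Finset.measurable_fun_sum _ fun n _ => ?_) measurable_snd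
    have e : (fun p : Pt d × ℝ => (Ioo (t n) (t (n + 1))).indicator
        (fun s => X n k (τ n s) p.1) p.2) = (Prod.snd ⁻¹' Ioo (t n) (t (n + 1))).indicator
        fun p => Function.uncurry (X n k) (τ n p.2, p.1) := by
      ext1 p; by_cases hp : p.2 ∈ Ioo (t n) (t (n + 1))
      · rw [indicator_of_mem hp, indicator_of_mem (by exact hp)]; rfl
      · rw [indicator_of_notMem hp, indicator_of_notMem (by exact hp)]
    rw [e]
    exact ((hXc n k).measurable.comp (((hτ.measurable n).comp measurable_snd).prodMk
      measurable_fst)).indicator (measurable_snd measurableSet_Ioo)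
  · filter_upwards [ht.ae_spaceTime hX] with p ⟨n, hn, hs, hp⟩
    rw [ht.stepMap_eq hn hs]
    simp only [ht.stepMap_eq hn hs]
    exact (hp _ (hτ.mem_Icc ht hn hs)).prodMk_nhds tendsto_const_nhds

theorem map_stepMap_le (ht : IsTimeGrid T N t) (hτ : IsElapsed N t τ) (hmin : 0 < φmin)
    (hΓ : 0 ≤ Γ) (hφm : AEMeasurable φ (volume.restrict Ω))
    (hF : ∀ n < N, RegularFlow (M n) φ φmin φmax Γ (V n) T) :
    ((spaceTime Ω T).withDensity fun p => ENNReal.ofReal (φ p.1)).map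
        (stepMap N t (fun n => flow (M n) φ (V n) T) τ) ≤
      ((spaceTime Ω T).withDensity fun p => ENNReal.ofReal (φ p.1)).withDensity
        fun p => ENNReal.ofReal (Real.exp (Γ / φmin * stepSize N t p.2)) := by
  set Θ := stepMap N t (fun n => flow (M n) φ (V n) T) τ
  set ρ := (spaceTime Ω T).withDensity fun p => ENNReal.ofReal (φ p.1)
  set κ := (volume.restrict Ω).withDensity fun x => ENNReal.ofReal (φ x) with hκ
  have hρ : ρ = κ.prod (volume.restrict (Ioo 0 T)) :=
    (prod_withDensity_left₀ hφm.ennreal_ofReal).symm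
  have hΘ : AEMeasurable Θ ρ :=
    (aemeasurable_stepMap ht hτ hF).mono_ac (withDensity_absolutelyContinuous _ _)
  have hwm : Measurable fun p : Pt d × ℝ =>
      ENNReal.ofReal (Real.exp (Γ / φmin * stepSize N t p.2)) :=
    (Real.measurable_exp.comp ((measurable_stepSize.comp measurable_snd).const_mul _)).ennreal_ofReal
  refine Measure.le_iff.2 fun S hS => ?_
  set f : Pt d × ℝ → ℝ≥0∞ := S.indicator 1
  have hf : Measurable f := measurable_one.indicator hS
  have e1 : ρ.map Θ S = ∫⁻ p, f (Θ p) ∂ρ := by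
    rw [← lintegral_map' hf.aemeasurable hΘ, lintegral_indicator_one hS]
  have e2 : (ρ.withDensity fun p => ENNReal.ofReal (Real.exp (Γ / φmin * stepSize N t p.2))) S =
      ∫⁻ p, ENNReal.ofReal (Real.exp (Γ / φmin * stepSize N t p.2)) * f p ∂ρ := by
    rw [withDensity_apply _ hS, ← lintegral_indicator hS]
    congr 1 with p
    by_cases hp : p ∈ S <;> simp [f, hp]
  have hwf : AEMeasurable (fun p => ENNReal.ofReal (Real.exp (Γ / φmin * stepSize N t p.2)) * f p)
      (κ.prod (volume.restrict (Ioo 0 T))) := (hwm.mul hf).aemeasurable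
  rw [e1, e2, hρ, lintegral_prod_symm _ (hρ ▸ hf.comp_aemeasurable hΘ), lintegral_prod_symm _ hwf]
  refine lintegral_mono_ae ?_
  filter_upwards [ht.ae_exists_mem] with s ⟨n, hn, hs⟩
  have h1 : ∀ x, f (Θ (x, s)) = f (flow (M n) φ (V n) T (τ n s) x, s) := fun x => by
    rw [show Θ (x, s) = _ from ht.stepMap_eq (p := (x, s)) hn hs]
  have hτs := hτ.mem_Icc ht hn hs
  have hfs : Measurable fun x => f (x, s) := hf.comp measurable_prodMk_right
  simp only [h1, ht.stepSize_eq hn hs]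
  rw [← lintegral_map' (f := fun x => f (x, s)) hfs.aemeasurable
      (((hF n hn).aemeasurable hτs).mono_ac (withDensity_absolutelyContinuous _ _)),
    lintegral_const_mul _ hfs]
  refine (lintegral_mono' ((hF n hn).map_le _ hτs) le_rfl).trans ?_
  rw [lintegral_smul_measure, smul_eq_mul]
  refine mul_le_mul_left (ENNReal.ofReal_le_ofReal (Real.exp_le_exp.2 ?_)) _
  exact mul_le_mul_of_nonneg_left (hτ.mem n hn s hs).2 (div_nonneg hΓ hmin.le)

theorem stepMap_left_inv (ht : IsTimeGrid T N t) (hτ : IsElapsed N t τ)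
    (hF : ∀ n < N, RegularFlow (M n) φ φmin φmax Γ (V n) T) {V' : ℕ → Pt d → Pt d}
    (hV' : ∀ n x, V' n x = -V n x)
    (hF' : ∀ n < N, RegularFlow (M n) φ φmin φmax Γ (V' n) T)
    (hac : (spaceTime Ω T).map (stepMap N t (fun n => flow (M n) φ (V n) T) τ) ≪ spaceTime Ω T) :
    ∀ᵐ p ∂spaceTime Ω T, stepMap N t (fun n => flow (M n) φ (V' n) T) τ
      (stepMap N t (fun n => flow (M n) φ (V n) T) τ p) = p := by
  have h1 : ∀ᵐ x ∂volume.restrict Ω, ∀ n ∈ Finset.range N, ∀ a ≤ T, ∀ γ : ℝ → Pt d, γ 0 = x →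
      IsForwardLine (M n).inside ((M n).field φ φmin (V' n)) a γ →
        EqOn (fun t => flow (M n) φ (V' n) T t x) γ (Icc 0 a) :=
    (Finset.eventually_all _).2 fun n hn => (hF' n (Finset.mem_range.1 hn)).unique
  have h2 := ae_of_ae_map (aemeasurable_stepMap ht hτ hF)
    (hac.ae_le (Measure.quasiMeasurePreserving_fst.ae h1))
  filter_upwards [h2, ht.ae_spaceTime fun n hn => (hF n hn).line.and (hF n hn).start]
    with p hp ⟨n, hn, hs, hl, h0⟩
  rw [ht.stepMap_eq hn hs] at hp ⊢
  rw [ht.stepMap_eq hn (p := (flow (M n) φ (V n) T (τ n p.2) p.1, p.2)) hs]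
  have hτs := hτ.mem_Icc ht hn hs
  have hneg : ∀ x, (M n).field φ φmin (V' n) x = -(M n).field φ φmin (V n) x := fun x => by
    rw [show V' n = fun x => -V n x from funext (hV' n), PolytopalMesh.field_neg]
  have := hp n (Finset.mem_range.2 hn) (τ n p.2) hτs.2 _ (by simp)
    (hl.reverse hτs.2 hneg) ⟨hτs.1, le_rfl⟩
  simp only [sub_self, h0] at this
  simp only [this]

theorem volume_lt_top (M : PolytopalMesh Ω) : volume Ω < ⊤ :=
  ((PolytopalMesh.isBounded_inside (M := M)).closure.subset
    PolytopalMesh.subset_closure_inside).measure_lt_top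

theorem isTransportPair_stepMap (ht : IsTimeGrid T N t) (hτ : IsElapsed N t τ)
    (hmin : 0 < φmin) (hΓ : 0 ≤ Γ) (hφm : AEMeasurable φ (volume.restrict Ω))
    (hφ : ∀ x ∈ Ω, φmin ≤ φ x ∧ φ x ≤ φmax) (hΩ : MeasurableSet Ω)
    (hF : ∀ n < N, RegularFlow (M n) φ φmin φmax Γ (V n) T) {V' : ℕ → Pt d → Pt d}
    (hV' : ∀ n x, V' n x = -V n x)
    (hF' : ∀ n < N, RegularFlow (M n) φ φmin φmax Γ (V' n) T) :
    IsTransportPair (spaceTime Ω T) (fun p => φ p.1)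
      (fun p => Real.exp (Γ / φmin * stepSize N t p.2))
      (stepMap N t (fun n => flow (M n) φ (V n) T) τ)
      (stepMap N t (fun n => flow (M n) φ (V' n) T) τ) := by
  have hρ : spaceTime Ω T ≪ (spaceTime Ω T).withDensity fun p => ENNReal.ofReal (φ p.1) := by
    refine withDensity_absolutelyContinuous'
      (hφm.comp_quasiMeasurePreserving Measure.quasiMeasurePreserving_fst).ennreal_ofReal ?_
    refine Measure.quasiMeasurePreserving_fst.ae (p := fun x => ENNReal.ofReal (φ x) ≠ 0) ?_
    filter_upwards [ae_restrict_mem hΩ] with x hx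
    simpa using hmin.trans_le (hφ x hx).1
  have hac : ∀ V : ℕ → Pt d → Pt d, (∀ n < N, RegularFlow (M n) φ φmin φmax Γ (V n) T) →
      (spaceTime Ω T).map (stepMap N t (fun n => flow (M n) φ (V n) T) τ) ≪ spaceTime Ω T := by
    intro V hF
    have h1 := (Measure.absolutelyContinuous_of_le
      (map_stepMap_le ht hτ hmin hΓ hφm hF)).trans ((withDensity_absolutelyContinuous _ _).trans
        (withDensity_absolutelyContinuous _ _))
    have hΘ := aemeasurable_stepMap ht hτ hF
    refine Measure.AbsolutelyContinuous.mk fun S hS h0 => ?_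
    have h2 := h1 h0
    rw [Measure.map_apply_of_aemeasurable
      (hΘ.mono_ac (withDensity_absolutelyContinuous _ _)) hS] at h2
    rw [Measure.map_apply_of_aemeasurable hΘ hS]
    exact hρ h2
  exact ⟨aemeasurable_stepMap ht hτ hF, aemeasurable_stepMap ht hτ hF',
    map_stepMap_le ht hτ hmin hΓ hφm hF, map_stepMap_le ht hτ hmin hΓ hφm hF',
    stepMap_left_inv ht hτ hF hV' hF' (hac V hF),
    stepMap_left_inv ht hτ hF' (fun n x => by rw [hV', neg_neg]) hF (hac V' hF'),
    ae_of_all _ fun p => rfl, ae_of_all _ fun p => rfl⟩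

theorem aestronglyMeasurable_globalVelocity
    (hV : ∀ n < N, AEStronglyMeasurable (V n) (volume.restrict Ω)) :
    AEStronglyMeasurable (globalVelocity N t V) (spaceTime Ω T) := by
  refine Finset.aestronglyMeasurable_fun_sum _ fun n hn => ?_
  have e : (fun p : Pt d × ℝ => (Ioc (t n) (t (n + 1))).indicator (fun _ => V n p.1) p.2) =
      (Prod.snd ⁻¹' Ioc (t n) (t (n + 1))).indicator fun p => V n p.1 := by
    ext1 p; by_cases hp : p.2 ∈ Ioc (t n) (t (n + 1))
    · rw [indicator_of_mem hp, indicator_of_mem (by exact hp)]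
    · rw [indicator_of_notMem hp, indicator_of_notMem (by exact hp)]
  rw [e]
  exact ((hV n (Finset.mem_range.1 hn)).comp_quasiMeasurePreserving
    Measure.quasiMeasurePreserving_fst).indicator (measurable_snd measurableSet_Ioc)

theorem lintegral_edist_stepMap_le (ht : IsTimeGrid T N t) (hτ : IsElapsed N t τ)
    (hF : ∀ n < N, RegularFlow (M n) φ φmin φmax Γ (V n) T)
    (hV : ∀ n < N, AEStronglyMeasurable (V n) (volume.restrict Ω)) :
    ∫⁻ p, edist (stepMap N t (fun n => flow (M n) φ (V n) T) τ p) p ∂spaceTime Ω T ≤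
      ENNReal.ofReal (maxStep N t) *
        (ENNReal.ofReal (φmin⁻¹ * Real.exp (Γ / φmin * T) * φmax) * (ENNReal.ofReal φmin⁻¹ *
          ∫⁻ p, ‖globalVelocity N t V p‖ₑ ∂spaceTime Ω T)) := by
  have hgm := aestronglyMeasurable_globalVelocity (T := T) (t := t) hV
  have hΘ := aemeasurable_stepMap ht hτ hF
  have hed : AEMeasurable (fun p => edist (stepMap N t (fun n => flow (M n) φ (V n) T) τ p) p)
      (spaceTime Ω T) := hΘ.edist aemeasurable_id
  rw [lintegral_prod_symm _ hed, lintegral_prod_symm _ hgm.enorm,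
    ← lintegral_const_mul' _ _ ENNReal.ofReal_ne_top,
    ← lintegral_const_mul' _ _ ENNReal.ofReal_ne_top,
    ← lintegral_const_mul' _ _ ENNReal.ofReal_ne_top]
  refine lintegral_mono_ae ?_
  filter_upwards [ht.ae_exists_mem] with s ⟨n, hn, hs⟩
  have h1 : ∀ x, edist (stepMap N t (fun n => flow (M n) φ (V n) T) τ (x, s)) (x, s) =
      ‖flow (M n) φ (V n) T (τ n s) x - x‖ₑ := fun x => by
    rw [ht.stepMap_eq (p := (x, s)) hn hs, Prod.edist_eq, edist_self,
      max_eq_left (zero_le), edist_eq_enorm_sub]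
  have h2 : ∀ x, globalVelocity N t V (x, s) = V n x := fun x =>
    ht.sum_indicator (fun _ => subset_rfl) hn (Ioo_subset_Ioc_self hs) fun n _ => V n x
  simp only [h1, h2]
  refine ((hF n hn).displacement _ (hτ.mem_Icc ht hn hs)).trans ?_
  refine mul_le_mul_left (ENNReal.ofReal_le_ofReal ?_) _
  exact (hτ.mem n hn s hs).2.trans (IsTimeGrid.step_le_maxStep hn)

end StepMap


/-! ### Convergence of composition operators -/

section Convergence

/-- Composition operators converge strongly to the identity if the maps converge to the identity
in the mean. -/
theorem tendsto_compOperator {α : Type*} [MetricSpace α] [ProperSpace α] [MeasurableSpace α]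
    [BorelSpace α] [SecondCountableTopology α] {ν : Measure α} [IsFiniteMeasure ν] [ν.Regular]
    {Θ : ℕ → α → α} (hΘ : ∀ m, AEMeasurable (Θ m) ν)
    {A : ℕ → Lp ℝ 2 ν →L[ℝ] Lp ℝ 2 ν}
    (hA : ∀ m (f : α → ℝ) (hf : MemLp f 2 ν), A m (hf.toLp f) =ᵐ[ν] fun x => f (Θ m x))
    {K : ℝ} (hK : ∀ m ψ, ‖A m ψ‖ ≤ K * ‖ψ‖)
    (hd : Tendsto (fun m => ∫⁻ x, edist (Θ m x) x ∂ν) atTop (𝓝 0)) (ψ : Lp ℝ 2 ν) :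
    Tendsto (fun m => A m ψ) atTop (𝓝 ψ) := by
  have hmeas : TendstoInMeasure ν Θ atTop id := by
    refine tendstoInMeasure_of_ne_top fun ε hε hε' => ?_
    have h1 := ENNReal.Tendsto.div_const hd (b := ε) (Or.inr hε.ne')
    rw [ENNReal.zero_div] at h1
    exact tendsto_of_tendsto_of_tendsto_of_le_of_le tendsto_const_nhds h1 (fun _ => zero_le)
      fun m => meas_ge_le_lintegral_div ((hΘ m).edist aemeasurable_id) hε.ne' hε'
  have hcont : ∀ (g : α → ℝ) (hg : MemLp g 2 ν), Continuous g → HasCompactSupport g →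
      Tendsto (fun m => A m (hg.toLp g)) atTop (𝓝 (hg.toLp g)) := by
    intro g hg hgc hgs
    obtain ⟨b, hb⟩ := hgs.exists_bound_of_continuous hgc
    refine tendsto_of_subseq_tendsto fun ns hns => ?_
    have hmeas' : TendstoInMeasure ν (fun i => Θ (ns i)) atTop id :=
      fun ε hε => (hmeas ε hε).comp hns
    obtain ⟨ms, -, hms⟩ := hmeas'.exists_seq_tendsto_ae
    refine ⟨ms, ?_⟩
    rw [tendsto_iff_norm_sub_tendsto_zero]
    have h1 : ∀ m, ‖A m (hg.toLp g) - hg.toLp g‖ =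
        ((∫⁻ x, ‖g (Θ m x) - g x‖ₑ ^ (2 : ℝ) ∂ν) ^ (1 / 2 : ℝ)).toReal := by
      intro m
      rw [Lp.norm_def, eLpNorm_eq_lintegral_rpow_enorm_toReal (by norm_num) (by norm_num)]
      simp only [ENNReal.toReal_ofNat]
      congr 2
      refine lintegral_congr_ae ?_
      filter_upwards [Lp.coeFn_sub (A m (hg.toLp g)) (hg.toLp g), hA m g hg, hg.coeFn_toLp]
        with x h1 h2 h3
      rw [h1, Pi.sub_apply, h2, h3]
    simp only [h1]
    have h2 : Tendsto (fun i => ∫⁻ x, ‖g (Θ (ns (ms i)) x) - g x‖ₑ ^ (2 : ℝ) ∂ν) atTop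
        (𝓝 (∫⁻ _, 0 ∂ν)) := by
      refine tendsto_lintegral_of_dominated_convergence'
        (fun _ => ENNReal.ofReal (b + b) ^ (2 : ℝ)) (fun i => ?_) (fun i => ae_of_all _ fun x => ?_)
        ?_ ?_
      · exact (((hgc.measurable.comp_aemeasurable (hΘ _)).sub hgc.measurable.aemeasurable).enorm).pow_const _
      · refine ENNReal.rpow_le_rpow ?_ (by norm_num)
        rw [← ofReal_norm]
        exact ENNReal.ofReal_le_ofReal ((norm_sub_le _ _).trans (add_le_add (hb _) (hb _)))
      · rw [lintegral_const]
        exact ENNReal.mul_ne_top (ENNReal.rpow_ne_top_of_nonneg (by norm_num) ENNReal.ofReal_ne_top)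
          (measure_ne_top _ _)
      · filter_upwards [hms] with x hx
        have h3 : Tendsto (fun i => g (Θ (ns (ms i)) x) - g x) atTop (𝓝 0) := by
          have := ((hgc.tendsto _).comp hx).sub_const (g x)
          simpa using this
        have h4 := (ENNReal.continuous_rpow_const (y := (2 : ℝ))).tendsto _ |>.comp h3.enorm
        simpa [Function.comp_def] using h4
    rw [lintegral_zero] at h2
    have h5 := (ENNReal.continuous_rpow_const (y := (1 / 2 : ℝ))).tendsto _ |>.comp h2
    have h6 := (ENNReal.tendsto_toReal (by simp)).comp h5
    simpa [Function.comp_def] using h6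
  have hK0 : 0 ≤ |K| := abs_nonneg K
  rw [Metric.tendsto_atTop]
  intro ε hε
  set η := ε / (2 * (|K| + 1)) with hη
  have hη0 : 0 < η := by positivity
  obtain ⟨g, hgs, hge, hgc, hg⟩ := (Lp.memLp ψ).exists_hasCompactSupport_eLpNorm_sub_le
    (by norm_num) (ε := ENNReal.ofReal η) (by simpa using hη0)
  have h1 : ‖ψ - hg.toLp g‖ ≤ η := by
    rw [Lp.norm_def]
    refine ENNReal.toReal_le_of_le_ofReal hη0.le (le_trans (le_of_eq (eLpNorm_congr_ae ?_)) hge)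
    filter_upwards [Lp.coeFn_sub ψ (hg.toLp g), hg.coeFn_toLp] with x h1 h2
    rw [h1, Pi.sub_apply, h2, Pi.sub_apply]
  obtain ⟨m₀, hm₀⟩ := Metric.tendsto_atTop.1 (hcont g hg hgc hgs) (ε / 2) (half_pos hε)
  refine ⟨m₀, fun m hm => ?_⟩
  have h2 := hm₀ m hm
  rw [dist_eq_norm] at h2 ⊢
  have e : A m ψ - ψ = A m (ψ - hg.toLp g) + (A m (hg.toLp g) - hg.toLp g) -
      (ψ - hg.toLp g) := by rw [map_sub]; abel
  have h3 : ‖A m (ψ - hg.toLp g)‖ ≤ |K| * η := (hK m _).trans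
    (mul_le_mul (le_abs_self K) h1 (norm_nonneg _) hK0)
  have h4 : |K| * η + η = ε / 2 := by rw [hη]; field_simp
  rw [e]
  refine (norm_sub_le _ _).trans_lt ?_
  have := norm_add_le (A m (ψ - hg.toLp g)) (A m (hg.toLp g) - hg.toLp g)
  linarith

variable {H : Type*} [NormedAddCommGroup H] [InnerProductSpace ℝ H] [CompleteSpace H]

theorem tendsto_apply_of_tendsto {A : ℕ → H →L[ℝ] H} {K : ℝ} (hK : ∀ m ψ, ‖A m ψ‖ ≤ K * ‖ψ‖)
    (hA : ∀ ψ, Tendsto (fun m => A m ψ) atTop (𝓝 ψ)) {f : ℕ → H} {f₀ : H}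
    (hf : Tendsto f atTop (𝓝 f₀)) : Tendsto (fun m => A m (f m)) atTop (𝓝 f₀) := by
  have h1 : Tendsto (fun m => A m (f m - f₀)) atTop (𝓝 0) := by
    refine squeeze_zero_norm (fun m => hK m _) ?_
    have := (tendsto_iff_norm_sub_tendsto_zero.1 hf).const_mul K
    simpa using this
  have := h1.add (hA f₀)
  simpa using this

/-- Operators whose adjoints converge strongly to the identity preserve weak limits. -/
theorem tendsto_inner_apply_of_adjoint {A : ℕ → H →L[ℝ] H}
    (hA : ∀ ψ, Tendsto (fun m => ContinuousLinearMap.adjoint (A m) ψ) atTop (𝓝 ψ)) {f : ℕ → H}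
    {f₀ : H} (hf : ∀ g, Tendsto (fun m => inner ℝ (f m) g) atTop (𝓝 (inner ℝ f₀ g))) (g : H) :
    Tendsto (fun m => inner ℝ (A m (f m)) g) atTop (𝓝 (inner ℝ f₀ g)) := by
  obtain ⟨C, hC⟩ : ∃ C, ∀ m, ‖innerSL ℝ (f m)‖ ≤ C := by
    refine banach_steinhaus fun x => ?_
    obtain ⟨C, hC⟩ := ((hf x).norm).bddAbove_range
    exact ⟨C, fun m => hC ⟨m, rfl⟩⟩
  have h1 : Tendsto (fun m => inner ℝ (f m) (ContinuousLinearMap.adjoint (A m) g - g)) atTop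
      (𝓝 0) := by
    refine squeeze_zero_norm (fun m => ?_) (a := fun m => C * ‖ContinuousLinearMap.adjoint (A m) g - g‖) ?_
    · refine (norm_inner_le_norm _ _).trans (mul_le_mul_of_nonneg_right ?_ (norm_nonneg _))
      simpa using hC m
    · have := (tendsto_iff_norm_sub_tendsto_zero.1 (hA g)).const_mul C
      simpa using this
  have := h1.add (hf g)
  simpa [inner_sub_right, ContinuousLinearMap.adjoint_inner_right] using this

/-- The adjoint operators converge strongly to the identity. -/
theorem tendsto_adjoint {α : Type*} [MeasurableSpace α] {ν : Measure α} {φ : α → ℝ}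
    {φmin φmax K : ℝ} (hmin : 0 < φmin) (hφm : AEMeasurable φ ν)
    (hφ : ∀ᵐ x ∂ν, φmin ≤ φ x ∧ φ x ≤ φmax) {Θ' : ℕ → α → α} {A A' : ℕ → Lp ℝ 2 ν →L[ℝ] Lp ℝ 2 ν}
    (hA' : ∀ m (f : α → ℝ) (hf : MemLp f 2 ν), A' m (hf.toLp f) =ᵐ[ν] fun x => f (Θ' m x))
    (hK : ∀ m ψ, ‖A' m ψ‖ ≤ K * ‖ψ‖) (hA'1 : ∀ ψ, Tendsto (fun m => A' m ψ) atTop (𝓝 ψ))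
    {R : ℕ → α → ℝ} {r : ℕ → ℝ} (hr0 : ∀ m, 0 ≤ r m) (hr : Tendsto r atTop (𝓝 0))
    (hR : ∀ m, ∀ᵐ x ∂ν, |R m x| ≤ r m)
    (hadj : ∀ m (g : α → ℝ) (hg : MemLp g 2 ν), ContinuousLinearMap.adjoint (A m) (hg.toLp g) =ᵐ[ν]
        fun x => φ x * (g (Θ' m x) / φ (Θ' m x)) + R m x * g (Θ' m x)) (ψ : Lp ℝ 2 ν) :
    Tendsto (fun m => ContinuousLinearMap.adjoint (A m) ψ) atTop (𝓝 ψ) := by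
  have hψ := Lp.memLp ψ
  have hq : MemLp (fun x => ψ x / φ x) 2 ν := by
    refine MemLp.of_le_mul (c := φmin⁻¹) hψ (hψ.1.aemeasurable.div hφm).aestronglyMeasurable ?_
    filter_upwards [hφ] with x hx
    rw [norm_div, Real.norm_of_nonneg (hmin.le.trans hx.1), div_eq_inv_mul]
    exact mul_le_mul_of_nonneg_right (inv_anti₀ hmin hx.1) (norm_nonneg _)
  set h := hq.toLp _
  set φM := max φmax 0
  have key : ∀ m, ‖ContinuousLinearMap.adjoint (A m) ψ - ψ‖ ≤
      φM * ‖A' m h - h‖ + r m * (K * ‖ψ‖) := by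
    intro m
    have e1 := hadj m ψ hψ
    have e2 := hA' m ψ hψ
    rw [Lp.toLp_coeFn] at e1 e2
    set u := A' m h - h with hu
    set v := A' m ψ
    have h1 : ‖ContinuousLinearMap.adjoint (A m) ψ - ψ‖ ≤ ‖φM • |u| + r m • |v|‖ := by
      refine Lp.norm_le_norm_of_ae_le ?_
      filter_upwards [Lp.coeFn_sub (ContinuousLinearMap.adjoint (A m) ψ) ψ, e1, e2,
        hA' m _ hq, hq.coeFn_toLp, Lp.coeFn_sub (A' m h) h, Lp.coeFn_add (φM • |u|) (r m • |v|),
        Lp.coeFn_smul φM |u|, Lp.coeFn_smul (r m) |v|, Lp.coeFn_abs u, Lp.coeFn_abs v, hφ, hR m]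
        with x x1 x2 x3 x4 x5 x6 x7 x8 x9 x10 x11 x12 x13
      have hφx := hmin.trans_le x12.1
      rw [x1, Pi.sub_apply, x2, x7, Pi.add_apply, x8, x9, Pi.smul_apply, Pi.smul_apply, x10, x11,
        hu, x6, Pi.sub_apply, x4, x5, x3, smul_eq_mul, smul_eq_mul]
      have e : φ x * (ψ (Θ' m x) / φ (Θ' m x)) + R m x * ψ (Θ' m x) - ψ x =
          φ x * (ψ (Θ' m x) / φ (Θ' m x) - ψ x / φ x) + R m x * ψ (Θ' m x) := by
        field_simp; ring
      rw [e]
      refine le_trans ?_ (le_abs_self _)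
      refine (norm_add_le _ _).trans ?_
      rw [norm_mul, norm_mul, Real.norm_eq_abs, Real.norm_eq_abs, Real.norm_eq_abs,
        Real.norm_eq_abs]
      refine add_le_add (mul_le_mul_of_nonneg_right ?_ (abs_nonneg _))
        (mul_le_mul_of_nonneg_right x13 (abs_nonneg _))
      rw [abs_of_pos hφx]
      exact x12.2.trans (le_max_left _ _)
    refine h1.trans ((norm_add_le _ _).trans ?_)
    rw [norm_smul, norm_smul, norm_abs_eq_norm, norm_abs_eq_norm, Real.norm_of_nonneg (hr0 m),
      Real.norm_of_nonneg (le_max_right _ _)]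
    exact add_le_add le_rfl (mul_le_mul_of_nonneg_left (hK m ψ) (hr0 m))
  rw [tendsto_iff_norm_sub_tendsto_zero]
  refine squeeze_zero (fun m => norm_nonneg _) key ?_
  have h1 := ((tendsto_iff_norm_sub_tendsto_zero.1 (hA'1 h)).const_mul φM).add
    (hr.mul_const (K * ‖ψ‖))
  simpa using h1

end Convergence


/-! ### The transport operators -/

section TransportOperators

variable {d : ℕ} {Ω : Set (Pt d)} {T : ℝ} {φ : Pt d → ℝ} {φmin φmax Γ : ℝ}

theorem IsAdmissible.aemeasurable_porosity {M : PolytopalMesh Ω} {V : Pt d → Pt d}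
    (hA : IsAdmissible M φ φmin φmax V Γ) (hmin : 0 < φmin) (hΩ : Ω.Nonempty) :
    AEMeasurable φ (volume.restrict Ω) := by
  obtain ⟨C, B, D⟩ := hA.exists_fieldData hmin hΩ
  have h1 : AEMeasurable (M.extendPorosity φ φmin) (volume.restrict Ω) :=
    D.phi_meas.aemeasurable.restrict
  refine h1.congr ?_
  rw [← PolytopalMesh.restrict_inside (M := M)]
  filter_upwards [ae_restrict_mem PolytopalMesh.isOpen_inside.measurableSet] with x hx
  exact M.extendPorosity_of_mem hx

theorem globalVelocity_neg (N : ℕ) (t : ℕ → ℝ) (V : ℕ → Pt d → Pt d) (p : Pt d × ℝ) :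
    globalVelocity N t (fun n x => -V n x) p = -globalVelocity N t V p := by
  simp only [globalVelocity, ← Finset.sum_neg_distrib]
  refine Finset.sum_congr rfl fun n _ => ?_
  by_cases h : p.2 ∈ Ioc (t n) (t (n + 1))
  · rw [indicator_of_mem h, indicator_of_mem h]
  · rw [indicator_of_notMem h, indicator_of_notMem h, neg_zero]

theorem exp_sub_one_le {y : ℝ} : Real.exp y - 1 ≤ y * Real.exp y := by
  have h1 := Real.add_one_le_exp (-y)
  have h2 : Real.exp (-y) * Real.exp y = 1 := by rw [← Real.exp_add]; simp
  nlinarith [Real.exp_pos y]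

/-- The factor in the bound of the remainder. -/
theorem weight_le {δ : ℝ} (hmin : 0 < φmin) (hle : φmin ≤ φmax) (hΓ : 0 ≤ Γ) (hδ0 : 0 ≤ δ)
    (hδT : δ ≤ T) : (Real.exp (Γ / φmin * δ) - 1) * (φmax / φmin) ≤
      δ * φmin⁻¹ * Γ * jacobianBound φmin φmax Γ T := by
  have hc : 0 ≤ Γ / φmin := div_nonneg hΓ hmin.le
  have hq : 0 ≤ φmax / φmin := div_nonneg (hmin.le.trans hle) hmin.le
  have h1 : Real.exp (Γ / φmin * δ) - 1 ≤ Γ / φmin * δ * Real.exp (Γ / φmin * |T|) := by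
    refine exp_sub_one_le.trans (mul_le_mul_of_nonneg_left (Real.exp_le_exp.2 ?_)
      (mul_nonneg hc hδ0))
    exact mul_le_mul_of_nonneg_left (hδT.trans (le_abs_self T)) hc
  refine (mul_le_mul_of_nonneg_right h1 hq).trans_eq ?_
  rw [jacobianBound]
  ring

theorem IsTimeGrid.eq_of_mem {N : ℕ} {t : ℕ → ℝ} (ht : IsTimeGrid T N t) {n k : ℕ} (hn : n < N)
    (hk : k < N) {s : ℝ} (hs : s ∈ Icc (t n) (t (n + 1))) (hs' : s ∈ Ioo (t k) (t (k + 1))) :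
    n = k := by
  by_contra hne
  rcases lt_or_gt_of_ne hne with h | h
  · linarith [ht.mono (show n + 1 ≤ k from h) hk.le, hs.2, hs'.1]
  · linarith [ht.mono (show k + 1 ≤ n from h) hn.le, hs.1, hs'.2]

theorem maxStep_nonneg {N : ℕ} {t : ℕ → ℝ} (ht : IsTimeGrid T N t) : 0 ≤ maxStep N t :=
  Real.iSup_nonneg fun n => (sub_pos.2 (ht.lt n n.2)).le

theorem isFiniteMeasure_spaceTime (hΩ : volume Ω < ⊤) (T : ℝ) :
    IsFiniteMeasure (spaceTime Ω T) := by
  have : IsFiniteMeasure (volume.restrict Ω) := ⟨by rwa [Measure.restrict_apply_univ]⟩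
  infer_instance

theorem tendsto_lintegral_edist_stepMap (hΩ : volume Ω < ⊤) {N : ℕ → ℕ} {t : ℕ → ℕ → ℝ}
    (ht : ∀ m, IsTimeGrid T (N m) (t m)) {M : ℕ → ℕ → PolytopalMesh Ω} {V : ℕ → ℕ → Pt d → Pt d}
    {τ : ℕ → ℕ → ℝ → ℝ} (hτ : ∀ m, IsElapsed (N m) (t m) (τ m))
    (hF : ∀ m, ∀ n < N m, RegularFlow (M m n) φ φmin φmax Γ (V m n) T)
    (hV : ∀ m, ∀ n < N m, AEStronglyMeasurable (V m n) (volume.restrict Ω))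
    (hstep : Tendsto (fun m => maxStep (N m) (t m)) atTop (𝓝 0)) {B : ℝ≥0}
    (hB : ∀ m, eLpNorm (globalVelocity (N m) (t m) (V m)) 2 (spaceTime Ω T) ≤ B) :
    Tendsto (fun m => ∫⁻ p, edist (stepMap (N m) (t m)
      (fun n => flow (M m n) φ (V m n) T) (τ m) p) p ∂spaceTime Ω T) atTop (𝓝 0) := by
  have := isFiniteMeasure_spaceTime hΩ T
  have h1 : ∀ m, ∫⁻ p, ‖globalVelocity (N m) (t m) (V m) p‖ₑ ∂spaceTime Ω T ≤
      B * spaceTime Ω T univ ^ (1 / 2 : ℝ) := by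
    intro m
    rw [← eLpNorm_one_eq_lintegral_enorm]
    refine (eLpNorm_le_eLpNorm_mul_rpow_measure_univ (q := 2) (by norm_num)
      (aestronglyMeasurable_globalVelocity (hV m))).trans ?_
    have e : (1 / (1 : ℝ≥0∞).toReal - 1 / (2 : ℝ≥0∞).toReal) = 1 / 2 := by
      rw [ENNReal.toReal_one, ENNReal.toReal_ofNat]; norm_num
    rw [e]
    exact mul_le_mul_left (hB m) _
  have h2 : Tendsto (fun m => ENNReal.ofReal (maxStep (N m) (t m)) *
      (ENNReal.ofReal (φmin⁻¹ * Real.exp (Γ / φmin * T) * φmax) * (ENNReal.ofReal φmin⁻¹ *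
        (B * spaceTime Ω T univ ^ (1 / 2 : ℝ))))) atTop (𝓝 0) := by
    have h3 := ENNReal.tendsto_ofReal hstep
    rw [ENNReal.ofReal_zero] at h3
    have h4 := ENNReal.Tendsto.mul_const (b := ENNReal.ofReal (φmin⁻¹ * Real.exp (Γ / φmin * T) *
      φmax) * (ENNReal.ofReal φmin⁻¹ * (B * spaceTime Ω T univ ^ (1 / 2 : ℝ)))) h3 (Or.inr ?_)
    · rwa [zero_mul] at h4
    · exact ENNReal.mul_ne_top ENNReal.ofReal_ne_top (ENNReal.mul_ne_top ENNReal.ofReal_ne_top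
        (ENNReal.mul_ne_top ENNReal.coe_ne_top
          (ENNReal.rpow_ne_top_of_nonneg (by norm_num) (measure_ne_top _ _))))
  refine tendsto_of_tendsto_of_tendsto_of_le_of_le tendsto_const_nhds h2 (fun _ => zero_le)
    fun m => (lintegral_edist_stepMap_le (ht m) (hτ m) (hF m) (hV m)).trans ?_
  have := h1 m
  gcongr

/-- The transport operators for the elapsed times `τ`. -/
theorem exists_transportOperator (hΩ : Ω.Nonempty) (hT : 0 < T) (hmin : 0 < φmin) {N : ℕ → ℕ}
    {t : ℕ → ℕ → ℝ} (ht : ∀ m, IsTimeGrid T (N m) (t m)) {M : ℕ → ℕ → PolytopalMesh Ω}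
    {V : ℕ → ℕ → Pt d → Pt d} (hV : ∀ m, ∀ n < N m, IsAdmissible (M m n) φ φmin φmax (V m n) Γ)
    (hstep : Tendsto (fun m => maxStep (N m) (t m)) atTop (𝓝 0))
    (hbdd : ∃ B : ℝ≥0, ∀ m, eLpNorm (globalVelocity (N m) (t m) (V m)) 2 (spaceTime Ω T) ≤ B)
    {τ : ℕ → ℕ → ℝ → ℝ} (hτ : ∀ m, IsElapsed (N m) (t m) (τ m)) :
    ∃ (A : ℕ → (L2 Ω T →L[ℝ] L2 Ω T)) (C : ℝ),
      (∀ m, IsInducedBy (A m) fun ψ p =>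
        ψ (stepMap (N m) (t m) (fun n => flow (M m n) φ (V m n) T) (τ m) p)) ∧
      (∀ m ψ, ‖A m ψ‖ ≤ C * ‖ψ‖) ∧
      (∀ m, ∃ R : Pt d × ℝ → ℝ, MemLp R ⊤ (spaceTime Ω T) ∧
        (∀ n < N m, ∀ᵐ p ∂spaceTime Ω T, p.2 ∈ Icc (t m n) (t m (n + 1)) →
          |R p| ≤ (t m (n + 1) - t m n) * φmin⁻¹ * Γ * jacobianBound φmin φmax Γ T) ∧
        IsInducedBy (ContinuousLinearMap.adjoint (A m)) (fun ψ p => φ p.1 *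
          (ψ (stepMap (N m) (t m) (fun n => flow (M m n) φ (fun x => -V m n x) T) (τ m) p) /
            φ (stepMap (N m) (t m) (fun n => flow (M m n) φ (fun x => -V m n x) T) (τ m) p).1) +
          R p * ψ (stepMap (N m) (t m) (fun n => flow (M m n) φ (fun x => -V m n x) T) (τ m) p))) ∧
      (∀ (f : ℕ → L2 Ω T) (f₀ : L2 Ω T), Tendsto f atTop (𝓝 f₀) →
        Tendsto (fun m => A m (f m)) atTop (𝓝 f₀)) ∧
      (∀ (f : ℕ → L2 Ω T) (f₀ : L2 Ω T), WeaklyTendsto f f₀ →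
        WeaklyTendsto (fun m => A m (f m)) f₀) := by
  have hN : ∀ m, 0 < N m := fun m => Nat.pos_of_ne_zero fun h0 => by
    have h1 := (ht m).last
    rw [h0, (ht m).zero] at h1
    exact hT.ne h1
  have hA₀ := hV 0 0 (hN 0)
  have hle := hA₀.le hΩ
  have hΓ := hA₀.gamma_nonneg hΩ
  have hφm := hA₀.aemeasurable_porosity hmin hΩ
  have hφ := hA₀.phi_bounds
  have hΩm : MeasurableSet Ω := (M 0 0).isOpen_domain.measurableSet
  have hΩv : volume Ω < ⊤ := volume_lt_top (M 0 0)
  have := isFiniteMeasure_spaceTime hΩv T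
  have hF : ∀ m, ∀ n < N m, RegularFlow (M m n) φ φmin φmax Γ (V m n) T := fun m n hn =>
    (hV m n hn).regularFlow hmin hΩ hT.le
  have hF' : ∀ m, ∀ n < N m, RegularFlow (M m n) φ φmin φmax Γ (fun x => -V m n x) T :=
    fun m n hn => (hV m n hn).neg.regularFlow hmin hΩ hT.le
  have hVm : ∀ m, ∀ n < N m, AEStronglyMeasurable (V m n) (volume.restrict Ω) := fun m n hn => by
    obtain ⟨g, hg, -⟩ := (hV m n hn).hdiv
    exact hg.memLp.1
  obtain ⟨B, hB⟩ := hbdd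
  have hB' : ∀ m, eLpNorm (globalVelocity (N m) (t m) fun n x => -V m n x) 2 (spaceTime Ω T) ≤ B :=
    fun m => by
      rw [show (globalVelocity (N m) (t m) fun n x => -V m n x) =
        -globalVelocity (N m) (t m) (V m) from funext (globalVelocity_neg _ _ _), eLpNorm_neg]
      exact hB m
  set Θ : ℕ → Pt d × ℝ → Pt d × ℝ := fun m =>
    stepMap (N m) (t m) (fun n => flow (M m n) φ (V m n) T) (τ m)
  set Θ' : ℕ → Pt d × ℝ → Pt d × ℝ := fun m =>
    stepMap (N m) (t m) (fun n => flow (M m n) φ (fun x => -V m n x) T) (τ m)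
  set w : ℕ → Pt d × ℝ → ℝ := fun m p => Real.exp (Γ / φmin * stepSize (N m) (t m) p.2)
  set W : ℝ := Real.exp (Γ / φmin * T)
  have hc : 0 ≤ Γ / φmin := div_nonneg hΓ hmin.le
  have hpair : ∀ m, IsTransportPair (spaceTime Ω T) (fun p => φ p.1) (w m) (Θ m) (Θ' m) := fun m =>
    isTransportPair_stepMap (ht m) (hτ m) hmin hΓ hφm hφ hΩm (hF m) (fun _ _ => rfl) (hF' m)
  have hφm' : AEMeasurable (fun p : Pt d × ℝ => φ p.1) (spaceTime Ω T) :=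
    hφm.comp_quasiMeasurePreserving Measure.quasiMeasurePreserving_fst
  have hφ' : ∀ᵐ p ∂spaceTime Ω T, φmin ≤ φ p.1 ∧ φ p.1 ≤ φmax :=
    Measure.quasiMeasurePreserving_fst.ae
      (p := fun x => φmin ≤ φ x ∧ φ x ≤ φmax) ((ae_restrict_mem hΩm).mono hφ)
  have hw : ∀ m, Measurable (w m) := fun m =>
    Real.measurable_exp.comp ((measurable_stepSize.comp measurable_snd).const_mul _)
  have hw1 : ∀ m p, 1 ≤ w m p := fun m p =>
    Real.one_le_exp (mul_nonneg hc ((ht m).stepSize_mem hT.le p.2).1)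
  have hwW : ∀ m p, w m p ≤ W := fun m p => Real.exp_le_exp.2
    (mul_le_mul_of_nonneg_left ((ht m).stepSize_mem hT.le p.2).2 hc)
  have hop := fun m => exists_compOperator (hpair m).aemeasurable
    ((hpair m).map_le_smul hmin hφ' (hwW m))
  have hop' := fun m => exists_compOperator (hpair m).symm.aemeasurable
    ((hpair m).symm.map_le_smul hmin hφ' (hwW m))
  choose A hA hAC using hop
  choose A' hA' hAC' using hop'
  have hadj := fun m => (hpair m).exists_adjoint hmin hφm' hφ' (hw m) (hw1 m) (hwW m) (hA m)
  choose R hR1 hR2 hR3 using hadj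
  have hRb : ∀ m, ∀ᵐ p ∂spaceTime Ω T, ∃ k < N m, p.2 ∈ Ioo (t m k) (t m (k + 1)) ∧
      |R m p| ≤ (t m (k + 1) - t m k) * φmin⁻¹ * Γ * jacobianBound φmin φmax Γ T := by
    intro m
    filter_upwards [hR2 m, (ht m).ae_spaceTime (P := fun _ _ => True)
      (fun n _ => ae_of_all _ fun _ => trivial)] with p hp ⟨k, hk, hs, _⟩
    refine ⟨k, hk, hs, hp.trans ?_⟩
    simp only [w, (ht m).stepSize_eq hk hs]
    exact weight_le hmin hle hΓ (sub_pos.2 ((ht m).lt k hk)).le ((ht m).step_le hk)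
  have hJ : 0 ≤ jacobianBound φmin φmax Γ T :=
    mul_nonneg (div_nonneg (hmin.le.trans hle) hmin.le) (Real.exp_nonneg _)
  have hκ : 0 ≤ φmin⁻¹ * Γ * jacobianBound φmin φmax Γ T :=
    mul_nonneg (mul_nonneg (inv_nonneg.2 hmin.le) hΓ) hJ
  have hstrong : ∀ ψ, Tendsto (fun m => A m ψ) atTop (𝓝 ψ) :=
    tendsto_compOperator (fun m => (hpair m).aemeasurable) hA hAC
      (tendsto_lintegral_edist_stepMap hΩv ht hτ hF hVm hstep hB)
  have hstrong' : ∀ ψ, Tendsto (fun m => A' m ψ) atTop (𝓝 ψ) :=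
    tendsto_compOperator (fun m => (hpair m).aemeasurable') hA' hAC'
      (tendsto_lintegral_edist_stepMap hΩv ht hτ hF' (fun m n hn => (hVm m n hn).neg) hstep hB')
  have hadj1 : ∀ ψ, Tendsto (fun m => ContinuousLinearMap.adjoint (A m) ψ) atTop (𝓝 ψ) := by
    refine tendsto_adjoint (R := R)
      (r := fun m => maxStep (N m) (t m) * (φmin⁻¹ * Γ * jacobianBound φmin φmax Γ T)) hmin hφm' hφ'
      hA' hAC' hstrong' (fun m => mul_nonneg (maxStep_nonneg (ht m)) hκ) ?_ (fun m => ?_) hR3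
    · simpa using hstep.mul_const (φmin⁻¹ * Γ * jacobianBound φmin φmax Γ T)
    · filter_upwards [hRb m] with p ⟨k, hk, hs, hp⟩
      refine hp.trans ?_
      rw [mul_assoc, mul_assoc, ← mul_assoc φmin⁻¹]
      exact mul_le_mul_of_nonneg_right (IsTimeGrid.step_le_maxStep hk) hκ
  refine ⟨A, _, fun m ψ hψ => hA m ψ hψ, hAC, fun m => ⟨R m, hR1 m, fun n hn => ?_,
    fun ψ hψ => hR3 m ψ hψ⟩, fun f f₀ hf => tendsto_apply_of_tendsto hAC hstrong hf,
    fun f f₀ hf g => tendsto_inner_apply_of_adjoint hadj1 hf g⟩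
  filter_upwards [hRb m] with p ⟨k, hk, hs, hp⟩ hpn
  obtain rfl := (ht m).eq_of_mem hn hk hpn hs
  exact hp

variable {N : ℕ} {t : ℕ → ℝ}

theorem transport_ae_eq (ht : IsTimeGrid T N t) (M : ℕ → PolytopalMesh Ω) (V : ℕ → Pt d → Pt d)
    (ψ : Pt d × ℝ → ℝ) : transport T φ N t M V ψ =ᵐ[spaceTime Ω T]
      fun p => ψ (stepMap N t (fun n => flow (M n) φ (V n) T) (fun n _ => t (n + 1) - t n) p) := by
  filter_upwards [ht.ae_spaceTime (P := fun _ _ => True) fun n _ => ae_of_all _ fun _ => trivial]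
    with p ⟨n, hn, hs, _⟩
  rw [ht.stepMap_eq hn hs, transport, ht.sum_indicator (fun _ => Ioo_subset_Ioc_self) hn hs
    fun n s => ψ (flow (M n) φ (V n) T (t (n + 1) - t n) p.1, s)]

theorem transportHat_ae_eq (ht : IsTimeGrid T N t) (M : ℕ → PolytopalMesh Ω)
    (V : ℕ → Pt d → Pt d) (ψ : Pt d × ℝ → ℝ) : transportHat T φ N t M V ψ =ᵐ[spaceTime Ω T]
      fun p => ψ (stepMap N t (fun n => flow (M n) φ (V n) T) (fun n s => t (n + 1) - s) p) := by
  filter_upwards [ht.ae_spaceTime (P := fun _ _ => True) fun n _ => ae_of_all _ fun _ => trivial]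
    with p ⟨n, hn, hs, _⟩
  rw [ht.stepMap_eq hn hs, transportHat, ht.sum_indicator (fun _ => Ioo_subset_Ioc_self) hn hs
    fun n s => ψ (flow (M n) φ (V n) T (t (n + 1) - s) p.1, s)]

theorem isElapsed_step (ht : IsTimeGrid T N t) : IsElapsed N t fun n _ => t (n + 1) - t n :=
  ⟨fun _ => measurable_const, fun n hn _ _ => ⟨(sub_pos.2 (ht.lt n hn)).le, le_rfl⟩⟩

theorem isElapsed_sub (N : ℕ) (t : ℕ → ℝ) : IsElapsed N t fun n s => t (n + 1) - s :=
  ⟨fun _ => measurable_const.sub measurable_id, fun _ _ _ hs => ⟨by linarith [hs.2], by linarith [hs.1]⟩⟩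

theorem IsInducedBy.congr {A : L2 Ω T →L[ℝ] L2 Ω T} {S S' : (Pt d × ℝ → ℝ) → (Pt d × ℝ → ℝ)}
    (h : IsInducedBy A S) (hS : ∀ ψ, S' ψ =ᵐ[spaceTime Ω T] S ψ) : IsInducedBy A S' :=
  fun ψ hψ => (h ψ hψ).trans (hS ψ).symm

end TransportOperators

theorem lemma5p6 {d : ℕ} (Ω : Set (Pt d)) (T : ℝ) (hT : 0 < T)
    (φ : Pt d → ℝ) (φmin φmax Γ : ℝ) (hφmin : 0 < φmin)
    (N : ℕ → ℕ) (t : ℕ → ℕ → ℝ) (ht : ∀ m, IsTimeGrid T (N m) (t m))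
    (M : ℕ → ℕ → PolytopalMesh Ω) (V : ℕ → ℕ → Pt d → Pt d)
    (hV : ∀ m, ∀ n < N m, IsAdmissible (M m n) φ φmin φmax (V m n) Γ)
    (hstep : Tendsto (fun m => maxStep (N m) (t m)) atTop (𝓝 0))
    (hbdd : ∃ B : ℝ≥0, ∀ m,
      eLpNorm (globalVelocity (N m) (t m) (V m)) 2 (spaceTime Ω T) ≤ B) :
    ∃ A Ahat : ℕ → (L2 Ω T →L[ℝ] L2 Ω T),
      -- `A m` and `Ahat m` are the two transport operators for the velocities `V m`
      (∀ m, IsInducedBy (A m) (transport T φ (N m) (t m) (M m) (V m))) ∧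
      (∀ m, IsInducedBy (Ahat m) (transportHat T φ (N m) (t m) (M m) (V m))) ∧
      -- uniform bound
      (∃ C : ℝ, ∀ m, ∀ ψ : L2 Ω T, ‖A m ψ‖ + ‖Ahat m ψ‖ ≤ C * ‖ψ‖) ∧
      -- dual operators
      (∀ m, ∃ R Rhat : Pt d × ℝ → ℝ,
        MemLp R ∞ (spaceTime Ω T) ∧ MemLp Rhat ∞ (spaceTime Ω T) ∧
        (∀ n < N m, ∀ᵐ p ∂(spaceTime Ω T), p.2 ∈ Icc (t m n) (t m (n + 1)) →
          |R p| ≤ (t m (n + 1) - t m n) * φmin⁻¹ * Γ * jacobianBound φmin φmax Γ T ∧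
          |Rhat p| ≤ (t m (n + 1) - t m n) * φmin⁻¹ * Γ * jacobianBound φmin φmax Γ T) ∧
        IsInducedBy (ContinuousLinearMap.adjoint (A m)) (fun ψ p =>
          φ p.1 * transport T φ (N m) (t m) (M m) (fun n x => -V m n x)
              (fun q => ψ q / φ q.1) p +
            R p * transport T φ (N m) (t m) (M m) (fun n x => -V m n x) ψ p) ∧
        IsInducedBy (ContinuousLinearMap.adjoint (Ahat m)) (fun ψ p =>
          φ p.1 * transportHat T φ (N m) (t m) (M m) (fun n x => -V m n x)
              (fun q => ψ q / φ q.1) p +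
            Rhat p * transportHat T φ (N m) (t m) (M m) (fun n x => -V m n x) ψ p)) ∧
      -- strong convergence
      (∀ (f : ℕ → L2 Ω T) (f₀ : L2 Ω T), Tendsto f atTop (𝓝 f₀) →
        Tendsto (fun m => A m (f m)) atTop (𝓝 f₀) ∧
        Tendsto (fun m => Ahat m (f m)) atTop (𝓝 f₀)) ∧
      -- weak convergence
      (∀ (f : ℕ → L2 Ω T) (f₀ : L2 Ω T), WeaklyTendsto f f₀ →
        WeaklyTendsto (fun m => A m (f m)) f₀ ∧
        WeaklyTendsto (fun m => Ahat m (f m)) f₀) := by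
  rcases Ω.eq_empty_or_nonempty with hΩ | hΩ
  · have h0 : spaceTime Ω T = 0 := by simp [spaceTime, hΩ]
    have hae : ∀ p : Pt d × ℝ → Prop, ∀ᵐ x ∂spaceTime Ω T, p x := fun p => by rw [h0]; simp
    have hsub : ∀ f g : L2 Ω T, f = g := fun f g => Lp.ext (hae _)
    refine ⟨fun _ => 0, fun _ => 0, fun m ψ hψ => hae _, fun m ψ hψ => hae _, ⟨0, fun m ψ => ?_⟩,
      fun m => ⟨0, 0, MemLp.zero, MemLp.zero, fun n _ => hae _, fun ψ hψ => hae _,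
        fun ψ hψ => hae _⟩, fun f f₀ _ => ?_, fun f f₀ _ => ?_⟩
    · simp
    · exact ⟨by rw [hsub f₀ 0]; exact tendsto_const_nhds, by rw [hsub f₀ 0]; exact tendsto_const_nhds⟩
    · constructor <;> intro g <;> rw [hsub f₀ 0] <;> exact tendsto_const_nhds
  obtain ⟨A, C, hA, hAC, hAR, hAs, hAw⟩ := exists_transportOperator hΩ hT hφmin ht hV hstep hbdd
    fun m => isElapsed_step (ht m)
  obtain ⟨A', C', hA', hAC', hAR', hAs', hAw'⟩ := exists_transportOperator hΩ hT hφmin ht hV hstep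
    hbdd fun m => isElapsed_sub (N m) (t m)
  refine ⟨A, A', fun m => (hA m).congr (transport_ae_eq (ht m) _ _),
    fun m => (hA' m).congr (transportHat_ae_eq (ht m) _ _), ⟨C + C', fun m ψ => ?_⟩, fun m => ?_,
    fun f f₀ hf => ⟨hAs f f₀ hf, hAs' f f₀ hf⟩, fun f f₀ hf => ⟨hAw f f₀ hf, hAw' f f₀ hf⟩⟩
  · rw [add_mul]; exact add_le_add (hAC m ψ) (hAC' m ψ)
  · obtain ⟨R, hR1, hR2, hR3⟩ := hAR m
    obtain ⟨R', hR'1, hR'2, hR'3⟩ := hAR' m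
    refine ⟨R, R', hR1, hR'1, fun n hn => ?_, hR3.congr fun ψ => ?_, hR'3.congr fun ψ => ?_⟩
    · filter_upwards [hR2 n hn, hR'2 n hn] with p h1 h2 hp
      exact ⟨h1 hp, h2 hp⟩
    · filter_upwards [transport_ae_eq (φ := φ) (ht m) (M m) (fun n x => -V m n x) ψ,
        transport_ae_eq (φ := φ) (ht m) (M m) (fun n x => -V m n x) fun q => ψ q / φ q.1]
        with p h1 h2
      rw [h1, h2]
    · filter_upwards [transportHat_ae_eq (φ := φ) (ht m) (M m) (fun n x => -V m n x) ψ,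
        transportHat_ae_eq (φ := φ) (ht m) (M m) (fun n x => -V m n x) fun q => ψ q / φ q.1]
        with p h1 h2
      rw [h1, h2]
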